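/- Let $\mathbb{R}^{2,1}$ be Minkowski 3-space and fix a real number $H\neq 0$. **Immersions.** Consider smooth spacelike immersions $f:J\times\mathbb{R}\to\mathbb{R}^{2,1}$, $J$ a nonempty open interval, of constant mean curvature $H$ with respect to one of the two unit normals $N$. Such an $f$ is *equivariant* if there is a continuous homomorphism $t\mapsto R_t$ from $\mathbb{R}$ to the isometry group of $\mathbb{R}^{2,1}$ with $f(x,y+t)=R_tf(x,y)$; it is *rotational* if moreover the $R_t$ fix a common (timelike, spacelike or lightlike) line pointwise or, as the limiting case without axis, are all translations. Two equivariant immersions are *congruent* if they agree up to an isometry of $\mathbb{R}^{2,1}$ and an orientation preserving coordinate change $\varphi$ of the strips with $\varphi(x,y+t)=\varphi(x,y)+(0,kt)$ for some constant $k\ne0$. An equivariant immersion is *maximal* if it is not congruent to the restriction to a proper substrip of an equivariant immersion of constant mean curvature $H$. The moduli space $\mathcal{M}_E$ (resp. $\mathcal{M}_R$) is the set of congruence classes of maximal equivariant (resp. maximal equivariant and rotational) immersions of constant mean curvature $H$. **Parameters.** Let $$R=\{(p,q,v_0)\in\mathbb{R}^3: v_0^4-2pv_0^2+q^2\ge0,\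 (q,v_0)\neq(0,0)\},$$ $$E=\{(p,P,v_0)\in\mathbb{R}\times\mathbb{C}\times\mathbb{R}: v_0^4-2pv_0^2+|P|^2\ge0,\ (P,v_0)\ne(0,0)\}.$$ A solution for $(p,q,v_0)$ is a function $v$ on an open interval containing $0$ with $$v'^2=v^4-2pv^2+q^2,\qquad v''=2v(v^2-p),\qquad v(0)=v_0 .$$ Put $(p_1,q_1,v_1)\sim_R(p_2,q_2,v_2)$ if there are solutions $v_1(x)$ and $v_2(x)$ for the two triples, $r>0$ and $c\in\mathbb{R}$ such that $v_2(x)=rv_1(rx+c)$ or $v_2(x)=-rv_1(rx+c)$, the intervals of definition corresponding under $x\mapsto rx+c$, and $q_2=r^2q_1$. Put $(p,P,v_0)\sim_E(p',P',v_0')$ if there are $q,q'\in\mathbb{R}$ and $\lambda\in\mathbb{S}^1$ with $P=q\lambda^{-2}$, $P'=q'\lambda^{-2}$ and $(p,q,v_0)\sim_R(p',q',v_0')$. An immersion $f$ on $J\times\mathbb{R}$ *belongs to* $(p,P,v_0)\in E$ if, with $z=x+iy$, it is conformal and there are a solution $v$ for $(p,|P|,v_0)$, on an interval containing $J$ and without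 zeros on $J$, and a unit normal $N$ such that the mean curvature with respect to $N$ is $H$, the Hopf differential $\langle N,f_{zz}\rangle dz^2$ is $\frac{P}{2H}dz^2$, and the induced metric is $$\frac{|P|^2}{H^2v(x)^2}\,|dz|^2\ \text{ if } P\ne0,\qquad \frac{v(x)^2}{H^2}\,|dz|^2\ \text{ if } P=0 .$$ (For $P\neq0$ this is the immersion with metric $4v^{-2}|dz|^2$, mean curvature $\pm|P|/2$ and Hopf differential of modulus $1$, rescaled by a homothety to mean curvature $\pm H$; for $P=0$ it is totally umbilic.) It belongs to $(p,q,v_0)\in R$ if it belongs to $(p,P,v_0)$ with $P=q$. **Theorem.** The relations $\sim_E$, $\sim_R$ and congruence are equivalence relations, and the quotient spaces $E/\!\sim_E$ and $R/\!\sim_R$ are not Hausdorff. To every point of $E$ belongs a maximal equivariant immersion of constant mean curvature $H$, and assigning to a point of $E$ the class of any maximal equivariant immersion belonging to it is a well defined bijection $E/\!\sim_E\;\to\mathcal{M}_E$. To every point of $R$ belongs a maximal rotational immersion, and in the same way one obtains a bijection $R/\!\sim_R\;\to\mathcal{M}_R$. Every equivariant (resp. rotational) spacelike immersion of constant mean curvature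 $H$ on a strip is congruent to the restriction of a maximal equivariant (resp. maximal rotational) one to a substrip, and the class of the latter in $\mathcal{M}_E$ (resp. $\mathcal{M}_R$) is unique. -/

import Mathlib

open Set
open scoped ContDiff

noncomputable section

namespace CMC

/-! ### Minkowski space and its isometries -/

/-- The vector space underlying Minkowski 3-space; the scalar product is `mink`. -/
abbrev Mink : Type := Fin 3 → ℝ

/-- The Lorentzian scalar product of signature `(+, +, -)`. -/
def mink (X Y : Mink) : ℝ := X 0 * Y 0 + X 1 * Y 1 - X 2 * Y 2

/-- Isometries of Minkowski space: affine bijections preserving the Lorentzian square of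
differences. All of them are allowed, also those reversing time or orientation. -/
def IsIsometry (A : Mink ≃ᵃ[ℝ] Mink) : Prop :=
  ∀ X Y : Mink, mink (A X - A Y) (A X - A Y) = mink (X - Y) (X - Y)

/-- A continuous homomorphism from the real line to the isometry group. (On the finite dimensional
group of affine bijections continuity is the same as continuity of all orbit maps.) -/
def IsIsometryFlow (R : Multiplicative ℝ →* (Mink ≃ᵃ[ℝ] Mink)) : Prop :=
  (∀ t : ℝ, IsIsometry (R (Multiplicative.ofAdd t))) ∧
    ∀ X : Mink, Continuous fun t : ℝ => R (Multiplicative.ofAdd t) X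

/-! ### Maps on strips and their fundamental forms -/

/-- Nonempty open intervals, possibly unbounded. -/
def IsOpenInterval (J : Set ℝ) : Prop := IsOpen J ∧ J.OrdConnected ∧ J.Nonempty

/-- A map `f` on the strip `J × ℝ` of the `(x, y)`-plane. The values of `f` outside of the strip are
irrelevant. -/
structure StripMap where
  J : Set ℝ
  f : ℝ × ℝ → Mink

/-- The domain of a strip map. -/
def StripMap.dom (S : StripMap) : Set (ℝ × ℝ) := S.J ×ˢ univ

/-- Partial derivative with respect to `x`. -/
def pdx (f : ℝ × ℝ → Mink) (z : ℝ × ℝ) : Mink := fderiv ℝ f z (1, 0)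

/-- Partial derivative with respect to `y`. -/
def pdy (f : ℝ × ℝ → Mink) (z : ℝ × ℝ) : Mink := fderiv ℝ f z (0, 1)

/-- A smooth immersion of a strip whose induced metric is positive definite. -/
def IsSpacelikeImmersion (S : StripMap) : Prop :=
  IsOpenInterval S.J ∧ ContDiffOn ℝ ∞ S.f S.dom ∧
    ∀ z ∈ S.dom, ∀ w : ℝ × ℝ, w ≠ 0 → 0 < mink (fderiv ℝ S.f z w) (fderiv ℝ S.f z w)

/-- `N` is a continuous unit (timelike) normal field along the immersion. -/
def IsUnitNormal (S : StripMap) (N : ℝ × ℝ → Mink) : Prop :=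
  ContinuousOn N S.dom ∧ ∀ z ∈ S.dom,
    mink (N z) (N z) = -1 ∧ mink (N z) (pdx S.f z) = 0 ∧ mink (N z) (pdy S.f z) = 0

/-- The mean curvature `(e G - 2 f F + g E) / (2 (E G - F ^ 2))` with respect to the normal `N`. -/
def meanCurvature (f N : ℝ × ℝ → Mink) (z : ℝ × ℝ) : ℝ :=
  (mink (N z) (pdx (pdx f) z) * mink (pdy f z) (pdy f z)
      - 2 * mink (N z) (pdx (pdy f) z) * mink (pdx f z) (pdy f z)
      + mink (N z) (pdy (pdy f) z) * mink (pdx f z) (pdx f z)) /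
    (2 * (mink (pdx f z) (pdx f z) * mink (pdy f z) (pdy f z) - mink (pdx f z) (pdy f z) ^ 2))

/-- The coefficient `Q = ⟨N, f_zz⟩` of the Hopf differential `Q dz²`, where `z = x + i y`, so that
`f_zz = (f_xx - f_yy - 2 i f_xy) / 4`. -/
def hopf (f N : ℝ × ℝ → Mink) (z : ℝ × ℝ) : ℂ :=
  (((mink (N z) (pdx (pdx f) z) - mink (N z) (pdy (pdy f) z)) / 4 : ℝ) : ℂ)
    - ((mink (N z) (pdx (pdy f) z) / 2 : ℝ) : ℂ) * Complex.I

/-- Spacelike immersions of constant mean curvature `H` with respect to one of the two unit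
normals. -/
def IsCMC (H : ℝ) (S : StripMap) : Prop :=
  IsSpacelikeImmersion S ∧
    ∃ N : ℝ × ℝ → Mink, IsUnitNormal S N ∧ ∀ z ∈ S.dom, meanCurvature S.f N z = H

/-! ### Equivariant and rotational immersions -/

/-- `f (x, y + t) = R_t (f (x, y))`. -/
def IsEquivariantUnder (S : StripMap) (R : Multiplicative ℝ →* (Mink ≃ᵃ[ℝ] Mink)) : Prop :=
  IsIsometryFlow R ∧
    ∀ x ∈ S.J, ∀ y t : ℝ, S.f (x, y + t) = R (Multiplicative.ofAdd t) (S.f (x, y))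

/-- Spacelike immersions of constant mean curvature `H`, equivariant with respect to `y`. -/
def IsEquivariantCMC (H : ℝ) (S : StripMap) : Prop :=
  IsCMC H S ∧ ∃ R, IsEquivariantUnder S R

/-- All `R_t` fix one common line pointwise (rotations about this axis, which may be timelike,
spacelike or lightlike). -/
def HasAxis (R : Multiplicative ℝ →* (Mink ≃ᵃ[ℝ] Mink)) : Prop :=
  ∃ c d : Mink, d ≠ 0 ∧ ∀ t s : ℝ, R (Multiplicative.ofAdd t) (c + s • d) = c + s • d

/-- All `R_t` are translations: the limiting case of rotations, without axis. -/
def IsTranslational (R : Multiplicative ℝ →* (Mink ≃ᵃ[ℝ] Mink)) : Prop :=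
  ∀ t : ℝ, ∃ b : Mink, ∀ X : Mink, R (Multiplicative.ofAdd t) X = X + b

/-- Spacelike immersions of constant mean curvature `H` that are rotational: equivariant under
rotations about an axis, the limiting case of translations being included. -/
def IsRotationalCMC (H : ℝ) (S : StripMap) : Prop :=
  IsCMC H S ∧ ∃ R, IsEquivariantUnder S R ∧ (HasAxis R ∨ IsTranslational R)

/-! ### Coordinate changes, congruence, moduli spaces -/

/-- An orientation preserving coordinate change between the strips `J₁ × ℝ` and `J₂ × ℝ` which
carries translations in `y` to translations in `y`. -/
def IsCoordChange (J₁ J₂ : Set ℝ) (φ : ℝ × ℝ → ℝ × ℝ) : Prop :=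
  BijOn φ (J₁ ×ˢ univ) (J₂ ×ˢ univ) ∧ ContDiffOn ℝ ∞ φ (J₁ ×ˢ univ) ∧
    (∀ z ∈ J₁ ×ˢ (univ : Set ℝ), 0 < (fderiv ℝ φ z).det) ∧
    ∃ k : ℝ, k ≠ 0 ∧ ∀ x ∈ J₁, ∀ y t : ℝ, φ (x, y + t) = φ (x, y) + (0, k * t)

/-- Equality up to coordinate change and ambient isometry. -/
def Congruent (S T : StripMap) : Prop :=
  ∃ (A : Mink ≃ᵃ[ℝ] Mink) (φ : ℝ × ℝ → ℝ × ℝ), IsIsometry A ∧ IsCoordChange S.J T.J φ ∧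
    ∀ z ∈ S.dom, A (S.f z) = T.f (φ z)

/-- Up to coordinate change and ambient isometry, `S` is the restriction of `T` to the strip over
`J' ⊆ T.J`. -/
def ExtendsOver (S T : StripMap) (J' : Set ℝ) : Prop :=
  J' ⊆ T.J ∧ Congruent S ⟨J', T.f⟩

/-- An equivariant immersion which cannot be extended to a larger strip as an equivariant
immersion of constant mean curvature `H`, not even after a coordinate change. -/
def IsMaximal (H : ℝ) (S : StripMap) : Prop :=
  IsEquivariantCMC H S ∧
    ∀ T : StripMap, IsEquivariantCMC H T → ∀ J' : Set ℝ, ExtendsOver S T J' → J' = T.J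

/-- Maximal equivariant spacelike immersions of constant mean curvature `H`. -/
abbrev EquivariantImmersion (H : ℝ) : Type := {S : StripMap // IsMaximal H S}

/-- Maximal rotational spacelike immersions of constant mean curvature `H`. -/
abbrev RotationalImmersion (H : ℝ) : Type := {S : StripMap // IsMaximal H S ∧ IsRotationalCMC H S}

/-- Congruence of maximal equivariant immersions. -/
def congE (H : ℝ) (S T : EquivariantImmersion H) : Prop := Congruent S.1 T.1

/-- Congruence of maximal rotational immersions. -/
def congR (H : ℝ) (S T : RotationalImmersion H) : Prop := Congruent S.1 T.1

/-- Equivariant spacelike immersions of constant mean curvature `H`, up to coordinate change and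
ambient isometry. -/
abbrev EquivariantModuli (H : ℝ) : Type := Quot (congE H)

/-- Rotational spacelike immersions of constant mean curvature `H`, up to coordinate change and
ambient isometry. -/
abbrev RotationalModuli (H : ℝ) : Type := Quot (congR H)

/-! ### The parameter spaces -/

/-- `v` solves `v' ^ 2 = v ^ 4 - 2 p v ^ 2 + q ^ 2` and `v'' = 2 v (v ^ 2 - p)` on `I`. -/
def IsSolution (p q : ℝ) (I : Set ℝ) (v : ℝ → ℝ) : Prop :=
  ∃ w : ℝ → ℝ, ∀ x ∈ I, HasDerivAt v (w x) x ∧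
    HasDerivAt w (2 * v x * (v x ^ 2 - p)) x ∧
    w x ^ 2 = v x ^ 4 - 2 * p * v x ^ 2 + q ^ 2

/-- The solution on the open interval `I ∋ 0` has the initial value `v 0 = v₀`. -/
def IsSolutionFrom (p q v₀ : ℝ) (I : Set ℝ) (v : ℝ → ℝ) : Prop :=
  IsOpenInterval I ∧ (0 : ℝ) ∈ I ∧ IsSolution p q I v ∧ v 0 = v₀

/-- The triples `(p, q, v₀)` with `v₀ ^ 4 - 2 p v₀ ^ 2 + q ^ 2 ≥ 0`, without the triples
`(p, 0, 0)`, which belong to the solution that vanishes identically. -/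
def R : Set (ℝ × ℝ × ℝ) :=
  {s | 0 ≤ s.2.2 ^ 4 - 2 * s.1 * s.2.2 ^ 2 + s.2.1 ^ 2 ∧ ¬(s.2.1 = 0 ∧ s.2.2 = 0)}

/-- The relation between triples `(p₁, q₁, v₁)` and `(p₂, q₂, v₂)`: solutions belonging to them are
related by `v₂(x) = ± r v₁(r x + c)` (including the intervals on which they are defined), and
`q₂ = r ^ 2 q₁` with the sign of `q`. -/
def relR (s t : ℝ × ℝ × ℝ) : Prop :=
  ∃ (I₁ I₂ : Set ℝ) (v₁ v₂ : ℝ → ℝ) (r c σ : ℝ),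
    IsSolutionFrom s.1 s.2.1 s.2.2 I₁ v₁ ∧ IsSolutionFrom t.1 t.2.1 t.2.2 I₂ v₂ ∧
    0 < r ∧ (σ = 1 ∨ σ = -1) ∧ I₁ = (fun x : ℝ => r * x + c) '' I₂ ∧
    (∀ x ∈ I₂, v₂ x = σ * r * v₁ (r * x + c)) ∧ t.2.1 = r ^ 2 * s.2.1

/-- The relation on `R`. -/
def simR (s t : R) : Prop := relR s.1 t.1

/-- The triples `(p, P, v₀)` with `P` complex and `v₀ ^ 4 - 2 p v₀ ^ 2 + |P| ^ 2 ≥ 0`, without the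
triples `(p, 0, 0)`. -/
def E : Set (ℝ × ℂ × ℝ) :=
  {s | 0 ≤ s.2.2 ^ 4 - 2 * s.1 * s.2.2 ^ 2 + ‖s.2.1‖ ^ 2 ∧ ¬(s.2.1 = 0 ∧ s.2.2 = 0)}

/-- The relation on `E`: `P = q l⁻²` and `P' = q' l⁻²` with the same `l` on the unit circle, and
`(p, q, v₀)` is related to `(p', q', v₀')`. -/
def simE (s t : E) : Prop :=
  ∃ (q q' : ℝ) (l : ℂ), ‖l‖ = 1 ∧ s.1.2.1 = (q : ℂ) * (l ^ 2)⁻¹ ∧ t.1.2.1 = (q' : ℂ) * (l ^ 2)⁻¹ ∧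
    relR (s.1.1, q, s.1.2.2) (t.1.1, q', t.1.2.2)

/-! ### The surface belonging to a parameter -/

/-- The conformal factor `ℓ` of the metric `ℓ ^ 2 (dx ^ 2 + dy ^ 2)` at a point where the solution
has the value `v`. For `P ≠ 0` the metric is the metric `4 v⁻² |dz|²`, for which `|Q| = 1` and the
mean curvature is `± |P| / 2`, rescaled by the homothety of ratio `|P| / (2 |H|)` so that the mean
curvature becomes `± H`. -/
def confFactor (H : ℝ) (P : ℂ) (v : ℝ) : ℝ :=
  if P = 0 then v / H else ‖P‖ / (H * v)

/-- The immersion `S` belongs to `(p, P, v₀)`: `S` is conformal, its metric is given by a solution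
`v` with `v 0 = v₀`, without zeros on the strip, and with respect to one and the same unit normal
its mean curvature is `H` and its Hopf differential is `P / (2 H) dz²`. -/
def BelongsTo (H : ℝ) (s : ℝ × ℂ × ℝ) (S : StripMap) : Prop :=
  ∃ (I : Set ℝ) (v : ℝ → ℝ) (N : ℝ × ℝ → Mink),
    IsSolutionFrom s.1 ‖s.2.1‖ s.2.2 I v ∧ S.J ⊆ I ∧ (∀ x ∈ S.J, v x ≠ 0) ∧
    IsUnitNormal S N ∧ ∀ z ∈ S.dom,
      mink (pdx S.f z) (pdx S.f z) = confFactor H s.2.1 (v z.1) ^ 2 ∧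
      mink (pdy S.f z) (pdy S.f z) = confFactor H s.2.1 (v z.1) ^ 2 ∧
      mink (pdx S.f z) (pdy S.f z) = 0 ∧
      meanCurvature S.f N z = H ∧
      hopf S.f N z = s.2.1 / (2 * (H : ℂ))

end CMC

end

noncomputable section

namespace CMC

open Filter Topology Metric
open scoped NNReal

/-! ### Open intervals -/

/-! The first fundamental form of an equivariant surface depends on x only, so explicit integration
gives isothermal coordinates adapted to the group, with metric m|dz|², m = (g/H)², g = g(x) > 0.
Since H ≠ 0, the normal is determined by f, namely N = -Δf/(2Hm); hence it is smooth and
equivariant, and the second fundamental form depends on x only as well. The Codazzi equations then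
say that the coefficient P/(2H) of the Hopf differential is constant. The Gauss equation becomes
(log g)'' = g² - |P|²g⁻², and p is its first integral: g'² = g⁴ - 2pg² + |P|². These are
`ConfSurf.exists_isConf` and `exists_isConf`. Conversely, every positive solution g is realized
(`exists_surface_of_sol`): a frame is integrated along the profile curve, the Gauss-Codazzi
equations make the infinitesimal motion in the y-direction constant, and the affine flow it
generates sweeps out the surface.

Coordinate changes that respect y-translations, conformality and orientation are the maps z ↦ kz +
const with real k ≠ 0. Together with the rigidity theorem (`ConfSurf.exists_isometry`), this turns
congruence into g(x) = |k| g'(kx + c), p = k²p', P = k²P' (`IsConf.congruent`, `Congruent.data'`). A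
surface is maximal exactly when g is inextendable as a positive solution (`IsConf.isMaximal`,
`IsConf.inextendable`), so existence and uniqueness of maximal extensions become statements about an
ordinary differential equation.

The parameters describe v = ±g if P = 0 and v = ±|P|/g otherwise, the equation being invariant under
v ↦ |P|/v. A maximal solution v may have zeros, where the metric blows up, and a maximal surface
lives over one component of {v ≠ 0}. A triple (p, P, v₀) fixes v only up to x ↦ -x, and selects no
component. Both ambiguities are harmless: reflections in midpoints of zeros preserve |v| and carry
any component to any other (`MaxSol.exists_symmetry`), and x ↦ e - x extends to the orientation
preserving z ↦ e - z, which fixes dz². Conversely, congruent surfaces have solutions related by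
scaling, shift and sign (`congruent_of_orb`, `orb_of_congruent`).

A surface is rotational exactly when P is real: an axis or translational symmetry forces ⟨N, f_xy⟩ =
0, and if this vanishes the axis can be written down in terms of the frame. The quotients fail to be
Hausdorff because of p = |P| = 1: the values of tanh fill one class, and the constant solution 1 is
a different class in its closure. -/

theorem IsOpenInterval.inter {I J : Set ℝ} (hI : IsOpenInterval I) (hJ : IsOpenInterval J) {x : ℝ}
    (hxI : x ∈ I) (hxJ : x ∈ J) : IsOpenInterval (I ∩ J) :=
  ⟨hI.1.inter hJ.1, hI.2.1.inter hJ.2.1, x, hxI, hxJ⟩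

theorem IsOpenInterval.isPreconnected {I : Set ℝ} (hI : IsOpenInterval I) : IsPreconnected I :=
  hI.2.1.isPreconnected

theorem IsOpenInterval.exists_Icc {I : Set ℝ} (hI : IsOpenInterval I) {x y : ℝ} (hx : x ∈ I)
    (hy : y ∈ I) : ∃ a b, x ∈ Ioo a b ∧ y ∈ Ioo a b ∧ Icc a b ⊆ I := by
  have key : ∀ z ∈ I, ∃ a ∈ I, ∃ b ∈ I, a < z ∧ z < b := by
    intro z hz
    obtain ⟨ε, hε, h⟩ := Metric.isOpen_iff.1 hI.1 z hz
    refine ⟨z - ε / 2, h ?_, z + ε / 2, h ?_, by linarith, by linarith⟩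
    · rw [Metric.mem_ball, Real.dist_eq, abs_lt]; constructor <;> linarith
    · rw [Metric.mem_ball, Real.dist_eq, abs_lt]; constructor <;> linarith
  rcases le_total x y with h | h
  · obtain ⟨a, ha, -, -, hax, -⟩ := key x hx
    obtain ⟨-, -, b, hb, -, hyb⟩ := key y hy
    exact ⟨a, b, ⟨hax, by linarith⟩, ⟨by linarith, hyb⟩, hI.2.1.out ha hb⟩
  · obtain ⟨a, ha, -, -, hax, -⟩ := key y hy
    obtain ⟨-, -, b, hb, -, hyb⟩ := key x hx
    exact ⟨a, b, ⟨by linarith, hyb⟩, ⟨hax, by linarith⟩, hI.2.1.out ha hb⟩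

theorem isOpenInterval_Ioo {a b : ℝ} (h : a < b) : IsOpenInterval (Ioo a b) :=
  ⟨isOpen_Ioo, ordConnected_Ioo, nonempty_Ioo.2 h⟩

theorem IsOpenInterval.preimage {I : Set ℝ} (hI : IsOpenInterval I) {k : ℝ} (hk : k ≠ 0) (c : ℝ) :
    IsOpenInterval ((fun x => k * x + c) ⁻¹' I) := by
  refine ⟨hI.1.preimage (by fun_prop), ?_, ?_⟩
  · rcases hk.lt_or_gt with h | h
    · refine hI.2.1.preimage_anti fun x y hxy => ?_
      show k * y + c ≤ k * x + c
      nlinarith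
    · refine hI.2.1.preimage_mono fun x y hxy => ?_
      show k * x + c ≤ k * y + c
      nlinarith
  · obtain ⟨x, hx⟩ := hI.2.2
    refine ⟨(x - c) / k, ?_⟩
    show k * ((x - c) / k) + c ∈ I
    rwa [mul_div_cancel₀ _ hk, sub_add_cancel]

theorem isOpenInterval_sUnion {𝒮 : Set (Set ℝ)} (h : ∀ I ∈ 𝒮, IsOpenInterval I) {x : ℝ}
    (hx : ∀ I ∈ 𝒮, x ∈ I) (hne : 𝒮.Nonempty) : IsOpenInterval (⋃₀ 𝒮) := by
  refine ⟨isOpen_sUnion fun I hI => (h I hI).1, ?_, ?_⟩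
  · rw [← isPreconnected_iff_ordConnected]
    exact isPreconnected_sUnion x 𝒮 hx fun I hI => (h I hI).isPreconnected
  · obtain ⟨I, hI⟩ := hne
    exact ⟨x, I, hI, hx I hI⟩

theorem isOpenInterval_component {U : Set ℝ} (hU : IsOpen U) {x : ℝ} (hx : x ∈ U) :
    IsOpenInterval (connectedComponentIn U x) :=
  ⟨hU.connectedComponentIn, isPreconnected_connectedComponentIn.ordConnected,
    x, mem_connectedComponentIn hx⟩

/-! ### Ordinary differential equations -/

/-- Functions which agree on the overlaps of their domains have a common extension. -/
theorem exists_glue {E : Type*} [Zero E] (𝒮 : Set (Set ℝ × (ℝ → E)))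
    (h : ∀ s ∈ 𝒮, ∀ t ∈ 𝒮, EqOn s.2 t.2 (s.1 ∩ t.1)) :
    ∃ y : ℝ → E, ∀ s ∈ 𝒮, EqOn y s.2 s.1 := by
  classical
  refine ⟨fun x => if hx : ∃ s ∈ 𝒮, x ∈ s.1 then hx.choose.2 x else 0, fun s hs x hx => ?_⟩
  have hex : ∃ s ∈ 𝒮, x ∈ s.1 := ⟨s, hs, hx⟩
  simp only [dif_pos hex]
  exact h _ hex.choose_spec.1 _ hs ⟨hex.choose_spec.2, hx⟩

theorem exists_bounded_solution {E : Type*} [NormedAddCommGroup E] [NormedSpace ℝ E]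
    [CompleteSpace E] {f : ℝ → E → E} {a b : ℝ} {K L : ℝ≥0} {t₀ : ℝ} (ht₀ : t₀ ∈ Icc a b) (y₀ : E)
    (hK : ∀ t ∈ Icc a b, LipschitzWith K (f t)) (hc : ∀ y, ContinuousOn (fun t => f t y) (Icc a b))
    (hL : ∀ t ∈ Icc a b, ∀ y, ‖f t y‖ ≤ L) :
    ∃ y : ℝ → E, y t₀ = y₀ ∧ ∀ t ∈ Icc a b, HasDerivWithinAt y (f t (y t)) (Icc a b) t := by
  have hm : 0 ≤ max (b - t₀) (t₀ - a) := le_max_of_le_left (by linarith [ht₀.2])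
  have : IsPicardLindelof f (⟨t₀, ht₀⟩ : Icc a b) y₀ (L * ⟨_, hm⟩) 0 L K :=
    { lipschitzOnWith := fun t ht => (hK t ht).lipschitzOnWith
      continuousOn := fun x _ => hc x
      norm_le := fun t ht x _ => hL t ht x
      mul_max_le := by
        rw [NNReal.coe_zero, sub_zero]
        exact le_rfl }
  exact this.exists_eq_forall_mem_Icc_hasDerivWithinAt₀

/-- The truncation of real numbers at `±r`. -/
def trunc (r : ℝ) (x : ℝ) : ℝ := max (-r) (min r x)

theorem trunc_of_abs_le {r x : ℝ} (h : |x| ≤ r) : trunc r x = x := by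
  rw [abs_le] at h
  rw [trunc, min_eq_right h.2, max_eq_right h.1]

theorem abs_trunc_le {r : ℝ} (hr : 0 ≤ r) (x : ℝ) : |trunc r x| ≤ r := by
  rw [abs_le, trunc]
  exact ⟨le_max_left _ _, max_le (by linarith) (min_le_left _ _)⟩

theorem abs_trunc_le_abs {r : ℝ} (hr : 0 ≤ r) (x : ℝ) : |trunc r x| ≤ |x| := by
  rcases le_total |x| r with h | h
  · rw [trunc_of_abs_le h]
  · exact (abs_trunc_le hr x).trans h

theorem abs_trunc_sub_le (r x y : ℝ) : |trunc r x - trunc r y| ≤ |x - y| := by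
  unfold trunc
  refine (abs_max_sub_max_le_max _ _ _ _).trans ?_
  rw [sub_self, abs_zero]
  refine max_le (abs_nonneg _) ((abs_min_sub_min_le_max _ _ _ _).trans ?_)
  rw [sub_self, abs_zero]
  exact max_le (abs_nonneg _) le_rfl

/-- The right hand side of the frame equations, truncated at `r`. -/
def frameField (α β : ℝ → ℝ) (r : ℝ) (t : ℝ) (y : ℝ × ℝ × ℝ) : ℝ × ℝ × ℝ :=
  (α t * trunc r y.2.2, β t * trunc r y.2.2, α t * trunc r y.1 + β t * trunc r y.2.1)

theorem norm_triple_le {y : ℝ × ℝ × ℝ} {r : ℝ} :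
    ‖y‖ ≤ r ↔ |y.1| ≤ r ∧ |y.2.1| ≤ r ∧ |y.2.2| ≤ r := by
  rw [Prod.norm_def, Prod.norm_def, max_le_iff, max_le_iff]; rfl

theorem norm_frame_le {a b x y z K M : ℝ} (ha : |a| ≤ K) (hb : |b| ≤ K)
    (hx : |x| ≤ M) (hy : |y| ≤ M) (hz : |z| ≤ M) :
    ‖((a * z, b * z, a * x + b * y) : ℝ × ℝ × ℝ)‖ ≤ 2 * K * M := by
  have hK : 0 ≤ K := (abs_nonneg _).trans ha
  have hM : 0 ≤ M := (abs_nonneg _).trans hx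
  have h : ∀ {s t : ℝ}, |s| ≤ K → |t| ≤ M → |s * t| ≤ K * M := fun hs ht => by
    rw [abs_mul]; exact mul_le_mul hs ht (abs_nonneg _) hK
  have hKM := mul_nonneg hK hM
  rw [norm_triple_le]
  refine ⟨(h ha hz).trans (by linarith), (h hb hz).trans (by linarith), ?_⟩
  exact (abs_add_le _ _).trans (by linarith [h ha hx, h hb hy])

theorem norm_frameField_le {α β : ℝ → ℝ} {r K t : ℝ} (ha : |α t| ≤ K) (hb : |β t| ≤ K)
    (hr : 0 ≤ r) (y : ℝ × ℝ × ℝ) : ‖frameField α β r t y‖ ≤ 2 * K * min r ‖y‖ := by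
  have h := (norm_triple_le (y := y)).1 le_rfl
  refine norm_frame_le ha hb ?_ ?_ ?_ <;> refine le_min (abs_trunc_le hr _) ?_
  · exact (abs_trunc_le_abs hr _).trans h.1
  · exact (abs_trunc_le_abs hr _).trans h.2.1
  · exact (abs_trunc_le_abs hr _).trans h.2.2

theorem lipschitzWith_frameField {α β : ℝ → ℝ} (r : ℝ) {K : ℝ≥0} {t : ℝ} (ha : |α t| ≤ K)
    (hb : |β t| ≤ K) : LipschitzWith (2 * K) (frameField α β r t) := by
  refine LipschitzWith.of_dist_le_mul fun y z => ?_
  rw [dist_eq_norm, dist_eq_norm]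
  have h := (norm_triple_le (y := y - z)).1 le_rfl
  have := norm_frame_le ha hb ((abs_trunc_sub_le r _ _).trans h.1)
    ((abs_trunc_sub_le r _ _).trans h.2.1) ((abs_trunc_sub_le r _ _).trans h.2.2)
  refine (le_of_eq (congrArg norm ?_)).trans this
  refine Prod.ext ?_ (Prod.ext ?_ ?_) <;> simp [frameField] <;> ring

/-- The frame equations as a linear system. -/
def IsFrameSol (α β : ℝ → ℝ) (I : Set ℝ) (y : ℝ → ℝ × ℝ × ℝ) : Prop :=
  ∀ x ∈ I, HasDerivAt y
    (α x * (y x).2.2, β x * (y x).2.2, α x * (y x).1 + β x * (y x).2.1) x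

/-- Truncating the linear field makes it bounded and globally Lipschitz, so that the Picard-Lindelöf
theorem applies on the whole interval at once. Grönwall's inequality then shows that the solution
never reaches the truncation. -/
theorem exists_frameSol_Ioo {α β : ℝ → ℝ} {a b t₀ : ℝ} (ht₀ : t₀ ∈ Icc a b)
    (hα : ContinuousOn α (Icc a b)) (hβ : ContinuousOn β (Icc a b)) (y₀ : ℝ × ℝ × ℝ) :
    ∃ y, y t₀ = y₀ ∧ IsFrameSol α β (Ioo a b) y := by
  obtain ⟨A, hA⟩ := isCompact_Icc.exists_bound_of_continuousOn hα
  obtain ⟨B, hB⟩ := isCompact_Icc.exists_bound_of_continuousOn hβ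
  have hK0 : 0 ≤ max A B := (norm_nonneg _).trans ((hA t₀ ht₀).trans (le_max_left _ _))
  obtain ⟨K, hKA⟩ : ∃ K : ℝ≥0, (K : ℝ) = max A B := ⟨⟨_, hK0⟩, rfl⟩
  have ha : ∀ t ∈ Icc a b, |α t| ≤ K := fun t ht =>
    (hA t ht).trans (hKA ▸ le_max_left _ _)
  have hb : ∀ t ∈ Icc a b, |β t| ≤ K := fun t ht =>
    (hB t ht).trans (hKA ▸ le_max_right _ _)
  -- The Grönwall bound for a field of norm at most 2K‖y‖ over a time of at most b - a.
  set r : ℝ := ‖y₀‖ * Real.exp (2 * K * (b - a)) with hrdef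
  have hr : 0 ≤ r := by positivity
  have hbd : ∀ t ∈ Icc a b, ∀ y, ‖frameField α β r t y‖ ≤ 2 * K * ‖y‖ := fun t ht y =>
    (norm_frameField_le (ha t ht) (hb t ht) hr y).trans
      (mul_le_mul_of_nonneg_left (min_le_right _ _) (by positivity))
  obtain ⟨y, hy0, hy⟩ := exists_bounded_solution (L := 2 * K * ⟨r, hr⟩) ht₀ y₀
    (fun t ht => lipschitzWith_frameField r (ha t ht) (hb t ht))
    (fun y => by
      unfold frameField
      exact ((hα.mul continuousOn_const).prodMk ((hβ.mul continuousOn_const).prodMk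
        ((hα.mul continuousOn_const).add (hβ.mul continuousOn_const)))))
    (fun t ht y => (norm_frameField_le (ha t ht) (hb t ht) hr y).trans
      (mul_le_mul_of_nonneg_left (min_le_left _ _) (by positivity)))
  have hexp : ∀ {s : ℝ}, s ≤ b - a → ‖y₀‖ * Real.exp (2 * K * s) ≤ r := fun hs => by
    rw [hrdef]
    refine mul_le_mul_of_nonneg_left (Real.exp_le_exp.2 ?_) (norm_nonneg _)
    exact mul_le_mul_of_nonneg_left hs (by positivity)
  have hcont : ContinuousOn y (Icc a b) := fun t ht => (hy t ht).continuousWithinAt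
  have hder : ∀ t ∈ Ioo a b, HasDerivAt y (frameField α β r t (y t)) t := fun t ht =>
    (hy t (Ioo_subset_Icc_self ht)).hasDerivAt (Icc_mem_nhds ht.1 ht.2)
  have hbound : ∀ t ∈ Icc a b, ‖y t‖ ≤ r := by
    intro t ht
    rcases le_total t₀ t with h | h
    · have := norm_le_gronwallBound_of_norm_deriv_right_le (f := y) (ε := 0) (K := 2 * K)
        (δ := ‖y₀‖) (a := t₀) (b := b) (f' := fun t => frameField α β r t (y t))
        (hcont.mono (Icc_subset_Icc_left ht₀.1))
        (fun s hs => (hy s ⟨ht₀.1.trans hs.1, hs.2.le⟩).mono_of_mem_nhdsWithin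
          (mem_of_superset (Icc_mem_nhdsGE hs.2) (Icc_subset_Icc_left (ht₀.1.trans hs.1))))
        (by rw [hy0]) (fun s hs => by simpa using hbd s ⟨ht₀.1.trans hs.1, hs.2.le⟩ (y s)) t
        ⟨h, ht.2⟩
      rw [gronwallBound_ε0] at this
      exact this.trans (hexp (by linarith [ht.2, ht₀.1]))
    -- To the left of t₀ the same estimate is applied to the time-reversed solution.
    · have := norm_le_gronwallBound_of_norm_deriv_right_le (f := fun s => y (-s)) (ε := 0)
        (K := 2 * K) (δ := ‖y₀‖) (a := -t₀) (b := -a)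
        (f' := fun s => -frameField α β r (-s) (y (-s)))
        (hcont.comp continuous_neg.continuousOn fun s hs => ⟨by linarith [hs.2],
          by linarith [hs.1, ht₀.2]⟩)
        (fun s hs => by
          have h1 : -s ∈ Icc a b := ⟨by linarith [hs.2], by linarith [hs.1, ht₀.2]⟩
          have h2 : HasDerivWithinAt y (frameField α β r (-s) (y (-s))) (Iic (-s)) (-s) :=
            (hy _ h1).mono_of_mem_nhdsWithin (mem_of_superset (Icc_mem_nhdsLE
              (by linarith [hs.2] : a < -s)) (Icc_subset_Icc_right h1.2))
          have := h2.scomp s (hasDerivAt_neg s).hasDerivWithinAt (s := Ici s)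
            (fun u hu => by simpa using hu)
          simpa using! this)
        (by simp [hy0]) (fun s hs => by
          simpa using hbd (-s) ⟨by linarith [hs.2], by linarith [hs.1, ht₀.2]⟩ (y (-s))) (-t)
        ⟨by linarith, by linarith [ht.1]⟩
      rw [gronwallBound_ε0] at this
      simp only [neg_neg] at this
      exact this.trans (hexp (by linarith [ht.1, ht₀.2]))
  refine ⟨y, hy0, fun t ht => ?_⟩
  have h := norm_triple_le.1 (hbound t (Ioo_subset_Icc_self ht))
  have := hder t ht
  simpa only [frameField, trunc_of_abs_le h.1, trunc_of_abs_le h.2.1, trunc_of_abs_le h.2.2]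
    using this

theorem IsFrameSol.eqOn {α β : ℝ → ℝ} {a b t₀ : ℝ} (ht₀ : t₀ ∈ Ioo a b)
    (hα : ContinuousOn α (Icc a b)) (hβ : ContinuousOn β (Icc a b)) {y z : ℝ → ℝ × ℝ × ℝ}
    (hy : IsFrameSol α β (Ioo a b) y) (hz : IsFrameSol α β (Ioo a b) z) (h : y t₀ = z t₀) :
    EqOn y z (Ioo a b) := by
  obtain ⟨A, hA⟩ := isCompact_Icc.exists_bound_of_continuousOn hα
  obtain ⟨B, hB⟩ := isCompact_Icc.exists_bound_of_continuousOn hβ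
  have hK0 : 0 ≤ max A B :=
    (norm_nonneg _).trans ((hA t₀ (Ioo_subset_Icc_self ht₀)).trans (le_max_left _ _))
  obtain ⟨K, hKA⟩ : ∃ K : ℝ≥0, (K : ℝ) = max A B := ⟨⟨_, hK0⟩, rfl⟩
  refine ODE_solution_unique_of_mem_Ioo (K := 2 * K) (s := fun _ => univ)
    (v := fun x y => (α x * y.2.2, β x * y.2.2, α x * y.1 + β x * y.2.1))
    (fun t ht => LipschitzWith.lipschitzOnWith (LipschitzWith.of_dist_le_mul fun y z => ?_)) ht₀
    (fun t ht => ⟨hy t ht, trivial⟩) (fun t ht => ⟨hz t ht, trivial⟩) h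
  rw [dist_eq_norm, dist_eq_norm]
  have h := (norm_triple_le (y := y - z)).1 le_rfl
  have := norm_frame_le ((hA t (Ioo_subset_Icc_self ht)).trans (hKA ▸ le_max_left _ _ : A ≤ K))
    ((hB t (Ioo_subset_Icc_self ht)).trans (hKA ▸ le_max_right _ _ : B ≤ K)) h.1 h.2.1 h.2.2
  refine (le_of_eq (congrArg norm ?_)).trans this
  refine Prod.ext ?_ (Prod.ext ?_ ?_) <;> simp <;> ring

/-- The frame equations have global solutions. -/
theorem exists_frameSol {α β : ℝ → ℝ} {J : Set ℝ} (hJ : IsOpenInterval J) (hα : ContinuousOn α J)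
    (hβ : ContinuousOn β J) {t₀ : ℝ} (ht₀ : t₀ ∈ J) (y₀ : ℝ × ℝ × ℝ) :
    ∃ y, y t₀ = y₀ ∧ IsFrameSol α β J y := by
  obtain ⟨y, hy⟩ := exists_glue
    {s : Set ℝ × (ℝ → ℝ × ℝ × ℝ) | ∃ a b, s.1 = Ioo a b ∧ t₀ ∈ Ioo a b ∧ Icc a b ⊆ J ∧
      s.2 t₀ = y₀ ∧ IsFrameSol α β (Ioo a b) s.2} (by
    rintro ⟨_, y⟩ ⟨a, b, rfl, h1, h2, h3, h4⟩ ⟨_, z⟩ ⟨a', b', rfl, h1', h2', h3', h4'⟩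
    rw [Ioo_inter_Ioo]
    have hsub : Icc (max a a') (min b b') ⊆ J :=
      (Icc_subset_Icc (le_max_left _ _) (min_le_left _ _)).trans h2
    exact IsFrameSol.eqOn (t₀ := t₀) ⟨max_lt h1.1 h1'.1, lt_min h1.2 h1'.2⟩ (hα.mono hsub)
      (hβ.mono hsub)
      (fun x hx => h4 x ⟨(le_max_left _ _).trans_lt hx.1, hx.2.trans_le (min_le_left _ _)⟩)
      (fun x hx => h4' x ⟨(le_max_right _ _).trans_lt hx.1, hx.2.trans_le (min_le_right _ _)⟩)
      (h3.trans h3'.symm))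
  have key : ∀ x ∈ J, ∃ a b z, x ∈ Ioo a b ∧ t₀ ∈ Ioo a b ∧ z t₀ = y₀ ∧
      IsFrameSol α β (Ioo a b) z ∧ EqOn y z (Ioo a b) := by
    intro x hx
    obtain ⟨a, b, h1, h2, h3⟩ := hJ.exists_Icc hx ht₀
    obtain ⟨z, hz0, hz⟩ := exists_frameSol_Ioo (Ioo_subset_Icc_self h2) (hα.mono h3) (hβ.mono h3) y₀
    exact ⟨a, b, z, h1, h2, hz0, hz, hy (Ioo a b, z) ⟨a, b, rfl, h2, h3, hz0, hz⟩⟩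
  refine ⟨y, ?_, fun x hx => ?_⟩
  · obtain ⟨a, b, z, -, h2, h3, -, h5⟩ := key t₀ ht₀
    rw [h5 h2, h3]
  · obtain ⟨a, b, z, h1, -, -, h4, h5⟩ := key x hx
    rw [h5 h1]
    exact (h4 x h1).congr_of_eventuallyEq (h5.eventuallyEq_of_mem (Ioo_mem_nhds h1.1 h1.2))

end CMC
end

noncomputable section

namespace CMC

open Filter Topology Metric
open scoped NNReal

/-! ### The differential equation of the parameters -/

theorem IsOpenInterval.eq_of_hasDerivAt_zero {F : Type*} [NormedAddCommGroup F] [NormedSpace ℝ F]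
    {I : Set ℝ} (hI : IsOpenInterval I) {f : ℝ → F} (hf : ∀ x ∈ I, HasDerivAt f 0 x) {x y : ℝ}
    (hx : x ∈ I) (hy : y ∈ I) : f x = f y :=
  hI.1.is_const_of_deriv_eq_zero hI.isPreconnected
    (fun x hx => (hf x hx).differentiableAt.differentiableWithinAt) (fun x hx => (hf x hx).deriv)
    hx hy

/-- Solutions `v` of `v' ^ 2 = v ^ 4 - 2 p v ^ 2 + Q`, `v'' = 2 v (v ^ 2 - p)` together with
their derivative `w`. -/
def Sol (p Q : ℝ) (I : Set ℝ) (v w : ℝ → ℝ) : Prop :=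
  ∀ x ∈ I, HasDerivAt v (w x) x ∧ HasDerivAt w (2 * v x * (v x ^ 2 - p)) x ∧
    w x ^ 2 = v x ^ 4 - 2 * p * v x ^ 2 + Q

variable {p Q k ρ : ℝ} {I J : Set ℝ} {v w v' w' : ℝ → ℝ}

theorem Sol.mono (h : Sol p Q I v w) (hJ : J ⊆ I) : Sol p Q J v w := fun x hx => h x (hJ hx)

theorem Sol.congr (h : Sol p Q I v w) (hI : IsOpen I) (hv : EqOn v' v I) (hw : EqOn w' w I) :
    Sol p Q I v' w' := fun x hx => by
  obtain ⟨h1, h2, h3⟩ := h x hx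
  rw [hv hx, hw hx]
  exact ⟨h1.congr_of_eventuallyEq (hv.eventuallyEq_of_mem (hI.mem_nhds hx)),
    h2.congr_of_eventuallyEq (hw.eventuallyEq_of_mem (hI.mem_nhds hx)), h3⟩

theorem Sol.eqOn_deriv (h : Sol p Q I v w) {p' Q' : ℝ} (h' : Sol p' Q' I v' w') (hI : IsOpen I)
    (hv : EqOn v v' I) : EqOn w w' I := fun x hx =>
  ((h x hx).1.congr_of_eventuallyEq
    (hv.symm.eventuallyEq_of_mem (hI.mem_nhds hx))).unique (h' x hx).1

/-- The scaling invariance of the equation. Only ρ² = k² matters because the equation is odd in v;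
this lets one statement cover scalings, shifts, reflections of x and sign changes of v. -/
theorem Sol.comp (h : Sol p Q I v w) (hρ : ρ ^ 2 = k ^ 2) (c : ℝ) :
    Sol (k ^ 2 * p) (k ^ 4 * Q) ((fun x => k * x + c) ⁻¹' I) (fun x => ρ * v (k * x + c))
      (fun x => ρ * k * w (k * x + c)) := by
  intro x hx
  obtain ⟨h1, h2, h3⟩ := h _ hx
  have hlin : HasDerivAt (fun x => k * x + c) k x := by
    simpa using ((hasDerivAt_id x).const_mul k).add_const c
  refine ⟨?_, ?_, ?_⟩
  · refine HasDerivAt.congr_deriv ((h1.comp x hlin).const_mul ρ) ?_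
    ring
  · refine HasDerivAt.congr_deriv ((h2.comp x hlin).const_mul (ρ * k)) ?_
    linear_combination -(2 * ρ * (v (k * x + c)) ^ 3) * hρ
  · have hρ4 : ρ ^ 4 = k ^ 4 := by linear_combination (ρ ^ 2 + k ^ 2) * hρ
    rw [mul_pow, mul_pow, h3]
    linear_combination (k ^ 2 * v (k * x + c) ^ 4 - 2 * p * k ^ 2 * v (k * x + c) ^ 2 + k ^ 2 * Q
      + 2 * p * k ^ 2 * v (k * x + c) ^ 2) * hρ - v (k * x + c) ^ 4 * hρ4

/-- Dividing v'² = v⁴ - 2pv² + q² by v⁴ exchanges the roles of the leading and the constant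
coefficient. This is the passage between v and the conformal factor when P ≠ 0. -/
theorem Sol.inv {q : ℝ} (h : Sol p (q ^ 2) I v w) (hv : ∀ x ∈ I, v x ≠ 0) :
    Sol p (q ^ 2) I (fun x => q / v x) (fun x => -(q * w x) / v x ^ 2) := by
  intro x hx
  obtain ⟨h1, h2, h3⟩ := h x hx
  have h0 := hv x hx
  refine ⟨?_, ?_, ?_⟩
  · refine HasDerivAt.congr_deriv ((hasDerivAt_const x q).div h1 h0) ?_
    ring
  · refine HasDerivAt.congr_deriv (((h2.const_mul q).neg).div (h1.pow 2) (pow_ne_zero 2 h0)) ?_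
    simp only [Pi.neg_apply]
    field_simp
    push_cast
    linear_combination (2 * q * v x) * h3
  · field_simp
    linear_combination q ^ 2 * h3

/-- The vector field of the differential equation. -/
def field (p : ℝ) (y : ℝ × ℝ) : ℝ × ℝ := (y.2, 2 * y.1 * (y.1 ^ 2 - p))

theorem contDiff_field (p : ℝ) : ContDiff ℝ 1 (field p) := by unfold field; fun_prop

theorem Sol.hasDerivAt_prod (h : Sol p Q I v w) {x : ℝ} (hx : x ∈ I) :
    HasDerivAt (fun x => (v x, w x)) (field p (v x, w x)) x := (h x hx).1.prodMk (h x hx).2.1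

theorem Sol.continuousOn (h : Sol p Q I v w) : ContinuousOn v I := fun x hx =>
  (h x hx).1.continuousAt.continuousWithinAt

theorem Sol.continuousOn_deriv (h : Sol p Q I v w) : ContinuousOn w I := fun x hx =>
  (h x hx).2.1.continuousAt.continuousWithinAt

theorem Sol.eqOn (hI : IsOpenInterval I) (h : Sol p Q I v w) {Q' : ℝ} (h' : Sol p Q' I v' w')
    {x₀ : ℝ} (hx₀ : x₀ ∈ I) (hv : v x₀ = v' x₀) (hw : w x₀ = w' x₀) : EqOn v v' I ∧ EqOn w w' I := by
  have key : ∀ x ∈ I, (v x, w x) = (v' x, w' x) := by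
    intro x hx
    obtain ⟨a, b, h1, h2, h3⟩ := hI.exists_Icc hx hx₀
    have hc : ContinuousOn (fun x => (v x, w x)) (Icc a b) :=
      ((h.continuousOn).prodMk h.continuousOn_deriv).mono h3
    have hc' : ContinuousOn (fun x => (v' x, w' x)) (Icc a b) :=
      ((h'.continuousOn).prodMk h'.continuousOn_deriv).mono h3
    obtain ⟨M, hM⟩ := isCompact_Icc.exists_bound_of_continuousOn hc
    obtain ⟨M', hM'⟩ := isCompact_Icc.exists_bound_of_continuousOn hc'
    obtain ⟨K, hK⟩ := (contDiff_field p).contDiffOn.exists_lipschitzOnWith one_ne_zero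
      (convex_closedBall (0 : ℝ × ℝ) (max M M')) (isCompact_closedBall _ _)
    refine ODE_solution_unique_of_mem_Ioo (v := fun _ => field p)
      (s := fun _ => closedBall 0 (max M M')) (fun _ _ => hK) h2
      (fun t ht => ⟨h.hasDerivAt_prod (h3 (Ioo_subset_Icc_self ht)), ?_⟩)
      (fun t ht => ⟨h'.hasDerivAt_prod (h3 (Ioo_subset_Icc_self ht)), ?_⟩) (Prod.ext hv hw) h1
    · rw [mem_closedBall_zero_iff]
      exact (hM t (Ioo_subset_Icc_self ht)).trans (le_max_left _ _)
    · rw [mem_closedBall_zero_iff]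
      exact (hM' t (Ioo_subset_Icc_self ht)).trans (le_max_right _ _)
  exact ⟨fun x hx => congrArg Prod.fst (key x hx), fun x hx => congrArg Prod.snd (key x hx)⟩

/-- The first-order equation is conservation of energy for the second-order one, so it needs to hold
at one point only. -/
theorem sol_of_energy (hI : IsOpenInterval I)
    (h : ∀ x ∈ I, HasDerivAt v (w x) x ∧ HasDerivAt w (2 * v x * (v x ^ 2 - p)) x) {x₀ : ℝ}
    (hx₀ : x₀ ∈ I) (h0 : w x₀ ^ 2 = v x₀ ^ 4 - 2 * p * v x₀ ^ 2 + Q) : Sol p Q I v w := by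
  intro x hx
  refine ⟨(h x hx).1, (h x hx).2, ?_⟩
  have : w x ^ 2 - (v x ^ 4 - 2 * p * v x ^ 2) = w x₀ ^ 2 - (v x₀ ^ 4 - 2 * p * v x₀ ^ 2) := by
    refine hI.eq_of_hasDerivAt_zero
      (f := fun x => w x ^ 2 - (v x ^ 4 - 2 * p * v x ^ 2)) (fun y hy => ?_) hx hx₀
    obtain ⟨h1, h2⟩ := h y hy
    refine HasDerivAt.congr_deriv ((h2.pow 2).sub ((h1.pow 4).sub ((h1.pow 2).const_mul (2 * p)))) ?_
    push_cast
    ring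
  linarith

theorem exists_sol_local {v₀ : ℝ} (h : 0 ≤ v₀ ^ 4 - 2 * p * v₀ ^ 2 + Q) :
    ∃ I v w, IsOpenInterval I ∧ (0 : ℝ) ∈ I ∧ Sol p Q I v w ∧ v 0 = v₀ := by
  obtain ⟨y, hy0, ε, hε, hy⟩ := ((contDiff_field p).contDiffAt
    (x := (v₀, √(v₀ ^ 4 - 2 * p * v₀ ^ 2 + Q)))).exists_forall_mem_closedBall_exists_eq_forall_mem_Ioo_hasDerivAt₀ 0
  have h0 : (0 : ℝ) ∈ Ioo (0 - ε) (0 + ε) := ⟨by linarith, by linarith⟩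
  have hI : IsOpenInterval (Ioo (0 - ε) (0 + ε)) := isOpenInterval_Ioo (by linarith)
  refine ⟨_, fun x => (y x).1, fun x => (y x).2, hI, h0, sol_of_energy hI (fun x hx => ?_) h0 ?_, ?_⟩
  · exact ⟨(ContinuousLinearMap.fst ℝ ℝ ℝ).hasFDerivAt.comp_hasDerivAt x (hy x hx),
      (ContinuousLinearMap.snd ℝ ℝ ℝ).hasFDerivAt.comp_hasDerivAt x (hy x hx)⟩
  · simp only [hy0, Real.sq_sqrt h]
  · simp only [hy0]

/-- Where v ≠ 0, the value of v'' gives p, and then v'² gives Q. The zero solution, which is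
compatible with every p, is the reason why triples (p, 0, 0) are excluded from the parameter spaces.
-/
theorem Sol.param_unique (h : Sol p Q I v w) {p' Q' : ℝ} (h' : Sol p' Q' I v' w') (hI : IsOpen I)
    (hv : EqOn v v' I) {x : ℝ} (hx : x ∈ I) (h0 : v x ≠ 0) : p = p' ∧ Q = Q' := by
  have hw := h.eqOn_deriv h' hI hv
  have h2 := ((h x hx).2.1.congr_of_eventuallyEq
    (hw.symm.eventuallyEq_of_mem (hI.mem_nhds hx))).unique (h' x hx).2.1
  have h3 := (h x hx).2.2
  have h3' := (h' x hx).2.2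
  rw [← hv hx] at h2 h3'
  rw [← hw hx] at h3'
  have hp : p = p' := by
    have : 2 * v x * (p - p') = 0 := by linear_combination -h2
    rcases mul_eq_zero.1 this with h | h
    · exact absurd h (by simpa using h0)
    · linarith
  subst hp
  exact ⟨rfl, by linarith⟩

theorem Sol.exists_ne_zero (h : Sol p Q I v w) (hI : IsOpenInterval I) {x₀ : ℝ} (hx₀ : x₀ ∈ I)
    (h0 : ¬(Q = 0 ∧ v x₀ = 0)) : ∃ x ∈ I, v x ≠ 0 := by
  by_contra! hc
  refine h0 ⟨?_, hc x₀ hx₀⟩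
  have hw : w x₀ = 0 := ((h x₀ hx₀).1.congr_of_eventuallyEq
    (EqOn.eventuallyEq_of_mem (fun x hx => (hc x hx).symm) (hI.1.mem_nhds hx₀))).unique
    (hasDerivAt_const x₀ (0 : ℝ))
  have := (h x₀ hx₀).2.2
  rw [hw, hc x₀ hx₀] at this
  simpa using this.symm

/-- Solutions which cannot be extended to a larger open interval. -/
def MaxSol (p Q : ℝ) (I : Set ℝ) (v w : ℝ → ℝ) : Prop :=
  IsOpenInterval I ∧ Sol p Q I v w ∧ ∀ (I' : Set ℝ) (v' w' : ℝ → ℝ) (x : ℝ), IsOpenInterval I' →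
    Sol p Q I' v' w' → x ∈ I → x ∈ I' → v' x = v x → w' x = w x → I' ⊆ I

theorem MaxSol.eqOn (h : MaxSol p Q I v w) (hJ : IsOpenInterval J) (h' : Sol p Q J v' w') {x : ℝ}
    (hx : x ∈ I) (hx' : x ∈ J) (hv : v' x = v x) (hw : w' x = w x) :
    J ⊆ I ∧ EqOn v' v J ∧ EqOn w' w J := by
  have hsub := h.2.2 J v' w' x hJ h' hx hx' hv hw
  exact ⟨hsub, Sol.eqOn hJ h' (h.2.1.mono hsub) hx' hv hw⟩

/-- The union of all solutions with the given Cauchy data at one point; they glue by uniqueness. -/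
theorem exists_maxSol (hI : IsOpenInterval I) (h : Sol p Q I v w) :
    ∃ I' v' w', MaxSol p Q I' v' w' ∧ I ⊆ I' ∧ EqOn v' v I := by
  classical
  obtain ⟨x₀, hx₀⟩ := hI.2.2
  set 𝒮 : Set (Set ℝ × (ℝ → ℝ × ℝ)) := {s | IsOpenInterval s.1 ∧ x₀ ∈ s.1 ∧
    Sol p Q s.1 (fun x => (s.2 x).1) (fun x => (s.2 x).2) ∧ s.2 x₀ = (v x₀, w x₀)} with h𝒮
  obtain ⟨y, hy⟩ := exists_glue 𝒮 (by
    rintro s ⟨h1, h2, h3, h4⟩ t ⟨h1', h2', h3', h4'⟩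
    have := Sol.eqOn (h1.inter h1' h2 h2') (h3.mono inter_subset_left)
      (h3'.mono inter_subset_right) ⟨h2, h2'⟩ (by simp [h4, h4']) (by simp [h4, h4'])
    exact fun x hx => Prod.ext (this.1 hx) (this.2 hx))
  have hmem : (I, fun x => (v x, w x)) ∈ 𝒮 := ⟨hI, hx₀, h, rfl⟩
  set U : Set ℝ := ⋃₀ (Prod.fst '' 𝒮) with hU
  have hsubU : ∀ s ∈ 𝒮, s.1 ⊆ U := fun s hs => subset_sUnion_of_mem ⟨s, hs, rfl⟩
  have hUo : IsOpenInterval U := by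
    refine isOpenInterval_sUnion (x := x₀) ?_ ?_ ⟨I, _, hmem, rfl⟩
    · rintro _ ⟨s, hs, rfl⟩; exact hs.1
    · rintro _ ⟨s, hs, rfl⟩; exact hs.2.1
  have hUsol : Sol p Q U (fun x => (y x).1) (fun x => (y x).2) := by
    rintro x ⟨_, ⟨s, hs, rfl⟩, hx⟩
    exact Sol.congr (v' := fun x => (y x).1) (w' := fun x => (y x).2) hs.2.2.1 hs.1.1 (fun z hz => by simp only [hy s hs hz])
      (fun z hz => by simp only [hy s hs hz]) x hx
  have hx₀U : x₀ ∈ U := hsubU _ hmem hx₀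
  refine ⟨U, fun x => (y x).1, fun x => (y x).2, ⟨hUo, hUsol, ?_⟩, hsubU _ hmem,
    fun x hx => by simp only [hy _ hmem hx]⟩
  intro I' v' w' x hI' h' hxU hxI' hv hw
  have heq := Sol.eqOn (hUo.inter hI' hxU hxI') (hUsol.mono inter_subset_left)
    (h'.mono inter_subset_right) ⟨hxU, hxI'⟩ hv.symm hw.symm
  -- A solution meeting the union with equal Cauchy data at any point extends it to U ∪ I', which is
  -- then itself one of the intervals in the union.
  set z : ℝ → ℝ × ℝ := U.piecewise y (fun x => (v' x, w' x)) with hz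
  have hzU : ∀ t ∈ U, z t = y t := fun t ht => piecewise_eq_of_mem _ _ _ ht
  have hzI : ∀ t ∈ I', z t = (v' t, w' t) := fun t ht => by
    by_cases htU : t ∈ U
    · rw [hzU t htU]
      exact Prod.ext (heq.1 ⟨htU, ht⟩) (heq.2 ⟨htU, ht⟩)
    · exact piecewise_eq_of_notMem _ _ _ htU
  have hun : IsOpenInterval (U ∪ I') := by
    refine ⟨hUo.1.union hI'.1, ?_, x, Or.inl hxU⟩
    rw [← isPreconnected_iff_ordConnected]
    exact IsPreconnected.union x hxU hxI' hUo.isPreconnected hI'.isPreconnected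
  have : (U ∪ I', z) ∈ 𝒮 := by
    refine ⟨hun, Or.inl hx₀U, ?_, ?_⟩
    · rintro t (ht | ht)
      · exact Sol.congr (v' := fun x => (z x).1) (w' := fun x => (z x).2) hUsol hUo.1 (fun t ht => by simp only [hzU t ht])
          (fun t ht => by simp only [hzU t ht]) t ht
      · exact Sol.congr (v' := fun x => (z x).1) (w' := fun x => (z x).2) h' hI'.1 (fun t ht => by simp only [hzI t ht])
          (fun t ht => by simp only [hzI t ht]) t ht
    · show z x₀ = _
      rw [hzU x₀ hx₀U, hy _ hmem hx₀]
  exact subset_union_right.trans (hsubU _ this)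

theorem MaxSol.comp (h : MaxSol p Q I v w) (hk : k ≠ 0) (hρ : ρ ^ 2 = k ^ 2) (c : ℝ) :
    MaxSol (k ^ 2 * p) (k ^ 4 * Q) ((fun x => k * x + c) ⁻¹' I) (fun x => ρ * v (k * x + c))
      (fun x => ρ * k * w (k * x + c)) := by
  refine ⟨h.1.preimage hk c, h.2.1.comp hρ c, fun J v' w' x hJ h' hx hxJ hv hw => ?_⟩
  have hρ0 : ρ ≠ 0 := fun h0 => hk (by simpa [h0] using hρ.symm)
  have h1 := h'.comp (k := k⁻¹) (ρ := ρ⁻¹) (by rw [inv_pow, inv_pow, hρ]) (-(c / k))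
  have e1 : k⁻¹ ^ 2 * (k ^ 2 * p) = p := by field_simp
  have e2 : k⁻¹ ^ 4 * (k ^ 4 * Q) = Q := by field_simp
  have e3 : ∀ y, k⁻¹ * (k * y + c) + -(c / k) = y := fun y => by field_simp; ring
  rw [e1, e2] at h1
  have h2 := h.2.2 _ _ _ (k * x + c) (hJ.preimage (inv_ne_zero hk) _) h1 hx
    (by rw [mem_preimage, e3]; exact hxJ) (by simp only [e3, hv]; field_simp)
    (by simp only [e3, hw]; field_simp)
  intro y hy
  exact h2 (by rw [mem_preimage, e3]; exact hy)

/-- The value at 0 determines the derivative there up to sign, by the first-order equation. The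
opposite sign corresponds to the solution run backwards. -/
theorem MaxSol.exists_reflect (h : MaxSol p Q I v w) (h0 : (0 : ℝ) ∈ I) (hJ : IsOpenInterval J)
    (h' : Sol p Q J v' w') (h0' : (0 : ℝ) ∈ J) (hv : v' 0 = v 0) :
    ∃ ε : ℝ, (ε = 1 ∨ ε = -1) ∧ ∀ x ∈ J, ε * x ∈ I ∧ v' x = v (ε * x) := by
  have hw : w' 0 ^ 2 = w 0 ^ 2 := by rw [(h' 0 h0').2.2, (h.2.1 0 h0).2.2, hv]
  rcases sq_eq_sq_iff_eq_or_eq_neg.1 hw with hw | hw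
  · obtain ⟨h1, h2, -⟩ := h.eqOn hJ h' h0 h0' hv hw
    exact ⟨1, Or.inl rfl, fun x hx => by rw [one_mul]; exact ⟨h1 hx, h2 hx⟩⟩
  · have h1 := h'.comp (k := -1) (ρ := 1) (by norm_num) 0
    norm_num at h1
    have hJ' : IsOpenInterval ((fun x : ℝ => -x) ⁻¹' J) := by
      simpa using hJ.preimage (k := -1) (by norm_num) 0
    obtain ⟨h2, h3, -⟩ := h.eqOn hJ' h1 h0
      (by simpa using h0') (by simpa using hv) (by simp [hw])
    refine ⟨-1, Or.inr rfl, fun x hx => ?_⟩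
    rw [neg_one_mul]
    have hx' : -x ∈ (fun x : ℝ => -x) ⁻¹' J := by simpa using hx
    exact ⟨h2 hx', by simpa using h3 hx'⟩

/-! ### The relations on the parameter spaces -/

/-- The initial value `v₀'` for the parameter `p'` lies, up to a scaling by `k` and up to sign, on a
solution for `(p, Q)` with initial value `v₀`. -/
def Orb (k p Q v₀ p' v₀' : ℝ) : Prop :=
  ∃ (I : Set ℝ) (v w : ℝ → ℝ) (c ρ : ℝ), IsOpenInterval I ∧ (0 : ℝ) ∈ I ∧ c ∈ I ∧ Sol p Q I v w ∧
    v 0 = v₀ ∧ ρ ^ 2 = k ^ 2 ∧ p' = k ^ 2 * p ∧ v₀' = ρ * v c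

theorem Orb.refl {v₀ : ℝ} (h : 0 ≤ v₀ ^ 4 - 2 * p * v₀ ^ 2 + Q) : Orb 1 p Q v₀ p v₀ := by
  obtain ⟨I, v, w, hI, h0, hs, hv⟩ := exists_sol_local h
  exact ⟨I, v, w, 0, 1, hI, h0, h0, hs, hv, rfl, by ring, by rw [hv, one_mul]⟩

theorem Orb.symm {v₀ p' v₀' : ℝ} (hk : k ≠ 0) (h : Orb k p Q v₀ p' v₀') :
    Orb k⁻¹ p' (k ^ 4 * Q) v₀' p v₀ := by
  obtain ⟨I, v, w, c, ρ, hI, h0, hc, hs, hv, hρ, rfl, rfl⟩ := h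
  have hρ0 : ρ ≠ 0 := fun h0 => hk (by simpa [h0] using hρ.symm)
  have e : k * (-(c / k)) + c = 0 := by field_simp; ring
  refine ⟨_, _, _, -(c / k), ρ⁻¹, hI.preimage hk c, ?_, ?_, hs.comp hρ c, ?_, ?_, ?_, ?_⟩
  · simpa using hc
  · rw [mem_preimage, e]; exact h0
  · simp
  · rw [inv_pow, inv_pow, hρ]
  · field_simp
  · simp only [e, hv]; field_simp

theorem Orb.trans {k' v₀ p' v₀' p'' v₀'' : ℝ} (hk : k ≠ 0) (h : Orb k p Q v₀ p' v₀')
    (h' : Orb k' p' (k ^ 4 * Q) v₀' p'' v₀'') : Orb (k * k') p Q v₀ p'' v₀'' := by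
  obtain ⟨I, v, w, c, ρ, hI, h0, hc, hs, hv, hρ, rfl, rfl⟩ := h
  obtain ⟨I', v', w', c', ρ', hI', h0', hc', hs', hv', hρ', rfl, rfl⟩ := h'
  obtain ⟨M, u, u', hM, hsub, hu⟩ := exists_maxSol hI hs
  -- The second solution starts at the right value, but possibly runs through the rescaled first one
  -- backwards; in either case its end point lies on the maximal first solution.
  obtain ⟨ε, -, hε⟩ := (hM.comp hk hρ c).exists_reflect (by simpa using hsub hc) hI' hs' h0'
    (by simp [hv', hu hc])
  obtain ⟨h1, h2⟩ := hε c' hc'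
  refine ⟨M, u, u', k * (ε * c') + c, ρ' * ρ, hM.1, hsub h0, h1, hM.2.1, by rw [hu h0, hv], ?_, ?_, ?_⟩
  · rw [mul_pow, mul_pow, hρ, hρ', mul_comm]
  · ring
  · rw [h2]; ring

/-- A solution takes both initial values, so the pair of solutions can be replaced by one. The
scaling of p need not be imposed: it follows from `Sol.param_unique`, since a solution for a triple
in `R` is not identically zero. -/
theorem relR_iff {s t : ℝ × ℝ × ℝ} (ht : t ∈ R) :
    relR s t ↔ ∃ k > 0, Orb k s.1 (s.2.1 ^ 2) s.2.2 t.1 t.2.2 ∧ t.2.1 = k ^ 2 * s.2.1 := by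
  obtain ⟨p, q, v₀⟩ := s
  obtain ⟨p', q', v₀'⟩ := t
  constructor
  · rintro ⟨I₁, I₂, v₁, v₂, r, c, σ, ⟨hI₁, h0₁, ⟨w₁, h₁⟩, hv₁⟩, ⟨hI₂, h0₂, ⟨w₂, h₂⟩, hv₂⟩, hr, hσ, hI,
      hv, hq⟩
    simp only at *
    have hpre : I₂ = (fun x => r * x + c) ⁻¹' I₁ := by
      rw [hI, preimage_image_eq]
      intro x y hxy
      have : r * x = r * y := by simpa using hxy
      exact mul_left_cancel₀ hr.ne' this
    have hσ2 : (σ * r) ^ 2 = r ^ 2 := by rcases hσ with rfl | rfl <;> ring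
    have h3 := Sol.comp h₁ hσ2 c
    rw [← hpre] at h3
    obtain ⟨x, hx, hx0⟩ := Sol.exists_ne_zero h₂ hI₂ h0₂ (fun h => ht.2 ⟨by simpa using h.1,
      by simpa [hv₂] using h.2⟩)
    have hp := (Sol.param_unique h₂ h3 hI₂.1 hv hx hx0).1
    refine ⟨r, hr, ⟨I₁, v₁, w₁, c, σ * r, hI₁, h0₁, ?_, h₁, hv₁, hσ2, hp, ?_⟩, hq⟩
    · rw [hpre] at h0₂; simpa using h0₂
    · rw [← hv₂, hv 0 h0₂]; simp
  · rintro ⟨k, hk, ⟨I, v, w, c, ρ, hI, h0, hc, hs, hv, hρ, hp, hv'⟩, hq⟩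
    simp only at *
    obtain ⟨σ, hσ, rfl⟩ : ∃ σ : ℝ, (σ = 1 ∨ σ = -1) ∧ ρ = σ * k := by
      rcases sq_eq_sq_iff_eq_or_eq_neg.1 hρ with rfl | rfl
      · exact ⟨1, Or.inl rfl, by ring⟩
      · exact ⟨-1, Or.inr rfl, by ring⟩
    have hs' := hs.comp hρ c
    rw [← hp, show k ^ 4 * q ^ 2 = q' ^ 2 by rw [hq]; ring] at hs'
    refine ⟨I, (fun x => k * x + c) ⁻¹' I, v, fun x => σ * k * v (k * x + c), k, c, σ,
      ⟨hI, h0, ⟨w, hs⟩, hv⟩, ⟨hI.preimage hk.ne' c, by simpa using hc, ⟨_, hs'⟩, by simp [hv']⟩,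
      hk, hσ, ?_, fun x _ => rfl, hq⟩
    rw [image_preimage_eq]
    exact fun y => ⟨(y - c) / k, by field_simp; ring⟩

theorem simR_iff {s t : R} : simR s t ↔
    ∃ k > 0, Orb k s.1.1 (s.1.2.1 ^ 2) s.1.2.2 t.1.1 t.1.2.2 ∧ t.1.2.1 = k ^ 2 * s.1.2.1 :=
  relR_iff t.2

theorem equivalence_simR : Equivalence simR where
  refl s := simR_iff.2 ⟨1, one_pos, Orb.refl s.2.1, by ring⟩
  symm {s t} h := by
    obtain ⟨k, hk, h, hq⟩ := simR_iff.1 h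
    refine simR_iff.2 ⟨k⁻¹, inv_pos.2 hk, ?_, by rw [hq]; field_simp⟩
    rw [show t.1.2.1 ^ 2 = k ^ 4 * s.1.2.1 ^ 2 by rw [hq]; ring]
    exact h.symm hk.ne'
  trans {s t u} h h' := by
    obtain ⟨k, hk, h, hq⟩ := simR_iff.1 h
    obtain ⟨k', hk', h', hq'⟩ := simR_iff.1 h'
    refine simR_iff.2 ⟨k * k', mul_pos hk hk', ?_, by rw [hq', hq]; ring⟩
    rw [show t.1.2.1 ^ 2 = k ^ 4 * s.1.2.1 ^ 2 by rw [hq]; ring] at h'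
    exact h.trans hk.ne' h'

theorem norm_sq_mul_inv_sq {q : ℝ} {l : ℂ} (hl : ‖l‖ = 1) : ‖(q : ℂ) * (l ^ 2)⁻¹‖ ^ 2 = q ^ 2 := by
  simp [hl]

theorem exists_unit_sqrt (P : ℂ) : ∃ l : ℂ, ‖l‖ = 1 ∧ P = (‖P‖ : ℂ) * (l ^ 2)⁻¹ := by
  refine ⟨Complex.exp ((-(P.arg / 2) : ℝ) * Complex.I), Complex.norm_exp_ofReal_mul_I _, ?_⟩
  rw [← Complex.exp_nat_mul, ← Complex.exp_neg]
  nth_rewrite 1 [← Complex.norm_mul_exp_arg_mul_I P]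
  congr 2
  push_cast
  ring

/-- The common phase λ drops out: real multiples of the same λ⁻² are related by the real factor k².
Conversely, λ can be taken with P = |P|λ⁻², even if P = 0. -/
theorem simE_iff {s t : E} : simE s t ↔
    ∃ k > 0, Orb k s.1.1 (‖s.1.2.1‖ ^ 2) s.1.2.2 t.1.1 t.1.2.2 ∧
      t.1.2.1 = (k : ℂ) ^ 2 * s.1.2.1 := by
  obtain ⟨⟨p, P, v₀⟩, hs⟩ := s
  obtain ⟨⟨p', P', v₀'⟩, ht⟩ := t
  constructor
  · rintro ⟨q, q', l, hl, hP, hP', h⟩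
    simp only at *
    have hmem : (p', q', v₀') ∈ R := by
      refine ⟨?_, fun h => ht.2 ⟨?_, h.2⟩⟩
      · have := ht.1
        rw [hP', norm_sq_mul_inv_sq hl] at this
        exact this
      · have : q' = 0 := h.1
        simp [hP', this]
    obtain ⟨k, hk, h, hq⟩ := (relR_iff hmem).1 h
    simp only at *
    refine ⟨k, hk, ?_, ?_⟩
    · rw [hP, norm_sq_mul_inv_sq hl]; exact h
    · rw [hP', hP, hq]; push_cast; ring
  · rintro ⟨k, hk, h, hP'⟩
    simp only at *
    obtain ⟨l, hl, hP⟩ := exists_unit_sqrt P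
    have hP'2 : P' = ((k ^ 2 * ‖P‖ : ℝ) : ℂ) * (l ^ 2)⁻¹ := by
      rw [hP']; nth_rewrite 1 [hP]; push_cast; ring
    have hmem : (p', k ^ 2 * ‖P‖, v₀') ∈ R := by
      refine ⟨?_, fun h => ht.2 ⟨?_, h.2⟩⟩
      · have := ht.1
        rw [hP'2, norm_sq_mul_inv_sq hl] at this
        exact this
      · have : k ^ 2 * ‖P‖ = 0 := h.1
        rw [hP'2, this]; simp
    exact ⟨‖P‖, k ^ 2 * ‖P‖, l, hl, hP, hP'2, (relR_iff hmem).2 ⟨k, hk, h, rfl⟩⟩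

theorem norm_sq_scale {P P' : ℂ} (h : P' = (k : ℂ) ^ 2 * P) : ‖P'‖ ^ 2 = k ^ 4 * ‖P‖ ^ 2 := by
  rw [h, norm_mul, norm_pow, Complex.norm_real, Real.norm_eq_abs, sq_abs]; ring

theorem equivalence_simE : Equivalence simE where
  refl s := simE_iff.2 ⟨1, one_pos, Orb.refl s.2.1, by push_cast; ring⟩
  symm {s t} h := by
    obtain ⟨k, hk, h, hq⟩ := simE_iff.1 h
    have hk' : (k : ℂ) ≠ 0 := by exact_mod_cast hk.ne'
    refine simE_iff.2 ⟨k⁻¹, inv_pos.2 hk, ?_, by rw [hq]; push_cast; field_simp⟩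
    rw [norm_sq_scale hq]
    exact h.symm hk.ne'
  trans {s t u} h h' := by
    obtain ⟨k, hk, h, hq⟩ := simE_iff.1 h
    obtain ⟨k', hk', h', hq'⟩ := simE_iff.1 h'
    refine simE_iff.2 ⟨k * k', mul_pos hk hk', ?_, by rw [hq', hq]; push_cast; ring⟩
    rw [norm_sq_scale hq] at h'
    exact h.trans hk.ne' h'

/-! ### The quotients are not Hausdorff -/

theorem orb_tanh {a : ℝ} (ha : a ∈ Ioo (-1 : ℝ) 1) : Orb 1 1 1 0 1 a := by
  have h1 : 0 < 1 + a := by linarith [ha.1]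
  have h2 : 0 < 1 - a := by linarith [ha.2]
  -- The solution is tanh x, its derivative 1 - tanh² x, and the point where it takes the value a is
  -- artanh a.
  refine ⟨univ, fun x => 1 - 2 / (Real.exp (2 * x) + 1),
    fun x => 1 - (1 - 2 / (Real.exp (2 * x) + 1)) ^ 2, Real.log ((1 + a) / (1 - a)) / 2, 1,
    ⟨isOpen_univ, ordConnected_univ, univ_nonempty⟩, trivial, trivial, fun x _ => ?_, by norm_num,
    rfl, by norm_num, ?_⟩
  · have he : HasDerivAt (fun x => Real.exp (2 * x) + 1) (Real.exp (2 * x) * 2) x := by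
      simpa using (((hasDerivAt_id x).const_mul 2).exp).add_const 1
    have hpos : Real.exp (2 * x) + 1 ≠ 0 := by positivity
    have hv : HasDerivAt (fun x => 1 - 2 / (Real.exp (2 * x) + 1))
        (1 - (1 - 2 / (Real.exp (2 * x) + 1)) ^ 2) x := by
      refine HasDerivAt.congr_deriv (((hasDerivAt_const x (2 : ℝ)).div he hpos).const_sub 1) ?_
      field_simp
      ring
    refine ⟨hv, ?_, by ring⟩
    refine HasDerivAt.congr_deriv ((hv.pow 2).const_sub 1) ?_
    push_cast
    ring
  · simp only
    rw [mul_div_cancel₀ _ (two_ne_zero (α := ℝ)), Real.exp_log (div_pos h1 h2)]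
    field_simp
    ring

/-- A solution for p = Q = 1 which takes a value ±1 has v' = 0 there, hence is constant by
uniqueness, and cannot start at 0. -/
theorem not_orb_tanh_one : ¬ Orb 1 1 1 0 1 1 := by
  rintro ⟨I, v, w, c, ρ, hI, h0, hc, hs, hv, hρ, -, h1⟩
  have hvc : v c ^ 2 = 1 := by
    have : ρ ^ 2 * v c ^ 2 = 1 := by rw [← mul_pow, ← h1]; norm_num
    rw [hρ] at this
    linarith
  have hw : w c = 0 := by
    have := (hs c hc).2.2
    have h4 : v c ^ 4 = 1 := by rw [show v c ^ 4 = (v c ^ 2) ^ 2 by ring, hvc]; norm_num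
    rw [h4, hvc] at this
    have : w c ^ 2 = 0 := by linarith
    simpa using this
  have hconst : Sol 1 1 I (fun _ => v c) (fun _ => 0) := fun x _ => by
    refine ⟨hasDerivAt_const _ _, ?_, ?_⟩
    · rw [hvc]; simpa using hasDerivAt_const x (0 : ℝ)
    · rw [show v c ^ 4 = (v c ^ 2) ^ 2 by ring, hvc]; norm_num
  have := (Sol.eqOn hI hs hconst hc rfl hw).1 h0
  simp only [hv] at this
  rw [← this] at hvc
  norm_num at hvc

/-- In a Hausdorff space the fibre of f over f 0 would be closed, hence would contain the end point
1 of the interval. -/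
theorem not_t2_of_orb {X : Type*} [TopologicalSpace X] (f : ℝ → X) (hf : Continuous f)
    (h : ∀ a ∈ Ioo (-1 : ℝ) 1, f a = f 0) (h1 : f 1 ≠ f 0) : ¬ T2Space X := by
  intro _
  have hcl : IsClosed (f ⁻¹' {f 0}) := isClosed_singleton.preimage hf
  have h2 : closure (Ioo (-1 : ℝ) 1) ⊆ f ⁻¹' {f 0} := hcl.closure_subset_iff.2 h
  rw [closure_Ioo (by norm_num)] at h2
  exact h1 (h2 ⟨by norm_num, le_rfl⟩)

theorem not_t2Space_simR : ¬ T2Space (Quot simR) := by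
  have hmem : ∀ a : ℝ, ((1, 1, a) : ℝ × ℝ × ℝ) ∈ R := fun a =>
    ⟨by show 0 ≤ a ^ 4 - 2 * 1 * a ^ 2 + 1 ^ 2; nlinarith [sq_nonneg (a ^ 2 - 1)],
      fun h => one_ne_zero h.1⟩
  refine not_t2_of_orb (fun a => Quot.mk simR ⟨(1, 1, a), hmem a⟩)
    (continuous_quot_mk.comp (by fun_prop)) (fun a ha => ?_) (fun h => ?_)
  · refine (Quot.sound (simR_iff.2 ⟨1, one_pos, ?_, by norm_num⟩)).symm
    simpa using orb_tanh ha
  · obtain ⟨k, hk, h, hq⟩ := simR_iff.1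
      (equivalence_simR.symm (equivalence_simR.quot_mk_eq_iff _ _ |>.1 h))
    simp only at *
    have : k = 1 := by nlinarith
    subst this
    exact not_orb_tanh_one (by simpa using h)

theorem not_t2Space_simE : ¬ T2Space (Quot simE) := by
  have hmem : ∀ a : ℝ, ((1, 1, a) : ℝ × ℂ × ℝ) ∈ E := fun a =>
    ⟨by show 0 ≤ a ^ 4 - 2 * 1 * a ^ 2 + ‖(1 : ℂ)‖ ^ 2
        rw [norm_one]; nlinarith [sq_nonneg (a ^ 2 - 1)],
      fun h => one_ne_zero h.1⟩
  refine not_t2_of_orb (fun a => Quot.mk simE ⟨(1, 1, a), hmem a⟩)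
    (continuous_quot_mk.comp (by fun_prop)) (fun a ha => ?_) (fun h => ?_)
  · refine (Quot.sound (simE_iff.2 ⟨1, one_pos, ?_, by norm_num⟩)).symm
    simpa using orb_tanh ha
  · obtain ⟨k, hk, h, hq⟩ := simE_iff.1
      (equivalence_simE.symm (equivalence_simE.quot_mk_eq_iff _ _ |>.1 h))
    simp only [mul_one] at *
    have hq' : (1 : ℝ) = k ^ 2 := by exact_mod_cast hq
    have : k = 1 := by nlinarith
    subst this
    exact not_orb_tanh_one (by simpa using h)

end CMC
end

noncomputable section

namespace CMC

open Filter Topology Metric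
open scoped NNReal

/-! ### The Lorentzian scalar product -/

theorem mink_comm (X Y : Mink) : mink X Y = mink Y X := by unfold mink; ring

theorem mink_add_left (X Y Z : Mink) : mink (X + Y) Z = mink X Z + mink Y Z := by
  simp only [mink, Pi.add_apply]; ring

theorem mink_add_right (X Y Z : Mink) : mink X (Y + Z) = mink X Y + mink X Z := by
  simp only [mink, Pi.add_apply]; ring

theorem mink_sub_left (X Y Z : Mink) : mink (X - Y) Z = mink X Z - mink Y Z := by
  simp only [mink, Pi.sub_apply]; ring

theorem mink_sub_right (X Y Z : Mink) : mink X (Y - Z) = mink X Y - mink X Z := by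
  simp only [mink, Pi.sub_apply]; ring

theorem mink_smul_left (a : ℝ) (X Y : Mink) : mink (a • X) Y = a * mink X Y := by
  simp only [mink, Pi.smul_apply, smul_eq_mul]; ring

theorem mink_smul_right (a : ℝ) (X Y : Mink) : mink X (a • Y) = a * mink X Y := by
  simp only [mink, Pi.smul_apply, smul_eq_mul]; ring

theorem mink_zero_left (X : Mink) : mink 0 X = 0 := by simp [mink]

theorem mink_zero_right (X : Mink) : mink X 0 = 0 := by simp [mink]

theorem HasDerivAt.mink {f g : ℝ → Mink} {f' g' : Mink} {x : ℝ} (hf : HasDerivAt f f' x)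
    (hg : HasDerivAt g g' x) :
    HasDerivAt (fun x => CMC.mink (f x) (g x)) (CMC.mink f' (g x) + CMC.mink (f x) g') x := by
  have hf' := hasDerivAt_pi.1 hf
  have hg' := hasDerivAt_pi.1 hg
  unfold CMC.mink
  refine ((((hf' 0).mul (hg' 0)).add ((hf' 1).mul (hg' 1))).sub
    ((hf' 2).mul (hg' 2))).congr_deriv ?_
  ring

theorem contDiff_mink : ContDiff ℝ ∞ fun p : Mink × Mink => mink p.1 p.2 := by
  unfold mink; fun_prop

theorem ContDiffOn.mink {E : Type*} [NormedAddCommGroup E] [NormedSpace ℝ E] {f g : E → Mink}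
    {s : Set E} (hf : ContDiffOn ℝ ∞ f s) (hg : ContDiffOn ℝ ∞ g s) :
    ContDiffOn ℝ ∞ (fun x => CMC.mink (f x) (g x)) s :=
  contDiff_mink.comp_contDiffOn (hf.prodMk hg)

/-- Vectors `X`, `Y` of square `m` and a unit timelike vector `N`, pairwise orthogonal. -/
structure IsFrame (m : ℝ) (X Y N : Mink) : Prop where
  pos : 0 < m
  xx : mink X X = m
  yy : mink Y Y = m
  xy : mink X Y = 0
  nn : mink N N = -1
  nx : mink N X = 0
  ny : mink N Y = 0

namespace IsFrame

variable {m : ℝ} {X Y N : Mink}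

theorem decomp (h : IsFrame m X Y N) (V : Mink) :
    V = (mink V X / m) • X + (mink V Y / m) • Y - mink V N • N := by
  have hm := h.pos.ne'
  -- The columns of B are the frame, the rows of A the dual frame with respect to the Lorentzian
  -- product. Orthogonality is A B = 1; the expansion of V is B A = 1.
  set A : Matrix (Fin 3) (Fin 3) ℝ := !![X 0 / m, X 1 / m, -(X 2 / m);
    Y 0 / m, Y 1 / m, -(Y 2 / m); -N 0, -N 1, N 2] with hA
  set B : Matrix (Fin 3) (Fin 3) ℝ := !![X 0, Y 0, N 0; X 1, Y 1, N 1; X 2, Y 2, N 2] with hB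
  have e1 := h.xx
  have e2 := h.yy
  have e3 := h.xy
  have e4 := h.nn
  have e5 := h.nx
  have e6 := h.ny
  simp only [mink] at e1 e2 e3 e4 e5 e6
  have hAB : A * B = 1 := by
    ext i j
    fin_cases i <;> fin_cases j <;>
      simp [hA, hB, Matrix.mul_apply, Fin.sum_univ_three] <;> field_simp <;> linarith
  have hBA : B * A = 1 := mul_eq_one_comm.1 hAB
  have key := congrArg (fun M => Matrix.mulVec M V) hBA
  simp only [Matrix.one_mulVec] at key
  rw [← Matrix.mulVec_mulVec] at key
  nth_rewrite 1 [← key]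
  ext i
  fin_cases i <;>
    simp [hA, hB, Matrix.mulVec, dotProduct, Fin.sum_univ_three, mink] <;> ring

theorem ext (h : IsFrame m X Y N) {V W : Mink} (hx : mink V X = mink W X)
    (hy : mink V Y = mink W Y) (hn : mink V N = mink W N) : V = W := by
  rw [h.decomp V, h.decomp W, hx, hy, hn]

end IsFrame

/-! ### Isometries -/

theorem affine_sub (A : Mink ≃ᵃ[ℝ] Mink) (X Y : Mink) : A X - A Y = A.linear (X - Y) := by
  rw [← vsub_eq_sub, ← vsub_eq_sub, ← AffineEquiv.coe_toAffineMap, ← AffineMap.linearMap_vsub]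
  rfl

namespace IsIsometry

variable {A : Mink ≃ᵃ[ℝ] Mink}

theorem linear_sq (h : IsIsometry A) (V : Mink) : mink (A.linear V) (A.linear V) = mink V V := by
  simpa only [affine_sub, sub_zero] using h V 0

theorem linear_mink (h : IsIsometry A) (V W : Mink) :
    mink (A.linear V) (A.linear W) = mink V W := by
  have h1 := h.linear_sq (V + W)
  have h2 := h.linear_sq V
  have h3 := h.linear_sq W
  simp only [map_add, mink_add_left, mink_add_right] at h1
  rw [mink_comm W V, mink_comm (A.linear W) (A.linear V)] at h1
  linarith

theorem of_linear (h : ∀ V, mink (A.linear V) (A.linear V) = mink V V) : IsIsometry A := by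
  intro X Y
  rw [affine_sub, h]

theorem refl : IsIsometry (AffineEquiv.refl ℝ Mink) := fun _ _ => rfl

theorem symm (h : IsIsometry A) : IsIsometry A.symm := fun X Y => by
  simpa using (h (A.symm X) (A.symm Y)).symm

theorem trans {B : Mink ≃ᵃ[ℝ] Mink} (h : IsIsometry A) (h' : IsIsometry B) :
    IsIsometry (A.trans B) := fun X Y => (h' _ _).trans (h X Y)

end IsIsometry

theorem contDiff_affine (A : Mink ≃ᵃ[ℝ] Mink) : ContDiff ℝ ∞ A := by
  have : (A : Mink → Mink) = fun X => A.linear X + A 0 := by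
    ext1 X
    simpa using A.map_vadd 0 X
  rw [this]
  exact (LinearMap.toContinuousLinearMap (A.linear : Mink →ₗ[ℝ] Mink)).contDiff.add contDiff_const

theorem HasDerivAt.linearMap_comp {f : ℝ → Mink} {f' : Mink} {x : ℝ} (hf : HasDerivAt f f' x)
    (L : Mink →ₗ[ℝ] Mink) : HasDerivAt (fun x => L (f x)) (L f') x :=
  (LinearMap.toContinuousLinearMap L).hasFDerivAt.comp_hasDerivAt x hf

theorem HasDerivAt.affine_comp {f : ℝ → Mink} {f' : Mink} {x : ℝ} (hf : HasDerivAt f f' x)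
    (A : Mink ≃ᵃ[ℝ] Mink) : HasDerivAt (fun x => A (f x)) (A.linear f') x := by
  have : (fun x => A (f x)) = fun x => A.linear (f x) + A 0 := by
    ext1 x
    simpa using A.map_vadd 0 (f x)
  rw [this]
  exact (HasDerivAt.linearMap_comp hf A.linear).add_const _

/-! ### Partial derivatives on strips -/

/-- The strip over `J`. -/
abbrev strip (J : Set ℝ) : Set (ℝ × ℝ) := J ×ˢ univ

variable {J : Set ℝ} {f g : ℝ × ℝ → Mink} {z : ℝ × ℝ}

theorem isOpen_strip (hJ : IsOpen J) : IsOpen (strip J) := hJ.prod isOpen_univ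

theorem mk_mem_strip {x y : ℝ} : (x, y) ∈ strip J ↔ x ∈ J := by simp

theorem differentiableAt_of_smooth (hJ : IsOpen J) (hf : ContDiffOn ℝ ∞ f (strip J))
    (hz : z ∈ strip J) : DifferentiableAt ℝ f z :=
  (hf.contDiffAt ((isOpen_strip hJ).mem_nhds hz)).differentiableAt (by simp)

theorem contDiffOn_fderiv (hJ : IsOpen J) (hf : ContDiffOn ℝ ∞ f (strip J)) :
    ContDiffOn ℝ ∞ (fderiv ℝ f) (strip J) :=
  hf.fderiv_of_isOpen (isOpen_strip hJ) (by simp)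

theorem contDiffOn_pdx (hJ : IsOpen J) (hf : ContDiffOn ℝ ∞ f (strip J)) :
    ContDiffOn ℝ ∞ (pdx f) (strip J) := (contDiffOn_fderiv hJ hf).clm_apply contDiffOn_const

theorem contDiffOn_pdy (hJ : IsOpen J) (hf : ContDiffOn ℝ ∞ f (strip J)) :
    ContDiffOn ℝ ∞ (pdy f) (strip J) := (contDiffOn_fderiv hJ hf).clm_apply contDiffOn_const

theorem fderiv_eq_pd (f : ℝ × ℝ → Mink) (z w : ℝ × ℝ) :
    fderiv ℝ f z w = w.1 • pdx f z + w.2 • pdy f z := by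
  rw [pdx, pdy, ← map_smul, ← map_smul, ← map_add]
  simp

theorem hasDerivAt_comp_curve (hJ : IsOpen J) (hf : ContDiffOn ℝ ∞ f (strip J)) {a b : ℝ → ℝ}
    {a' b' t : ℝ} (ha : HasDerivAt a a' t) (hb : HasDerivAt b b' t) (ht : a t ∈ J) :
    HasDerivAt (fun s => f (a s, b s)) (a' • pdx f (a t, b t) + b' • pdy f (a t, b t)) t := by
  have h := (differentiableAt_of_smooth hJ hf (mk_mem_strip (y := b t) |>.2 ht)).hasFDerivAt
  have := h.comp_hasDerivAt t (ha.prodMk hb)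
  rwa [fderiv_eq_pd] at this

theorem hasDerivAt_pdx (hJ : IsOpen J) (hf : ContDiffOn ℝ ∞ f (strip J)) {x : ℝ} (hx : x ∈ J)
    (y : ℝ) : HasDerivAt (fun s => f (s, y)) (pdx f (x, y)) x := by
  simpa using hasDerivAt_comp_curve hJ hf (hasDerivAt_id x) (hasDerivAt_const x y) hx

theorem hasDerivAt_pdy (hJ : IsOpen J) (hf : ContDiffOn ℝ ∞ f (strip J)) {x : ℝ} (hx : x ∈ J)
    (y : ℝ) : HasDerivAt (fun s => f (x, s)) (pdy f (x, y)) y := by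
  simpa using hasDerivAt_comp_curve hJ hf (hasDerivAt_const y x) (hasDerivAt_id y) hx

theorem pdx_eq (hJ : IsOpen J) (hf : ContDiffOn ℝ ∞ f (strip J)) {x y : ℝ} (hx : x ∈ J) {V : Mink}
    (h : HasDerivAt (fun s => f (s, y)) V x) : pdx f (x, y) = V :=
  (hasDerivAt_pdx hJ hf hx y).unique h

theorem pdy_eq (hJ : IsOpen J) (hf : ContDiffOn ℝ ∞ f (strip J)) {x y : ℝ} (hx : x ∈ J) {V : Mink}
    (h : HasDerivAt (fun s => f (x, s)) V y) : pdy f (x, y) = V :=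
  (hasDerivAt_pdy hJ hf hx y).unique h

theorem pdx_congr (hJ : IsOpen J) (h : EqOn f g (strip J)) : EqOn (pdx f) (pdx g) (strip J) :=
  fun z hz => by
    rw [pdx, pdx, (h.eventuallyEq_of_mem ((isOpen_strip hJ).mem_nhds hz)).fderiv_eq]

theorem pdy_congr (hJ : IsOpen J) (h : EqOn f g (strip J)) : EqOn (pdy f) (pdy g) (strip J) :=
  fun z hz => by
    rw [pdy, pdy, (h.eventuallyEq_of_mem ((isOpen_strip hJ).mem_nhds hz)).fderiv_eq]

theorem pdx_pdy (hJ : IsOpen J) (hf : ContDiffOn ℝ ∞ f (strip J)) (hz : z ∈ strip J) :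
    pdx (pdy f) z = pdy (pdx f) z := by
  have hd : DifferentiableAt ℝ (fderiv ℝ f) z :=
    ((contDiffOn_fderiv hJ hf).contDiffAt ((isOpen_strip hJ).mem_nhds hz)).differentiableAt
      (by simp)
  have hsym : IsSymmSndFDerivAt ℝ f z :=
    (hf.contDiffAt ((isOpen_strip hJ).mem_nhds hz)).isSymmSndFDerivAt
      (by simpa using (WithTop.coe_le_coe.2 le_top : (2 : WithTop ℕ∞) ≤ ∞))
  have key : ∀ u v : ℝ × ℝ, fderiv ℝ (fun z => fderiv ℝ f z u) z v =
      fderiv ℝ (fderiv ℝ f) z v u := fun u v => by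
    rw [fderiv_clm_apply hd (differentiableAt_const u)]
    simp
  show fderiv ℝ (fun z => fderiv ℝ f z (0, 1)) z (1, 0) =
    fderiv ℝ (fun z => fderiv ℝ f z (1, 0)) z (0, 1)
  rw [key, key, hsym]

end CMC
end

noncomputable section

namespace CMC

open Filter Topology Metric
open scoped NNReal

/-! ### Structure equations of conformally parametrized surfaces -/

variable {J : Set ℝ} {f g N : ℝ × ℝ → Mink} {m : ℝ → ℝ} {H : ℝ} {z : ℝ × ℝ}

theorem pdx_mink (hJ : IsOpen J) (hf : ContDiffOn ℝ ∞ f (strip J)) (hg : ContDiffOn ℝ ∞ g (strip J))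
    {c : ℝ → ℝ} {c' x : ℝ} (hc : ∀ z ∈ strip J, mink (f z) (g z) = c z.1) (hd : HasDerivAt c c' x)
    (hx : x ∈ J) (y : ℝ) :
    mink (pdx f (x, y)) (g (x, y)) + mink (f (x, y)) (pdx g (x, y)) = c' :=
  (HasDerivAt.mink (hasDerivAt_pdx hJ hf hx y) (hasDerivAt_pdx hJ hg hx y)).unique
    (hd.congr_of_eventuallyEq (EqOn.eventuallyEq_of_mem
      (fun s hs => hc (s, y) (mk_mem_strip.2 hs)) (hJ.mem_nhds hx)))

theorem pdy_mink (hJ : IsOpen J) (hf : ContDiffOn ℝ ∞ f (strip J)) (hg : ContDiffOn ℝ ∞ g (strip J))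
    {c : ℝ → ℝ} {x : ℝ} (hc : ∀ z ∈ strip J, mink (f z) (g z) = c z.1) (hx : x ∈ J) (y : ℝ) :
    mink (pdy f (x, y)) (g (x, y)) + mink (f (x, y)) (pdy g (x, y)) = 0 := by
  refine (HasDerivAt.mink (hasDerivAt_pdy hJ hf hx y) (hasDerivAt_pdy hJ hg hx y)).unique ?_
  have : (fun s => mink (f (x, s)) (g (x, s))) = fun _ => c x :=
    funext fun s => hc (x, s) (mk_mem_strip.2 hx)
  rw [this]
  exact hasDerivAt_const _ _

/-- The coefficient `⟨N, f_xx⟩` of the second fundamental form. -/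
def hxx (f N : ℝ × ℝ → Mink) (z : ℝ × ℝ) : ℝ := mink (N z) (pdx (pdx f) z)

/-- The coefficient `⟨N, f_xy⟩` of the second fundamental form. -/
def hxy (f N : ℝ × ℝ → Mink) (z : ℝ × ℝ) : ℝ := mink (N z) (pdx (pdy f) z)

/-- The coefficient `⟨N, f_yy⟩` of the second fundamental form. -/
def hyy (f N : ℝ × ℝ → Mink) (z : ℝ × ℝ) : ℝ := mink (N z) (pdy (pdy f) z)

/-- Conformally parametrized surfaces of mean curvature `H` whose metric `m (dx ^ 2 + dy ^ 2)`
depends on `x` only. -/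
structure ConfSurf (H : ℝ) (J : Set ℝ) (f N : ℝ × ℝ → Mink) (m : ℝ → ℝ) : Prop where
  interval : IsOpenInterval J
  smooth : ContDiffOn ℝ ∞ f (strip J)
  frame : ∀ z ∈ strip J, IsFrame (m z.1) (pdx f z) (pdy f z) (N z)
  mean : ∀ z ∈ strip J, hxx f N z + hyy f N z = 2 * H * m z.1

theorem meanCurvature_of_frame (h : IsFrame (m z.1) (pdx f z) (pdy f z) (N z)) :
    meanCurvature f N z = (hxx f N z + hyy f N z) / (2 * m z.1) := by
  rw [meanCurvature, h.xx, h.yy, h.xy]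
  have := h.pos.ne'
  unfold hxx hyy
  field_simp
  ring

theorem meanCurvature_eq_iff (h : IsFrame (m z.1) (pdx f z) (pdy f z) (N z)) :
    meanCurvature f N z = H ↔ hxx f N z + hyy f N z = 2 * H * m z.1 := by
  have := h.pos
  rw [meanCurvature_of_frame h, div_eq_iff (by positivity)]
  constructor <;> intro h <;> linarith

namespace ConfSurf

theorem isOpen (h : ConfSurf H J f N m) : IsOpen J := h.interval.1

theorem contDiffOn_metric (h : ConfSurf H J f N m) : ContDiffOn ℝ ∞ m J := by
  have h1 : ContDiffOn ℝ ∞ (fun x : ℝ => pdx f (x, 0)) J :=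
    (contDiffOn_pdx h.isOpen h.smooth).comp (by fun_prop) fun x hx => mk_mem_strip.2 hx
  exact (ContDiffOn.mink h1 h1).congr fun x hx => (h.frame (x, 0) (mk_mem_strip.2 hx)).xx.symm

theorem hasDerivAt_metric (h : ConfSurf H J f N m) {x : ℝ} (hx : x ∈ J) :
    HasDerivAt m (deriv m x) x :=
  ((h.contDiffOn_metric.contDiffAt (h.isOpen.mem_nhds hx)).differentiableAt (by simp)).hasDerivAt

theorem contDiffOn_deriv_metric (h : ConfSurf H J f N m) : ContDiffOn ℝ ∞ (deriv m) J :=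
  h.contDiffOn_metric.deriv_of_isOpen h.isOpen (by simp)

variable (h : ConfSurf H J f N m) {x : ℝ} (hx : x ∈ J) (y : ℝ)
include h hx

theorem mink_fxx_fx : mink (pdx (pdx f) (x, y)) (pdx f (x, y)) = deriv m x / 2 := by
  have := pdx_mink h.isOpen (contDiffOn_pdx h.isOpen h.smooth) (contDiffOn_pdx h.isOpen h.smooth)
    (fun z hz => (h.frame z hz).xx) (h.hasDerivAt_metric hx) hx y
  rw [mink_comm (pdx f (x, y))] at this
  linarith

theorem mink_fxy_fy : mink (pdx (pdy f) (x, y)) (pdy f (x, y)) = deriv m x / 2 := by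
  have := pdx_mink h.isOpen (contDiffOn_pdy h.isOpen h.smooth) (contDiffOn_pdy h.isOpen h.smooth)
    (fun z hz => (h.frame z hz).yy) (h.hasDerivAt_metric hx) hx y
  rw [mink_comm (pdy f (x, y))] at this
  linarith

theorem mink_fxy_fx : mink (pdx (pdy f) (x, y)) (pdx f (x, y)) = 0 := by
  have := pdy_mink h.isOpen (contDiffOn_pdx h.isOpen h.smooth) (contDiffOn_pdx h.isOpen h.smooth)
    (fun z hz => (h.frame z hz).xx) hx y
  rw [mink_comm (pdx f (x, y)), ← pdx_pdy h.isOpen h.smooth (mk_mem_strip.2 hx)] at this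
  linarith

theorem mink_fyy_fy : mink (pdy (pdy f) (x, y)) (pdy f (x, y)) = 0 := by
  have := pdy_mink h.isOpen (contDiffOn_pdy h.isOpen h.smooth) (contDiffOn_pdy h.isOpen h.smooth)
    (fun z hz => (h.frame z hz).yy) hx y
  rw [mink_comm (pdy f (x, y))] at this
  linarith

theorem mink_fxx_fy : mink (pdx (pdx f) (x, y)) (pdy f (x, y)) = 0 := by
  have := pdx_mink h.isOpen (contDiffOn_pdx h.isOpen h.smooth) (contDiffOn_pdy h.isOpen h.smooth)
    (c := fun _ => 0) (fun z hz => (h.frame z hz).xy) (hasDerivAt_const x 0) hx y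
  rw [mink_comm (pdx f (x, y)), h.mink_fxy_fx hx y] at this
  linarith

theorem mink_fyy_fx : mink (pdy (pdy f) (x, y)) (pdx f (x, y)) = -(deriv m x / 2) := by
  have := pdy_mink h.isOpen (contDiffOn_pdx h.isOpen h.smooth) (contDiffOn_pdy h.isOpen h.smooth)
    (c := fun _ => 0) (fun z hz => (h.frame z hz).xy) hx y
  rw [mink_comm (pdx f (x, y)), ← pdx_pdy h.isOpen h.smooth (mk_mem_strip.2 hx),
    h.mink_fxy_fy hx y] at this
  linarith

theorem fxx_eq : pdx (pdx f) (x, y) =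
    (deriv m x / 2 / m x) • pdx f (x, y) - hxx f N (x, y) • N (x, y) := by
  have := (h.frame (x, y) (mk_mem_strip.2 hx)).decomp (pdx (pdx f) (x, y))
  rw [h.mink_fxx_fx hx, h.mink_fxx_fy hx, mink_comm _ (N (x, y))] at this
  simpa [hxx] using this

theorem fxy_eq : pdx (pdy f) (x, y) =
    (deriv m x / 2 / m x) • pdy f (x, y) - hxy f N (x, y) • N (x, y) := by
  have := (h.frame (x, y) (mk_mem_strip.2 hx)).decomp (pdx (pdy f) (x, y))
  rw [h.mink_fxy_fx hx, h.mink_fxy_fy hx, mink_comm _ (N (x, y))] at this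
  simpa [hxy] using this

theorem fyy_eq : pdy (pdy f) (x, y) =
    -(deriv m x / 2 / m x) • pdx f (x, y) - hyy f N (x, y) • N (x, y) := by
  have := (h.frame (x, y) (mk_mem_strip.2 hx)).decomp (pdy (pdy f) (x, y))
  rw [h.mink_fyy_fx hx, h.mink_fyy_fy hx, mink_comm _ (N (x, y))] at this
  simpa [hyy, neg_div] using this

/-- In f_xx + f_yy the tangential parts cancel, and the normal part is determined by the mean
curvature. As H ≠ 0 this recovers N from f, which makes the merely continuous normal smooth, unique
and equivariant. -/
theorem normal_eq (hH : H ≠ 0) : N (x, y) =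
    (-(1 / (2 * H * m x))) • (pdx (pdx f) (x, y) + pdy (pdy f) (x, y)) := by
  have hm := (h.frame (x, y) (mk_mem_strip.2 hx)).pos.ne'
  have hs := h.mean (x, y) (mk_mem_strip.2 hx)
  rw [h.fxx_eq hx, h.fyy_eq hx]
  simp only at hm hs
  have : (deriv m x / 2 / m x) • pdx f (x, y) - hxx f N (x, y) • N (x, y) +
      (-(deriv m x / 2 / m x) • pdx f (x, y) - hyy f N (x, y) • N (x, y)) =
      (-(hxx f N (x, y) + hyy f N (x, y))) • N (x, y) := by module
  rw [this, hs, smul_smul]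
  have e : -(1 / (2 * H * m x)) * -(2 * H * m x) = 1 := by field_simp
  rw [e, one_smul]

omit hx in
theorem contDiffOn_normal (hH : H ≠ 0) : ContDiffOn ℝ ∞ N (strip J) := by
  have hm : ContDiffOn ℝ ∞ (fun z : ℝ × ℝ => -(1 / (2 * H * m z.1))) (strip J) := by
    refine (contDiffOn_const.div (contDiffOn_const.mul
      (h.contDiffOn_metric.comp contDiffOn_fst fun z hz => hz.1)) fun z hz => ?_).neg
    have := (h.frame z hz).pos
    positivity
  refine (hm.smul ((contDiffOn_pdx h.isOpen (contDiffOn_pdx h.isOpen h.smooth)).add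
    (contDiffOn_pdy h.isOpen (contDiffOn_pdy h.isOpen h.smooth)))).congr ?_
  rintro ⟨x, y⟩ hz
  exact h.normal_eq (mk_mem_strip.1 hz) y hH

theorem mink_nx_fx (hH : H ≠ 0) : mink (pdx N (x, y)) (pdx f (x, y)) = -hxx f N (x, y) := by
  have := pdx_mink h.isOpen (h.contDiffOn_normal hH) (contDiffOn_pdx h.isOpen h.smooth)
    (c := fun _ => 0) (fun z hz => (h.frame z hz).nx) (hasDerivAt_const x 0) hx y
  unfold hxx
  linarith

theorem mink_nx_fy (hH : H ≠ 0) : mink (pdx N (x, y)) (pdy f (x, y)) = -hxy f N (x, y) := by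
  have := pdx_mink h.isOpen (h.contDiffOn_normal hH) (contDiffOn_pdy h.isOpen h.smooth)
    (c := fun _ => 0) (fun z hz => (h.frame z hz).ny) (hasDerivAt_const x 0) hx y
  unfold hxy
  linarith

theorem mink_ny_fx (hH : H ≠ 0) : mink (pdy N (x, y)) (pdx f (x, y)) = -hxy f N (x, y) := by
  have := pdy_mink h.isOpen (h.contDiffOn_normal hH) (contDiffOn_pdx h.isOpen h.smooth)
    (c := fun _ => 0) (fun z hz => (h.frame z hz).nx) hx y
  rw [← pdx_pdy h.isOpen h.smooth (mk_mem_strip.2 hx)] at this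
  unfold hxy
  linarith

theorem mink_ny_fy (hH : H ≠ 0) : mink (pdy N (x, y)) (pdy f (x, y)) = -hyy f N (x, y) := by
  have := pdy_mink h.isOpen (h.contDiffOn_normal hH) (contDiffOn_pdy h.isOpen h.smooth)
    (c := fun _ => 0) (fun z hz => (h.frame z hz).ny) hx y
  unfold hyy
  linarith

theorem nx_eq (hH : H ≠ 0) : pdx N (x, y) =
    -(hxx f N (x, y) / m x) • pdx f (x, y) - (hxy f N (x, y) / m x) • pdy f (x, y) := by
  have h0 := pdx_mink h.isOpen (h.contDiffOn_normal hH) (h.contDiffOn_normal hH)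
    (c := fun _ => -1) (fun z hz => (h.frame z hz).nn) (hasDerivAt_const x _) hx y
  rw [mink_comm (N (x, y))] at h0
  have h1 : mink (pdx N (x, y)) (N (x, y)) = 0 := by linarith
  have := (h.frame (x, y) (mk_mem_strip.2 hx)).decomp (pdx N (x, y))
  rw [h.mink_nx_fx hx y hH, h.mink_nx_fy hx y hH, h1] at this
  rw [this]
  module

theorem ny_eq (hH : H ≠ 0) : pdy N (x, y) =
    -(hxy f N (x, y) / m x) • pdx f (x, y) - (hyy f N (x, y) / m x) • pdy f (x, y) := by
  have h0 := pdy_mink h.isOpen (h.contDiffOn_normal hH) (h.contDiffOn_normal hH)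
    (c := fun _ => -1) (fun z hz => (h.frame z hz).nn) hx y
  rw [mink_comm (N (x, y))] at h0
  have h1 : mink (pdy N (x, y)) (N (x, y)) = 0 := by linarith
  have := (h.frame (x, y) (mk_mem_strip.2 hx)).decomp (pdy N (x, y))
  rw [h.mink_ny_fx hx y hH, h.mink_ny_fy hx y hH, h1] at this
  rw [this]
  module

end ConfSurf

/-! ### Coordinate changes and isometries -/

/-- The coordinate change `(x, y) ↦ (a x, b x + k y)`. -/
def chg (a b : ℝ → ℝ) (k : ℝ) (z : ℝ × ℝ) : ℝ × ℝ := (a z.1, b z.1 + k * z.2)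

section Change

variable {J₁ J₂ : Set ℝ} {a b : ℝ → ℝ} {k : ℝ}

theorem chg_mem_strip (hm : MapsTo a J₁ J₂) (hz : z ∈ strip J₁) : chg a b k z ∈ strip J₂ :=
  ⟨hm hz.1, trivial⟩

variable (hJ₁ : IsOpen J₁) (hJ₂ : IsOpen J₂) (ha : ContDiffOn ℝ ∞ a J₁) (hb : ContDiffOn ℝ ∞ b J₁)
  (hm : MapsTo a J₁ J₂) (hf : ContDiffOn ℝ ∞ f (strip J₂))

theorem hasDerivAt_of_contDiffOn {F : Type*} [NormedAddCommGroup F] [NormedSpace ℝ F] {u : ℝ → F}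
    {I : Set ℝ} (hI : IsOpen I) (hu : ContDiffOn ℝ ∞ u I) {x : ℝ} (hx : x ∈ I) :
    HasDerivAt u (deriv u x) x :=
  ((hu.contDiffAt (hI.mem_nhds hx)).differentiableAt (by simp)).hasDerivAt

include ha hb in
theorem contDiffOn_chg : ContDiffOn ℝ ∞ (chg a b k) (strip J₁) :=
  (ha.comp contDiffOn_fst fun _ hz => hz.1).prodMk
    ((hb.comp contDiffOn_fst fun _ hz => hz.1).add (contDiffOn_const.mul contDiffOn_snd))

include ha hb hm hf in
theorem contDiffOn_comp_chg : ContDiffOn ℝ ∞ (fun z => f (chg a b k z)) (strip J₁) :=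
  hf.comp (contDiffOn_chg ha hb) fun _ hz => chg_mem_strip hm hz

include hJ₁ hJ₂ ha hb hm hf

theorem hasDerivAt_comp_chg {x : ℝ} (hx : x ∈ J₁) (y : ℝ) :
    HasDerivAt (fun s => f (chg a b k (s, y)))
      (deriv a x • pdx f (chg a b k (x, y)) + deriv b x • pdy f (chg a b k (x, y))) x :=
  hasDerivAt_comp_curve hJ₂ hf (hasDerivAt_of_contDiffOn hJ₁ ha hx)
    ((hasDerivAt_of_contDiffOn hJ₁ hb hx).add_const (k * y)) (hm hx)

theorem pdx_comp_chg {x : ℝ} (hx : x ∈ J₁) (y : ℝ) : pdx (fun z => f (chg a b k z)) (x, y) =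
    deriv a x • pdx f (chg a b k (x, y)) + deriv b x • pdy f (chg a b k (x, y)) :=
  pdx_eq hJ₁ (contDiffOn_comp_chg ha hb hm hf) hx (hasDerivAt_comp_chg hJ₁ hJ₂ ha hb hm hf hx y)

theorem pdy_comp_chg {x : ℝ} (hx : x ∈ J₁) (y : ℝ) : pdy (fun z => f (chg a b k z)) (x, y) =
    k • pdy f (chg a b k (x, y)) := by
  refine pdy_eq hJ₁ (contDiffOn_comp_chg ha hb hm hf) hx ?_
  have := hasDerivAt_comp_curve hJ₂ hf (hasDerivAt_const y (a x))
    (((hasDerivAt_id y).const_mul k).const_add (b x)) (hm hx)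
  simpa [chg] using this

theorem pdx_pdx_comp_chg {x : ℝ} (hx : x ∈ J₁) (y : ℝ) :
    pdx (pdx (fun z => f (chg a b k z))) (x, y) =
      deriv (deriv a) x • pdx f (chg a b k (x, y)) + deriv (deriv b) x • pdy f (chg a b k (x, y)) +
      (deriv a x ^ 2) • pdx (pdx f) (chg a b k (x, y)) +
      (2 * deriv a x * deriv b x) • pdx (pdy f) (chg a b k (x, y)) +
      (deriv b x ^ 2) • pdy (pdy f) (chg a b k (x, y)) := by
  refine pdx_eq hJ₁ (contDiffOn_pdx hJ₁ (contDiffOn_comp_chg ha hb hm hf)) hx ?_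
  have h1 := (hasDerivAt_of_contDiffOn hJ₁ (ha.deriv_of_isOpen (m := ∞) hJ₁ (by simp)) hx).smul
    (hasDerivAt_comp_chg (k := k) hJ₁ hJ₂ ha hb hm (contDiffOn_pdx hJ₂ hf) hx y)
  have h2 := (hasDerivAt_of_contDiffOn hJ₁ (hb.deriv_of_isOpen (m := ∞) hJ₁ (by simp)) hx).smul
    (hasDerivAt_comp_chg (k := k) hJ₁ hJ₂ ha hb hm (contDiffOn_pdy hJ₂ hf) hx y)
  refine ((h1.add h2).congr_of_eventuallyEq (EqOn.eventuallyEq_of_mem (s := J₁) (fun s hs => ?_)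
    (hJ₁.mem_nhds hx))).congr_deriv ?_
  · simpa using pdx_comp_chg hJ₁ hJ₂ ha hb hm hf hs y
  · rw [← pdx_pdy hJ₂ hf (chg_mem_strip hm (mk_mem_strip.2 hx))]
    module

theorem pdx_pdy_comp_chg {x : ℝ} (hx : x ∈ J₁) (y : ℝ) :
    pdx (pdy (fun z => f (chg a b k z))) (x, y) =
      (k * deriv a x) • pdx (pdy f) (chg a b k (x, y)) +
      (k * deriv b x) • pdy (pdy f) (chg a b k (x, y)) := by
  refine pdx_eq hJ₁ (contDiffOn_pdy hJ₁ (contDiffOn_comp_chg ha hb hm hf)) hx ?_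
  have h2 := (hasDerivAt_comp_chg (k := k) hJ₁ hJ₂ ha hb hm (contDiffOn_pdy hJ₂ hf) hx y).const_smul
    k
  refine (h2.congr_of_eventuallyEq (EqOn.eventuallyEq_of_mem (s := J₁) (fun s hs => ?_)
    (hJ₁.mem_nhds hx))).congr_deriv ?_
  · simpa using pdy_comp_chg hJ₁ hJ₂ ha hb hm hf hs y
  · module

theorem pdy_pdy_comp_chg {x : ℝ} (hx : x ∈ J₁) (y : ℝ) :
    pdy (pdy (fun z => f (chg a b k z))) (x, y) = (k ^ 2) • pdy (pdy f) (chg a b k (x, y)) := by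
  refine pdy_eq hJ₁ (contDiffOn_pdy hJ₁ (contDiffOn_comp_chg ha hb hm hf)) hx ?_
  have h1 := (hasDerivAt_comp_curve hJ₂ (contDiffOn_pdy hJ₂ hf) (hasDerivAt_const y (a x))
    (((hasDerivAt_id y).const_mul k).const_add (b x)) (hm hx)).const_smul k
  refine (h1.congr_of_eventuallyEq (Eventually.of_forall fun s => ?_)).congr_deriv ?_
  · simpa [chg] using pdy_comp_chg hJ₁ hJ₂ ha hb hm hf hx s
  · simp [chg, smul_smul, sq]

/-- First-order terms disappear against the normal. What remains multiplies numerator and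
denominator by the square of the Jacobian determinant a'k. -/
theorem meanCurvature_comp_chg {x : ℝ} (hx : x ∈ J₁) (y : ℝ) (hd : deriv a x * k ≠ 0)
    (hnx : mink (N (chg a b k (x, y))) (pdx f (chg a b k (x, y))) = 0)
    (hny : mink (N (chg a b k (x, y))) (pdy f (chg a b k (x, y))) = 0) :
    meanCurvature (fun z => f (chg a b k z)) (fun z => N (chg a b k z)) (x, y) =
      meanCurvature f N (chg a b k (x, y)) := by
  unfold meanCurvature
  rw [pdx_pdx_comp_chg hJ₁ hJ₂ ha hb hm hf hx, pdx_pdy_comp_chg hJ₁ hJ₂ ha hb hm hf hx,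
    pdy_pdy_comp_chg hJ₁ hJ₂ ha hb hm hf hx, pdx_comp_chg hJ₁ hJ₂ ha hb hm hf hx,
    pdy_comp_chg hJ₁ hJ₂ ha hb hm hf hx]
  simp only [mink_add_left, mink_add_right, mink_smul_left, mink_smul_right, hnx, hny]
  rw [mink_comm (pdy f (chg a b k (x, y))) (pdx f (chg a b k (x, y)))]
  refine Eq.trans ?_ (mul_div_mul_left _ _ (pow_ne_zero 2 hd))
  congr 1 <;> ring

end Change

section Isometry

variable (hJ : IsOpen J) (hf : ContDiffOn ℝ ∞ f (strip J)) (L : Mink →ₗ[ℝ] Mink)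
  (A : Mink ≃ᵃ[ℝ] Mink)

include hf in
theorem contDiffOn_linear_comp : ContDiffOn ℝ ∞ (fun z => L (f z)) (strip J) :=
  (LinearMap.toContinuousLinearMap L).contDiff.comp_contDiffOn hf

include hf in
theorem contDiffOn_affine_comp : ContDiffOn ℝ ∞ (fun z => A (f z)) (strip J) :=
  (contDiff_affine A).comp_contDiffOn hf

include hJ hf

theorem pdx_linear_comp : EqOn (pdx fun z => L (f z)) (fun z => L (pdx f z)) (strip J) := by
  rintro ⟨x, y⟩ hz
  exact pdx_eq hJ (contDiffOn_linear_comp hf L) (mk_mem_strip.1 hz)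
    (HasDerivAt.linearMap_comp (hasDerivAt_pdx hJ hf (mk_mem_strip.1 hz) y) L)

theorem pdy_linear_comp : EqOn (pdy fun z => L (f z)) (fun z => L (pdy f z)) (strip J) := by
  rintro ⟨x, y⟩ hz
  exact pdy_eq hJ (contDiffOn_linear_comp hf L) (mk_mem_strip.1 hz)
    (HasDerivAt.linearMap_comp (hasDerivAt_pdy hJ hf (mk_mem_strip.1 hz) y) L)

theorem pdx_affine_comp : EqOn (pdx fun z => A (f z)) (fun z => A.linear (pdx f z)) (strip J) := by
  rintro ⟨x, y⟩ hz
  exact pdx_eq hJ (contDiffOn_affine_comp hf A) (mk_mem_strip.1 hz)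
    (HasDerivAt.affine_comp (hasDerivAt_pdx hJ hf (mk_mem_strip.1 hz) y) A)

theorem pdy_affine_comp : EqOn (pdy fun z => A (f z)) (fun z => A.linear (pdy f z)) (strip J) := by
  rintro ⟨x, y⟩ hz
  exact pdy_eq hJ (contDiffOn_affine_comp hf A) (mk_mem_strip.1 hz)
    (HasDerivAt.affine_comp (hasDerivAt_pdy hJ hf (mk_mem_strip.1 hz) y) A)

theorem pdx_pdx_affine_comp :
    EqOn (pdx (pdx fun z => A (f z))) (fun z => A.linear (pdx (pdx f) z)) (strip J) :=
  (pdx_congr hJ (pdx_affine_comp hJ hf A)).trans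
    (pdx_linear_comp hJ (contDiffOn_pdx hJ hf) A.linear)

theorem pdx_pdy_affine_comp :
    EqOn (pdx (pdy fun z => A (f z))) (fun z => A.linear (pdx (pdy f) z)) (strip J) :=
  (pdx_congr hJ (pdy_affine_comp hJ hf A)).trans
    (pdx_linear_comp hJ (contDiffOn_pdy hJ hf) A.linear)

theorem pdy_pdy_affine_comp :
    EqOn (pdy (pdy fun z => A (f z))) (fun z => A.linear (pdy (pdy f) z)) (strip J) :=
  (pdy_congr hJ (pdy_affine_comp hJ hf A)).trans
    (pdy_linear_comp hJ (contDiffOn_pdy hJ hf) A.linear)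

end Isometry

end CMC
end

noncomputable section

namespace CMC

open Filter Topology Metric
open scoped NNReal

/-! ### Behaviour of conformal surfaces under restriction, isometries and maps z ↦ kz + const. -/

variable {J : Set ℝ} {f g N : ℝ × ℝ → Mink} {m : ℝ → ℝ} {H : ℝ} {z : ℝ × ℝ}

namespace ConfSurf

theorem mono {J' : Set ℝ} (h : ConfSurf H J f N m) (hJ' : IsOpenInterval J') (hs : J' ⊆ J) :
    ConfSurf H J' f N m :=
  ⟨hJ', h.smooth.mono (prod_mono_left hs), fun z hz => h.frame z (prod_mono_left hs hz),
    fun z hz => h.mean z (prod_mono_left hs hz)⟩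

theorem congr_metric {m' : ℝ → ℝ} (h : ConfSurf H J f N m) (hm : EqOn m' m J) :
    ConfSurf H J f N m' :=
  ⟨h.interval, h.smooth, fun z hz => by rw [hm hz.1]; exact h.frame z hz,
    fun z hz => by rw [hm hz.1]; exact h.mean z hz⟩

theorem _root_.CMC.h_congr {M : ℝ × ℝ → Mink} (hJ : IsOpen J) (he : EqOn g f (strip J))
    (hN : EqOn M N (strip J)) (hz : z ∈ strip J) :
    hxx g M z = hxx f N z ∧ hxy g M z = hxy f N z ∧ hyy g M z = hyy f N z := by
  unfold hxx hxy hyy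
  rw [pdx_congr hJ (pdx_congr hJ he) hz, pdx_congr hJ (pdy_congr hJ he) hz,
    pdy_congr hJ (pdy_congr hJ he) hz, hN hz]
  exact ⟨rfl, rfl, rfl⟩

theorem congr (h : ConfSurf H J f N m) (he : EqOn g f (strip J)) : ConfSurf H J g N m :=
  ⟨h.interval, h.smooth.congr he, fun z hz => by
    rw [pdx_congr h.isOpen he hz, pdy_congr h.isOpen he hz]; exact h.frame z hz, fun z hz => by
    obtain ⟨h1, -, h3⟩ := h_congr h.isOpen he (fun _ _ => rfl : EqOn N N (strip J)) hz
    rw [h1, h3]; exact h.mean z hz⟩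

theorem _root_.CMC.h_affine (hJ : IsOpen J) (hf : ContDiffOn ℝ ∞ f (strip J)) {A : Mink ≃ᵃ[ℝ] Mink}
    (hA : IsIsometry A) (hz : z ∈ strip J) :
    hxx (fun z => A (f z)) (fun z => A.linear (N z)) z = hxx f N z ∧
    hxy (fun z => A (f z)) (fun z => A.linear (N z)) z = hxy f N z ∧
    hyy (fun z => A (f z)) (fun z => A.linear (N z)) z = hyy f N z := by
  unfold hxx hxy hyy
  rw [pdx_pdx_affine_comp hJ hf A hz, pdx_pdy_affine_comp hJ hf A hz,
    pdy_pdy_affine_comp hJ hf A hz]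
  exact ⟨hA.linear_mink _ _, hA.linear_mink _ _, hA.linear_mink _ _⟩

theorem affine (h : ConfSurf H J f N m) {A : Mink ≃ᵃ[ℝ] Mink} (hA : IsIsometry A) :
    ConfSurf H J (fun z => A (f z)) (fun z => A.linear (N z)) m := by
  refine ⟨h.interval, contDiffOn_affine_comp h.smooth A, fun z hz => ?_, fun z hz => ?_⟩
  · rw [pdx_affine_comp h.isOpen h.smooth A hz, pdy_affine_comp h.isOpen h.smooth A hz]
    have hF := h.frame z hz
    exact ⟨hF.pos, by rw [hA.linear_mink, hF.xx], by rw [hA.linear_mink, hF.yy],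
      by rw [hA.linear_mink, hF.xy], by rw [hA.linear_mink, hF.nn], by rw [hA.linear_mink, hF.nx],
      by rw [hA.linear_mink, hF.ny]⟩
  · obtain ⟨h1, -, h3⟩ := h_affine (N := N) h.isOpen h.smooth hA hz
    rw [h1, h3]
    exact h.mean z hz

/-- The holomorphic coordinate change `z ↦ k z + (c, d)`. -/
abbrev _root_.CMC.hchg (k c d : ℝ) : ℝ × ℝ → ℝ × ℝ := chg (fun x => k * x + c) (fun _ => d) k

theorem _root_.CMC.deriv_lin (k c : ℝ) : deriv (fun x : ℝ => k * x + c) = fun _ => k := by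
  ext x
  have : HasDerivAt (fun x => k * x + c) k x := by
    simpa using ((hasDerivAt_id x).const_mul k).add_const c
  exact this.deriv

theorem _root_.CMC.h_comp {k c d : ℝ} (hk : k ≠ 0) (hJ : IsOpenInterval J)
    (hf : ContDiffOn ℝ ∞ f (strip J)) (hz : z ∈ strip ((fun x => k * x + c) ⁻¹' J)) :
    hxx (fun z => f (hchg k c d z)) (fun z => N (hchg k c d z)) z = k ^ 2 * hxx f N (hchg k c d z) ∧
    hxy (fun z => f (hchg k c d z)) (fun z => N (hchg k c d z)) z = k ^ 2 * hxy f N (hchg k c d z) ∧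
    hyy (fun z => f (hchg k c d z)) (fun z => N (hchg k c d z)) z =
      k ^ 2 * hyy f N (hchg k c d z) := by
  obtain ⟨x, y⟩ := z
  have hJ' := hJ.preimage hk c
  have hx := mk_mem_strip.1 hz
  have hm : MapsTo (fun x => k * x + c) ((fun x => k * x + c) ⁻¹' J) J := fun _ h => h
  unfold hxx hxy hyy
  rw [pdx_pdx_comp_chg hJ'.1 hJ.1 (by fun_prop) (by fun_prop) hm hf hx,
    pdx_pdy_comp_chg hJ'.1 hJ.1 (by fun_prop) (by fun_prop) hm hf hx,
    pdy_pdy_comp_chg hJ'.1 hJ.1 (by fun_prop) (by fun_prop) hm hf hx]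
  simp only [deriv_lin, deriv_const', mink_add_right, mink_smul_right]
  exact ⟨by ring, by ring, trivial⟩

theorem comp (h : ConfSurf H J f N m) {k : ℝ} (hk : k ≠ 0) (c d : ℝ) :
    ConfSurf H ((fun x => k * x + c) ⁻¹' J) (fun z => f (hchg k c d z)) (fun z => N (hchg k c d z))
      (fun x => k ^ 2 * m (k * x + c)) := by
  have hJ' := h.interval.preimage hk c
  have hm : MapsTo (fun x => k * x + c) ((fun x => k * x + c) ⁻¹' J) J := fun _ h => h
  refine ⟨hJ', contDiffOn_comp_chg (by fun_prop) (by fun_prop) hm h.smooth, ?_, fun z hz => ?_⟩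
  · rintro ⟨x, y⟩ hz
    have hx := mk_mem_strip.1 hz
    rw [pdx_comp_chg hJ'.1 h.isOpen (by fun_prop) (by fun_prop) hm h.smooth hx,
      pdy_comp_chg hJ'.1 h.isOpen (by fun_prop) (by fun_prop) hm h.smooth hx]
    simp only [deriv_lin, deriv_const', zero_smul, add_zero]
    have hF := h.frame (hchg k c d (x, y)) (mk_mem_strip.2 hx)
    have e : ∀ V W : Mink, mink (k • V) (k • W) = k ^ 2 * mink V W := fun V W => by
      rw [mink_smul_left, mink_smul_right]; ring
    refine ⟨mul_pos (by positivity) hF.pos, ?_, ?_, ?_, hF.nn, ?_, ?_⟩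
    · rw [e, hF.xx]; rfl
    · rw [e, hF.yy]; rfl
    · rw [e, hF.xy, mul_zero]
    · rw [mink_smul_right, hF.nx, mul_zero]
    · rw [mink_smul_right, hF.ny, mul_zero]
  · obtain ⟨h1, -, h3⟩ := h_comp (N := N) (d := d) hk h.interval h.smooth hz
    have := h.mean (hchg k c d z) (mk_mem_strip.2 hz.1)
    rw [h1, h3, ← mul_add, this]
    simp only [chg]
    ring

theorem unique {M : ℝ × ℝ → Mink} {m' : ℝ → ℝ} (h : ConfSurf H J f N m) (h' : ConfSurf H J f M m')
    (hH : H ≠ 0) : EqOn m m' J ∧ EqOn N M (strip J) := by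
  have hm : EqOn m m' J := fun x hx => by
    rw [← (h.frame (x, 0) (mk_mem_strip.2 hx)).xx, ← (h'.frame (x, 0) (mk_mem_strip.2 hx)).xx]
  refine ⟨hm, ?_⟩
  rintro ⟨x, y⟩ hz
  rw [h.normal_eq (mk_mem_strip.1 hz) y hH, h'.normal_eq (mk_mem_strip.1 hz) y hH,
    hm (mk_mem_strip.1 hz)]

end ConfSurf

/-! ### Uniqueness -/

theorem eq_of_strip_hasDerivAt_zero {F : Type*} [NormedAddCommGroup F] [NormedSpace ℝ F]
    (hJ : IsOpenInterval J) {u : ℝ × ℝ → F}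
    (hx : ∀ x ∈ J, ∀ y, HasDerivAt (fun s => u (s, y)) 0 x)
    (hy : ∀ x ∈ J, ∀ y, HasDerivAt (fun s => u (x, s)) 0 y) {z z' : ℝ × ℝ} (hz : z ∈ strip J)
    (hz' : z' ∈ strip J) : u z = u z' := by
  obtain ⟨x, y⟩ := z
  obtain ⟨x', y'⟩ := z'
  have hx1 := mk_mem_strip.1 hz
  have hx2 := mk_mem_strip.1 hz'
  have h1 : u (x, y) = u (x', y) := hJ.eq_of_hasDerivAt_zero (fun x h => hx x h y) hx1 hx2
  have h2 : u (x', y) = u (x', y') :=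
    IsOpenInterval.eq_of_hasDerivAt_zero ⟨isOpen_univ, ordConnected_univ, univ_nonempty⟩
      (fun y _ => hy x' hx2 y) (mem_univ y) (mem_univ y')
  exact h1.trans h2

theorem IsFrame.mink_eq {m : ℝ} {X Y N : Mink} (h : IsFrame m X Y N) (V W : Mink) :
    mink V W = mink V X * mink W X / m + mink V Y * mink W Y / m - mink V N * mink W N := by
  nth_rewrite 1 [h.decomp V]
  simp only [mink_sub_left, mink_add_left, mink_smul_left]
  rw [mink_comm X, mink_comm Y, mink_comm N]
  ring

/-- The linear map which carries the frame `X`, `Y`, `N` to the frame `X'`, `Y'`, `N'`. -/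
def frameMap (m : ℝ) (X Y N X' Y' N' : Mink) : Mink →ₗ[ℝ] Mink where
  toFun V := (mink V X / m) • X' + (mink V Y / m) • Y' - mink V N • N'
  map_add' V W := by simp only [mink_add_left]; module
  map_smul' a V := by simp only [mink_smul_left, RingHom.id_apply]; module

theorem frameMap_apply (m : ℝ) (X Y N X' Y' N' V : Mink) : frameMap m X Y N X' Y' N' V =
    (mink V X / m) • X' + (mink V Y / m) • Y' - mink V N • N' := rfl

theorem mink_frameMap {m : ℝ} {X Y N X' Y' N' : Mink} (h : IsFrame m X Y N)
    (h' : IsFrame m X' Y' N') (V : Mink) :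
    mink (frameMap m X Y N X' Y' N' V) (frameMap m X Y N X' Y' N' V) = mink V V := by
  have hm := h.pos.ne'
  rw [frameMap_apply, h.mink_eq V V]
  simp only [mink_sub_left, mink_add_left, mink_smul_left, mink_sub_right, mink_add_right,
    mink_smul_right]
  rw [mink_comm X' N', mink_comm Y' N', mink_comm Y' X', h'.xx, h'.yy, h'.xy, h'.nn, h'.nx, h'.ny]
  field_simp
  ring

theorem IsFrame.exists_isometry {m : ℝ} {X Y N X' Y' N' : Mink} (h : IsFrame m X Y N)
    (h' : IsFrame m X' Y' N') (p q : Mink) : ∃ A : Mink ≃ᵃ[ℝ] Mink, IsIsometry A ∧ A p = q ∧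
      ∀ V, A.linear V = frameMap m X Y N X' Y' N' V := by
  set Λ := frameMap m X Y N X' Y' N'
  have hinj : Function.Injective Λ := by
    rw [← LinearMap.ker_eq_bot, LinearMap.ker_eq_bot']
    intro V hV
    have hm := h.pos.ne'
    have h1 : ∀ W, mink (Λ V) W = 0 := fun W => by rw [hV, mink_zero_left]
    have hX := h1 X'
    have hY := h1 Y'
    have hN := h1 N'
    rw [frameMap_apply] at hX hY hN
    simp only [mink_sub_left, mink_add_left, mink_smul_left] at hX hY hN
    rw [mink_comm Y' X', h'.xx, h'.xy, h'.nx] at hX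
    rw [h'.yy, h'.xy, h'.ny] at hY
    rw [mink_comm X' N', mink_comm Y' N', h'.nn, h'.nx, h'.ny] at hN
    refine h.ext ?_ ?_ ?_ <;> rw [mink_zero_left]
    · rw [div_mul_cancel₀ _ hm] at hX; linarith
    · rw [div_mul_cancel₀ _ hm] at hY; linarith
    · linarith
  set e := (LinearEquiv.ofInjectiveEndo Λ hinj)
  have he : ∀ V, e V = Λ V := fun V => rfl
  refine ⟨e.toAffineEquiv.trans (AffineEquiv.constVAdd ℝ Mink (q - Λ p)),
    IsIsometry.of_linear fun V => ?_, ?_, fun V => ?_⟩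
  · exact mink_frameMap h h' V
  · show (q - Λ p) + Λ p = q
    abel
  · rfl

/-- Conformally parametrized surfaces with the same metric and the same second fundamental form
agree up to an isometry. -/
theorem ConfSurf.exists_isometry {f' N' : ℝ × ℝ → Mink} (h : ConfSurf H J f N m)
    (h' : ConfSurf H J f' N' m) (hH : H ≠ 0) (e1 : EqOn (hxx f N) (hxx f' N') (strip J))
    (e2 : EqOn (hxy f N) (hxy f' N') (strip J)) (e3 : EqOn (hyy f N) (hyy f' N') (strip J)) :
    ∃ A : Mink ≃ᵃ[ℝ] Mink, IsIsometry A ∧ ∀ z ∈ strip J, A (f z) = f' z := by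
  obtain ⟨x₀, hx₀⟩ := h.interval.2.2
  have hz₀ : (x₀, (0 : ℝ)) ∈ strip J := mk_mem_strip.2 hx₀
  have hJ := h.isOpen
  have hdx := fun {x} (hx : x ∈ J) y => hasDerivAt_pdx hJ (contDiffOn_pdx hJ h.smooth) hx y
  -- The linear map carrying the frame of f at z to that of f' at z. Both frames satisfy the same
  -- structure equations, so it does not depend on z; its value is the linear part of the isometry.
  set Λ : ℝ × ℝ → Mink →ₗ[ℝ] Mink := fun z =>
    frameMap (m z.1) (pdx f z) (pdy f z) (N z) (pdx f' z) (pdy f' z) (N' z) with hΛ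
  have hconst : ∀ V, ∀ z ∈ strip J, Λ (x₀, 0) V = Λ z V := by
    intro V z hz
    refine eq_of_strip_hasDerivAt_zero (u := fun z => Λ z V) h.interval (fun x hx y => ?_)
      (fun x hx y => ?_) hz₀ hz
    · have hm0 := (h.frame (x, y) (mk_mem_strip.2 hx)).pos.ne'
      have hm := h.hasDerivAt_metric hx
      have hX := hasDerivAt_pdx hJ (contDiffOn_pdx hJ h.smooth) hx y
      have hY := hasDerivAt_pdx hJ (contDiffOn_pdy hJ h.smooth) hx y
      have hN := hasDerivAt_pdx hJ (h.contDiffOn_normal hH) hx y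
      have hX' := hasDerivAt_pdx hJ (contDiffOn_pdx hJ h'.smooth) hx y
      have hY' := hasDerivAt_pdx hJ (contDiffOn_pdy hJ h'.smooth) hx y
      have hN' := hasDerivAt_pdx hJ (h'.contDiffOn_normal hH) hx y
      have hV := hasDerivAt_const x V
      have key := ((((HasDerivAt.mink hV hX).div hm hm0).smul hX').add
        (((HasDerivAt.mink hV hY).div hm hm0).smul hY')).sub ((HasDerivAt.mink hV hN).smul hN')
      refine HasDerivAt.congr_deriv key ?_
      rw [h.fxx_eq hx, h.fxy_eq hx, h.nx_eq hx y hH, h'.fxx_eq hx, h'.fxy_eq hx, h'.nx_eq hx y hH,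
        ← e1 (mk_mem_strip.2 hx), ← e2 (mk_mem_strip.2 hx)]
      simp only [mink_zero_left, mink_sub_right, mink_smul_right, Pi.div_apply] at hm0 ⊢
      match_scalars <;> field_simp <;> ring
    · have hm0 := (h.frame (x, y) (mk_mem_strip.2 hx)).pos.ne'
      have hX := hasDerivAt_pdy hJ (contDiffOn_pdx hJ h.smooth) hx y
      have hY := hasDerivAt_pdy hJ (contDiffOn_pdy hJ h.smooth) hx y
      have hN := hasDerivAt_pdy hJ (h.contDiffOn_normal hH) hx y
      have hX' := hasDerivAt_pdy hJ (contDiffOn_pdx hJ h'.smooth) hx y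
      have hY' := hasDerivAt_pdy hJ (contDiffOn_pdy hJ h'.smooth) hx y
      have hN' := hasDerivAt_pdy hJ (h'.contDiffOn_normal hH) hx y
      have hV := hasDerivAt_const y V
      have key := ((((HasDerivAt.mink hV hX).div_const (m x)).smul hX').add
        (((HasDerivAt.mink hV hY).div_const (m x)).smul hY')).sub ((HasDerivAt.mink hV hN).smul hN')
      refine HasDerivAt.congr_deriv key ?_
      rw [← pdx_pdy hJ h.smooth (mk_mem_strip.2 hx), ← pdx_pdy hJ h'.smooth (mk_mem_strip.2 hx),
        h.fyy_eq hx, h.fxy_eq hx, h.ny_eq hx y hH, h'.fyy_eq hx, h'.fxy_eq hx, h'.ny_eq hx y hH,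
        ← e3 (mk_mem_strip.2 hx), ← e2 (mk_mem_strip.2 hx)]
      simp only [mink_zero_left, mink_sub_right, mink_smul_right] at hm0 ⊢
      match_scalars <;> field_simp <;> ring
  obtain ⟨A, hA, hA0, hAl⟩ := (h.frame _ hz₀).exists_isometry (h'.frame _ hz₀) (f (x₀, 0))
    (f' (x₀, 0))
  have hl : ∀ V, ∀ z ∈ strip J, A.linear V = Λ z V := fun V z hz => by
    rw [← hconst V z hz]; exact hAl V
  refine ⟨A, hA, fun z hz => ?_⟩
  have key : A (f z) - f' z = A (f (x₀, 0)) - f' (x₀, 0) := by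
    refine eq_of_strip_hasDerivAt_zero (u := fun z => A (f z) - f' z) h.interval (fun x hx y => ?_)
      (fun x hx y => ?_) hz hz₀
    · refine ((HasDerivAt.affine_comp (hasDerivAt_pdx hJ h.smooth hx y) A).sub
        (hasDerivAt_pdx hJ h'.smooth hx y)).congr_deriv ?_
      have hF := h.frame (x, y) (mk_mem_strip.2 hx)
      rw [hl _ (x, y) (mk_mem_strip.2 hx), hΛ]
      simp only [frameMap_apply, hF.xx, hF.xy, mink_comm (pdx f (x, y)) (N (x, y)), hF.nx]
      simp [hF.pos.ne']
    · refine ((HasDerivAt.affine_comp (hasDerivAt_pdy hJ h.smooth hx y) A).sub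
        (hasDerivAt_pdy hJ h'.smooth hx y)).congr_deriv ?_
      have hF := h.frame (x, y) (mk_mem_strip.2 hx)
      rw [hl _ (x, y) (mk_mem_strip.2 hx), hΛ]
      simp only [frameMap_apply, hF.yy, mink_comm (pdy f (x, y)) (pdx f (x, y)), hF.xy,
        mink_comm (pdy f (x, y)) (N (x, y)), hF.ny]
      simp [hF.pos.ne']
  rw [hA0, sub_self] at key
  exact sub_eq_zero.1 key

end CMC
end

noncomputable section

namespace CMC

open Filter Topology Metric
open scoped NNReal

variable {J : Set ℝ} {f g N : ℝ × ℝ → Mink} {m : ℝ → ℝ} {H : ℝ} {z : ℝ × ℝ}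

/-! ### Equivariant surfaces -/

section Equivariant

variable {R : Multiplicative ℝ →* (Mink ≃ᵃ[ℝ] Mink)}

theorem eqOn_comp_add (hR : ∀ x ∈ J, ∀ y t : ℝ, f (x, y + t) = R (Multiplicative.ofAdd t) (f (x, y)))
    (t : ℝ) : EqOn (fun z => f (hchg 1 0 t z)) (fun z => R (Multiplicative.ofAdd t) (f z))
      (strip J) := by
  rintro ⟨x, y⟩ hz
  show f (1 * x + 0, t + 1 * y) = _
  rw [one_mul, one_mul, add_zero, add_comm, hR x (mk_mem_strip.1 hz)]

theorem pdx_equivariant (hJ : IsOpen J) (hf : ContDiffOn ℝ ∞ f (strip J))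
    (hR : ∀ x ∈ J, ∀ y t : ℝ, f (x, y + t) = R (Multiplicative.ofAdd t) (f (x, y))) {x : ℝ}
    (hx : x ∈ J) (y t : ℝ) :
    pdx f (x, y + t) = (R (Multiplicative.ofAdd t)).linear (pdx f (x, y)) :=
  (hasDerivAt_pdx hJ hf hx (y + t)).unique
    ((HasDerivAt.affine_comp (hasDerivAt_pdx hJ hf hx y) _).congr_of_eventuallyEq
      (EqOn.eventuallyEq_of_mem (fun s hs => hR s hs y t) (hJ.mem_nhds hx)))

theorem pdy_equivariant (hJ : IsOpen J) (hf : ContDiffOn ℝ ∞ f (strip J))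
    (hR : ∀ x ∈ J, ∀ y t : ℝ, f (x, y + t) = R (Multiplicative.ofAdd t) (f (x, y))) {x : ℝ}
    (hx : x ∈ J) (y t : ℝ) :
    pdy f (x, y + t) = (R (Multiplicative.ofAdd t)).linear (pdy f (x, y)) := by
  have h1 : HasDerivAt (fun s => f (x, s + t)) (pdy f (x, y + t)) y := by
    simpa using hasDerivAt_comp_curve hJ hf (hasDerivAt_const y x) ((hasDerivAt_id y).add_const t) hx
  refine h1.unique ?_
  simpa only [hR x hx] using HasDerivAt.affine_comp (hasDerivAt_pdy hJ hf hx y) _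

/-- Both f(x, y + t) and R_t f are conformal surfaces of mean curvature H, and they are the same
map. Uniqueness of the normal identifies their normals, hence their second fundamental forms. -/
theorem ConfSurf.equivariant (h : ConfSurf H J f N m) (hH : H ≠ 0)
    (hI : ∀ t, IsIsometry (R (Multiplicative.ofAdd t)))
    (hR : ∀ x ∈ J, ∀ y t : ℝ, f (x, y + t) = R (Multiplicative.ofAdd t) (f (x, y))) {x : ℝ}
    (hx : x ∈ J) (y t : ℝ) :
    N (x, y + t) = (R (Multiplicative.ofAdd t)).linear (N (x, y)) ∧
    hxx f N (x, y + t) = hxx f N (x, y) ∧ hxy f N (x, y + t) = hxy f N (x, y) ∧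
    hyy f N (x, y + t) = hyy f N (x, y) := by
  have h1 := h.affine (hI t)
  have h2 := h.comp one_ne_zero 0 t
  have e : (fun x : ℝ => 1 * x + 0) ⁻¹' J = J := by ext x; simp
  have hz : (x, y) ∈ strip J := mk_mem_strip.2 hx
  have hc : hchg 1 0 t (x, y) = (x, y + t) := by
    show (1 * x + 0, t + 1 * y) = _
    rw [one_mul, one_mul, add_zero, add_comm]
  have h3 := h_comp (N := N) (d := t) one_ne_zero h.interval h.smooth (c := 0) (z := (x, y))
    (by rw [e]; exact hz)
  rw [e] at h2
  have hN := (h2.unique (h1.congr (eqOn_comp_add hR t)) hH).2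
  have h4 := h_affine (N := N) h.isOpen h.smooth (hI t) hz
  have h5 := h_congr h.isOpen (eqOn_comp_add hR t) hN hz
  rw [hc, one_pow, one_mul, one_mul, one_mul] at h3
  have h6 := hN hz
  simp only [hc] at h6
  exact ⟨h6, by rw [← h3.1, h5.1, h4.1], by rw [← h3.2.1, h5.2.1, h4.2.1],
    by rw [← h3.2.2, h5.2.2, h4.2.2]⟩

end Equivariant

/-! ### The equations of Gauss and Codazzi -/

namespace ConfSurf

variable (h : ConfSurf H J f N m) (hH : H ≠ 0)
  (i1 : ∀ x ∈ J, ∀ y t, hxx f N (x, y + t) = hxx f N (x, y))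
  (i2 : ∀ x ∈ J, ∀ y t, hxy f N (x, y + t) = hxy f N (x, y))
  {x : ℝ} (hx : x ∈ J) (y : ℝ)

theorem _root_.CMC.hasDerivAt_zero_of_shift {u : ℝ → ℝ} {u' y : ℝ} (h : ∀ y t, u (y + t) = u y)
    (hd : HasDerivAt u u' y) : u' = 0 := by
  have : u = fun _ => u 0 := funext fun s => by simpa using h 0 s
  rw [this] at hd
  exact hd.unique (hasDerivAt_const _ _)

include h hx in
theorem third_xxy : pdx (pdx (pdy f)) (x, y) = pdy (pdx (pdx f)) (x, y) := by
  rw [pdx_congr h.isOpen (fun z hz => pdx_pdy h.isOpen h.smooth hz) (mk_mem_strip.2 hx),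
    pdx_pdy h.isOpen (contDiffOn_pdx h.isOpen h.smooth) (mk_mem_strip.2 hx)]

include h hx hH i1 in
-- One Codazzi equation: the x-derivative of ⟨N, f_xy⟩ equals the y-derivative of ⟨N, f_xx⟩, which
-- vanishes by invariance under shifts in y.
theorem hasDerivAt_hxy : HasDerivAt (fun s => hxy f N (s, y)) 0 x := by
  have hz := mk_mem_strip (y := y) |>.2 hx
  have hF := h.frame _ hz
  have hJ := h.isOpen
  have sx := contDiffOn_pdx hJ h.smooth
  have sy := contDiffOn_pdy hJ h.smooth
  have sN := h.contDiffOn_normal hH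
  have h1 := HasDerivAt.mink (hasDerivAt_pdx hJ sN hx y) (hasDerivAt_pdx hJ (contDiffOn_pdx hJ sy) hx y)
  have h2 := HasDerivAt.mink (hasDerivAt_pdy hJ sN hx y) (hasDerivAt_pdy hJ (contDiffOn_pdx hJ sx) hx y)
  have h3 := hasDerivAt_zero_of_shift (u := fun s => hxx f N (x, s)) (i1 x hx) h2
  refine h1.congr_deriv ?_
  rw [h.third_xxy hx]
  have e : mink (pdx N (x, y)) (pdx (pdy f) (x, y)) = mink (pdy N (x, y)) (pdx (pdx f) (x, y)) := by
    have hm := hF.pos.ne'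
    rw [h.fxy_eq hx, h.fxx_eq hx, h.nx_eq hx y hH, h.ny_eq hx y hH]
    simp only [mink_sub_left, mink_sub_right, mink_smul_left, mink_smul_right, hF.xx, hF.yy, hF.xy,
      mink_comm (pdy f (x, y)) (pdx f (x, y)), mink_comm _ (N (x, y)), hF.nx, hF.ny]
    field_simp
    ring
  rw [e]
  exact h3

include h hx hH i2 in
-- The other Codazzi equation. It says that the traceless part H m - ⟨N, f_yy⟩ is constant.
theorem hasDerivAt_hyy : HasDerivAt (fun s => hyy f N (s, y)) (H * deriv m x) x := by
  have hz := mk_mem_strip (y := y) |>.2 hx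
  have hF := h.frame _ hz
  have hJ := h.isOpen
  have sx := contDiffOn_pdx hJ h.smooth
  have sy := contDiffOn_pdy hJ h.smooth
  have sN := h.contDiffOn_normal hH
  have h1 := HasDerivAt.mink (hasDerivAt_pdx hJ sN hx y) (hasDerivAt_pdx hJ (contDiffOn_pdy hJ sy) hx y)
  have h2 := HasDerivAt.mink (hasDerivAt_pdy hJ sN hx y) (hasDerivAt_pdy hJ (contDiffOn_pdx hJ sy) hx y)
  have h3 := hasDerivAt_zero_of_shift (u := fun s => hxy f N (x, s)) (i2 x hx) h2
  refine h1.congr_deriv ?_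
  rw [pdx_pdy hJ sy hz]
  have e : mink (pdx N (x, y)) (pdy (pdy f) (x, y)) =
      mink (pdy N (x, y)) (pdx (pdy f) (x, y)) + H * deriv m x := by
    have hm := hF.pos.ne'
    have hs := h.mean _ hz
    rw [h.fxy_eq hx, h.fyy_eq hx, h.nx_eq hx y hH, h.ny_eq hx y hH]
    simp only [mink_sub_left, mink_sub_right, mink_smul_left, mink_smul_right, hF.xx, hF.yy, hF.xy,
      mink_comm (pdy f (x, y)) (pdx f (x, y)), mink_comm _ (N (x, y)), hF.nx, hF.ny] at hs ⊢
    field_simp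
    linear_combination deriv m x * m x * hs
  rw [e]
  linear_combination h3

include h hx in
-- The Gauss equation, obtained by differentiating ⟨f_xy, f_y⟩ = m'/2 in x and ⟨f_xx, f_y⟩ = 0 in y
-- and eliminating ⟨f_xxy, f_y⟩.
theorem hasDerivAt_deriv_metric : HasDerivAt (deriv m)
    (deriv m x ^ 2 / m x + 2 * (hxx f N (x, y) * hyy f N (x, y) - hxy f N (x, y) ^ 2)) x := by
  have hz := mk_mem_strip (y := y) |>.2 hx
  have hF := h.frame _ hz
  have hJ := h.isOpen
  have sx := contDiffOn_pdx hJ h.smooth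
  have sy := contDiffOn_pdy hJ h.smooth
  have h0 := hasDerivAt_of_contDiffOn hJ h.contDiffOn_deriv_metric hx
  refine h0.congr_deriv ?_
  have h1 := pdx_mink hJ (contDiffOn_pdx hJ sy) sy (c := fun s => deriv m s / 2)
    (fun z hz => h.mink_fxy_fy hz.1 z.2) (h0.div_const 2) hx y
  have h2 := pdy_mink hJ (contDiffOn_pdx hJ sx) sy (c := fun _ => 0)
    (fun z hz => h.mink_fxx_fy hz.1 z.2) hx y
  rw [h.third_xxy hx] at h1
  have e1 : mink (pdx (pdy f) (x, y)) (pdx (pdy f) (x, y)) =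
      deriv m x ^ 2 / (4 * m x) - hxy f N (x, y) ^ 2 := by
    have hm := hF.pos.ne'
    rw [h.fxy_eq hx]
    simp only [mink_sub_left, mink_sub_right, mink_smul_left, mink_smul_right, hF.yy,
      mink_comm _ (N (x, y)), hF.nn, hF.ny]
    field_simp
    ring
  have e2 : mink (pdx (pdx f) (x, y)) (pdy (pdy f) (x, y)) =
      -(deriv m x ^ 2 / (4 * m x)) - hxx f N (x, y) * hyy f N (x, y) := by
    have hm := hF.pos.ne'
    rw [h.fxx_eq hx, h.fyy_eq hx]
    simp only [mink_sub_left, mink_sub_right, mink_smul_left, mink_smul_right, hF.xx,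
      mink_comm _ (N (x, y)), hF.nn, hF.nx]
    field_simp
    ring
  rw [e1] at h1
  rw [e2] at h2
  have hm := hF.pos.ne'
  simp only at hm
  have e3 : deriv m x ^ 2 / m x = 4 * (deriv m x ^ 2 / (4 * m x)) := by field_simp
  rw [e3]
  linear_combination -2 * h1 + 2 * h2

end ConfSurf

/-- The second fundamental form is given by the mean curvature `H` and the Hopf differential
`P / (2 H) dz²`. -/
def HasHopf (H : ℝ) (P : ℂ) (J : Set ℝ) (f N : ℝ × ℝ → Mink) (m : ℝ → ℝ) : Prop :=
  ∀ z ∈ strip J, hxx f N z = H * m z.1 + P.re / H ∧ hxy f N z = -(P.im / H) ∧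
    hyy f N z = H * m z.1 - P.re / H

theorem hopf_eq_iff (hH : H ≠ 0) {P : ℂ} (hs : hxx f N z + hyy f N z = 2 * H * m z.1) :
    hopf f N z = P / (2 * (H : ℂ)) ↔ hxx f N z = H * m z.1 + P.re / H ∧ hxy f N z = -(P.im / H) ∧
    hyy f N z = H * m z.1 - P.re / H := by
  have e : P / (2 * (H : ℂ)) = ((P.re / (2 * H) : ℝ) : ℂ) + ((P.im / (2 * H) : ℝ) : ℂ) * Complex.I := by
    nth_rewrite 1 [← Complex.re_add_im P]
    push_cast
    have : (H : ℂ) ≠ 0 := by exact_mod_cast hH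
    field_simp
  have e' : hopf f N z = (((hxx f N z - hyy f N z) / 4 : ℝ) : ℂ) +
      ((-(hxy f N z / 2) : ℝ) : ℂ) * Complex.I := by
    rw [hopf]
    push_cast [hxx, hyy, hxy]
    ring
  rw [e, e', Complex.ext_iff]
  simp only [Complex.add_re, Complex.ofReal_re, Complex.mul_re, Complex.I_re, Complex.ofReal_im,
    Complex.I_im, Complex.add_im, Complex.mul_im]
  constructor
  · rintro ⟨h1, h2⟩
    have h1' : hxx f N z - hyy f N z = 2 * (P.re / H) := by
      field_simp at h1 ⊢
      linarith
    have h2' : hxy f N z = -(P.im / H) := by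
      field_simp at h2 ⊢; linarith
    exact ⟨by linarith, h2', by linarith⟩
  · rintro ⟨h1, h2, h3⟩
    rw [h1, h2, h3]
    exact ⟨by field_simp; ring, by field_simp⟩

/-- The data of an equivariant surface in conformal coordinates: the metric is
`(g / H) ^ 2 |dz|²`, where `g` is a positive solution for `(p, |P|)`, and the Hopf differential is
`P / (2 H) dz²`. -/
def IsConf (H p : ℝ) (P : ℂ) (g : ℝ → ℝ) (S : StripMap) : Prop :=
  (∃ N, ConfSurf H S.J S.f N (fun x => (g x / H) ^ 2) ∧
    HasHopf H P S.J S.f N (fun x => (g x / H) ^ 2)) ∧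
  (∀ x ∈ S.J, 0 < g x) ∧ ∃ w, Sol p (‖P‖ ^ 2) S.J g w

/-- The Codazzi equations give the two constants β and κ, that is, a constant Hopf differential. The
Gauss equation then becomes the differential equation for g, with p as integration constant. -/
theorem ConfSurf.exists_isConf {S : StripMap} (h : ConfSurf H S.J S.f N m) (hH : H ≠ 0)
    (i1 : ∀ x ∈ S.J, ∀ y t, hxx S.f N (x, y + t) = hxx S.f N (x, y))
    (i2 : ∀ x ∈ S.J, ∀ y t, hxy S.f N (x, y + t) = hxy S.f N (x, y)) :
    ∃ p P g, IsConf H p P g S := by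
  obtain ⟨x₀, hx₀⟩ := h.interval.2.2
  have hmpos : ∀ x ∈ S.J, 0 < m x := fun x hx => (h.frame (x, 0) (mk_mem_strip.2 hx)).pos
  set β := hxy S.f N (x₀, 0) with hβ
  set κ := H * m x₀ - hyy S.f N (x₀, 0) with hκ
  have i2' : ∀ x ∈ S.J, ∀ y, hxy S.f N (x, y) = β := fun x hx y => by
    have h1 := i2 x hx 0 y
    rw [zero_add] at h1
    rw [h1, hβ]
    exact h.interval.eq_of_hasDerivAt_zero (f := fun s => hxy S.f N (s, 0))
      (fun x hx => h.hasDerivAt_hxy hH i1 hx 0) hx hx₀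
  have i3' : ∀ x ∈ S.J, ∀ y, hyy S.f N (x, y) = H * m x - κ := fun x hx y => by
    have h1 := i1 x hx 0 y
    rw [zero_add] at h1
    have h2 := h.mean (x, y) (mk_mem_strip.2 hx)
    have h3 := h.mean (x, 0) (mk_mem_strip.2 hx)
    have h4 : H * m x - hyy S.f N (x, 0) = H * m x₀ - hyy S.f N (x₀, 0) :=
      h.interval.eq_of_hasDerivAt_zero (f := fun s => H * m s - hyy S.f N (s, 0))
      (fun x hx => (((h.hasDerivAt_metric hx).const_mul H).sub
        (h.hasDerivAt_hyy hH i2 hx 0)).congr_deriv (sub_self _)) hx hx₀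
    simp only at h2 h3
    linarith
  have i1' : ∀ x ∈ S.J, ∀ y, hxx S.f N (x, y) = H * m x + κ := fun x hx y => by
    have h2 := h.mean (x, y) (mk_mem_strip.2 hx)
    rw [i3' x hx] at h2
    simp only at h2
    linarith
  -- Solves κ = Re P / H and β = -Im P / H.
  set P : ℂ := ⟨H * κ, -(H * β)⟩ with hP
  have hPn : ‖P‖ ^ 2 = H ^ 2 * (κ ^ 2 + β ^ 2) := by
    rw [← Complex.normSq_eq_norm_sq, Complex.normSq_apply, hP]; ring
  set g : ℝ → ℝ := fun x => |H| * √(m x) with hg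
  have hgsq : ∀ x ∈ S.J, g x ^ 2 = H ^ 2 * m x := fun x hx => by
    rw [hg]; simp only; rw [mul_pow, sq_abs, Real.sq_sqrt (hmpos x hx).le]
  have hgpos : ∀ x ∈ S.J, 0 < g x := fun x hx =>
    mul_pos (abs_pos.2 hH) (Real.sqrt_pos.2 (hmpos x hx))
  have hm2 : ∀ x ∈ S.J, HasDerivAt (deriv m)
      (deriv m x ^ 2 / m x + 2 * (H ^ 2 * m x ^ 2 - κ ^ 2 - β ^ 2)) x := fun x hx => by
    refine (h.hasDerivAt_deriv_metric hx 0).congr_deriv ?_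
    rw [i1' x hx, i2' x hx, i3' x hx]
    ring
  have hgd : ∀ x ∈ S.J, HasDerivAt g (g x * deriv m x / (2 * m x)) x := fun x hx => by
    have hm0 := (hmpos x hx)
    refine (((h.hasDerivAt_metric hx).sqrt hm0.ne').const_mul |H|).congr_deriv ?_
    rw [hg]
    have h1 := Real.sqrt_pos.2 hm0
    have h2 := Real.sq_sqrt hm0.le
    simp only
    field_simp
    rw [h2]
  -- The first-order equation solved for p: (g² + |P|²/g² - (g'/g)²)/2, expressed in terms of m. It
  -- is constant by the Gauss equation.
  set pf : ℝ → ℝ := fun x => (H ^ 2 * m x + (κ ^ 2 + β ^ 2) / m x - deriv m x ^ 2 / (4 * m x ^ 2)) / 2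
    with hpf
  have hpc : ∀ x ∈ S.J, pf x = pf x₀ := fun x hx => by
    refine h.interval.eq_of_hasDerivAt_zero (f := pf) (fun x hx => ?_) hx hx₀
    have hm0 := (hmpos x hx).ne'
    have d1 := h.hasDerivAt_metric hx
    have d2 := hm2 x hx
    refine ((((d1.const_mul (H ^ 2)).add ((hasDerivAt_const x (κ ^ 2 + β ^ 2)).div d1 hm0)).sub
      ((d2.pow 2).div ((d1.pow 2).const_mul 4)
        (mul_ne_zero four_ne_zero (pow_ne_zero 2 hm0)))).div_const 2).congr_deriv ?_
    simp only [Pi.pow_apply]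
    field_simp
    push_cast
    ring
  have hmet : EqOn (fun x => (g x / H) ^ 2) m S.J := fun x hx => by
    simp only
    rw [div_pow, hgsq x hx]
    field_simp
  refine ⟨pf x₀, P, g, ⟨N, h.congr_metric hmet, fun z hz => ?_⟩, hgpos,
    fun x => g x * deriv m x / (2 * m x), fun x hx => ⟨hgd x hx, ?_, ?_⟩⟩
  · rw [hmet hz.1]
    refine ⟨?_, ?_, ?_⟩
    · rw [i1' z.1 hz.1 z.2, hP]; field_simp
    · rw [i2' z.1 hz.1 z.2, hP]; field_simp
    · rw [i3' z.1 hz.1 z.2, hP]; field_simp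
  · have hm0 := (hmpos x hx).ne'
    refine (((hgd x hx).mul (hm2 x hx)).div ((h.hasDerivAt_metric hx).const_mul 2)
      (mul_ne_zero two_ne_zero hm0)).congr_deriv ?_
    rw [← hpc x hx, hgsq x hx, hpf]
    simp only [Pi.mul_apply]
    field_simp
    ring
  · have hm0 := (hmpos x hx).ne'
    rw [← hpc x hx, hPn, div_pow, mul_pow, show g x ^ 4 = (g x ^ 2) ^ 2 by ring, hgsq x hx, hpf]
    field_simp
    ring

end CMC
end

noncomputable section

namespace CMC

open Filter Topology Metric
open scoped NNReal

variable {J J₁ J₂ J₃ : Set ℝ} {a b a' b' : ℝ → ℝ} {k k' : ℝ} {H : ℝ} {z : ℝ × ℝ}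

/-! ### Coordinate changes -/

/-- The map `(x, y) ↦ (a x, b x + k y)` is a coordinate change between the strips over `J₁` and
`J₂`. -/
structure IsChg (J₁ J₂ : Set ℝ) (a b : ℝ → ℝ) (k : ℝ) : Prop where
  ne : k ≠ 0
  bij : BijOn a J₁ J₂
  smooth_a : ContDiffOn ℝ ∞ a J₁
  smooth_b : ContDiffOn ℝ ∞ b J₁
  pos : ∀ x ∈ J₁, 0 < deriv a x * k

theorem fderiv_chg (hJ : IsOpen J) (ha : ContDiffOn ℝ ∞ a J) (hb : ContDiffOn ℝ ∞ b J)
    (hz : z ∈ strip J) : (fderiv ℝ (chg a b k) z).det = deriv a z.1 * k := by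
  have h1 : HasFDerivAt (fun z : ℝ × ℝ => a z.1)
      (deriv a z.1 • ContinuousLinearMap.fst ℝ ℝ ℝ) z :=
    (hasDerivAt_of_contDiffOn hJ ha hz.1).comp_hasFDerivAt z hasFDerivAt_fst
  have h2 : HasFDerivAt (fun z : ℝ × ℝ => b z.1 + k * z.2)
      (deriv b z.1 • ContinuousLinearMap.fst ℝ ℝ ℝ + k • ContinuousLinearMap.snd ℝ ℝ ℝ) z :=
    ((hasDerivAt_of_contDiffOn hJ hb hz.1).comp_hasFDerivAt z hasFDerivAt_fst).add
      (hasFDerivAt_snd.const_mul k)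
  have h3 : fderiv ℝ (chg a b k) z = _ := (h1.prodMk h2).fderiv
  rw [h3, ContinuousLinearMap.det, ← LinearMap.det_toMatrix (Module.Basis.finTwoProd ℝ),
    Matrix.det_fin_two]
  simp [LinearMap.toMatrix_apply]

theorem IsChg.isCoordChange (h : IsChg J₁ J₂ a b k) (hJ : IsOpen J₁) :
    IsCoordChange J₁ J₂ (chg a b k) := by
  refine ⟨⟨fun z hz => ⟨h.bij.mapsTo hz.1, trivial⟩, ?_, ?_⟩, contDiffOn_chg h.smooth_a h.smooth_b,
    fun z hz => ?_, k, h.ne, fun x _ y t => ?_⟩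
  · rintro ⟨x, y⟩ hz ⟨x', y'⟩ hz' he
    obtain ⟨h1, h2⟩ := Prod.ext_iff.1 he
    have hx : x = x' := h.bij.injOn hz.1 hz'.1 h1
    subst hx
    have h3 : k * y = k * y' := by simpa [chg] using h2
    rw [mul_left_cancel₀ h.ne h3]
  · rintro ⟨u, w⟩ hz
    obtain ⟨x, hx, rfl⟩ := h.bij.surjOn hz.1
    refine ⟨(x, (w - b x) / k), mk_mem_strip.2 hx, Prod.ext rfl ?_⟩
    have := h.ne
    simp only [chg]
    field_simp
    ring
  · rw [fderiv_chg hJ h.smooth_a h.smooth_b hz]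
    exact h.pos z.1 hz.1
  · refine Prod.ext ?_ ?_ <;> simp [chg]
    ring

/-- Compatibility with shifts in y leaves only the values on y = 0 free. Injectivity descends to the
first component because a discrepancy in the second one can be absorbed by a shift in y, as k ≠ 0.
-/
theorem IsCoordChange.exists_chg {φ : ℝ × ℝ → ℝ × ℝ} (h : IsCoordChange J₁ J₂ φ) (hJ : IsOpen J₁) :
    ∃ a b k, IsChg J₁ J₂ a b k ∧ EqOn φ (chg a b k) (strip J₁) := by
  obtain ⟨hbij, hs, hpos, k, hk, heq⟩ := h
  have he : EqOn φ (chg (fun x => (φ (x, 0)).1) (fun x => (φ (x, 0)).2) k) (strip J₁) := by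
    rintro ⟨x, y⟩ hz
    have := heq x (mk_mem_strip.1 hz) 0 y
    rw [zero_add] at this
    rw [this]
    refine Prod.ext ?_ ?_ <;> simp [chg]
  have hs0 : ContDiffOn ℝ ∞ (fun x : ℝ => φ (x, 0)) J₁ :=
    hs.comp (by fun_prop) fun x hx => mk_mem_strip.2 hx
  refine ⟨_, _, k, ⟨hk, ⟨?_, ?_, ?_⟩, contDiff_fst.comp_contDiffOn hs0,
    contDiff_snd.comp_contDiffOn hs0, fun x hx => ?_⟩, he⟩
  · exact fun x hx => (hbij.mapsTo (mk_mem_strip.2 hx)).1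
  · intro x hx x' hx' hxx
    set y' := ((φ (x, 0)).2 - (φ (x', 0)).2) / k
    have : φ (x, 0) = φ (x', y') := by
      rw [he (mk_mem_strip.2 hx), he (mk_mem_strip.2 hx')]
      refine Prod.ext hxx ?_
      simp only [chg, y']
      field_simp
      ring
    exact (Prod.ext_iff.1 (hbij.injOn (mk_mem_strip.2 hx) (mk_mem_strip.2 hx') this)).1
  · intro u hu
    obtain ⟨⟨x, y⟩, hz, hxy⟩ := hbij.surjOn (mk_mem_strip (y := 0) |>.2 hu)
    refine ⟨x, mk_mem_strip.1 hz, ?_⟩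
    rw [he hz] at hxy
    exact (Prod.ext_iff.1 hxy).1
  · have := hpos (x, 0) (mk_mem_strip.2 hx)
    rw [(he.eventuallyEq_of_mem ((isOpen_strip hJ).mem_nhds (mk_mem_strip.2 hx))).fderiv_eq] at this
    exact this.trans_eq (fderiv_chg hJ (contDiff_fst.comp_contDiffOn hs0)
      (contDiff_snd.comp_contDiffOn hs0) (mk_mem_strip.2 hx))

/-- The inverse of a smooth injective function on an open set with nonvanishing derivative. -/
theorem exists_smooth_inverse (hJ : IsOpen J₁) (hbij : BijOn a J₁ J₂) (ha : ContDiffOn ℝ ∞ a J₁)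
    (hd : ∀ x ∈ J₁, deriv a x ≠ 0) :
    ∃ c : ℝ → ℝ, BijOn c J₂ J₁ ∧ InvOn c a J₁ J₂ ∧ ContDiffOn ℝ ∞ c J₂ ∧
      ∀ x ∈ J₁, deriv c (a x) = (deriv a x)⁻¹ := by
  have hinv := hbij.invOn_invFunOn
  set c := Function.invFunOn a J₁ with hc
  have key : ∀ x ∈ J₁, ContDiffAt ℝ ∞ c (a x) ∧ HasDerivAt c (deriv a x)⁻¹ (a x) := by
    intro x hx
    have hax := ha.contDiffAt (hJ.mem_nhds hx)
    have hder := hasDerivAt_of_contDiffOn hJ ha hx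
    have hst : HasStrictDerivAt a (deriv a x) x := hax.hasStrictDerivAt (by simp)
    have hst' := hst.hasStrictFDerivAt_equiv (hd x hx)
    set e := hst'.toOpenPartialHomeomorph a with he
    have hxs : x ∈ e.source := hst'.mem_toOpenPartialHomeomorph_source
    have hea : ∀ y, e y = a y := fun y => rfl
    have hxt : a x ∈ e.target := e.map_source hxs
    have hsx : e.symm (a x) = x := by rw [← hea x, e.left_inv hxs]
    -- Near a(x) the global inverse agrees with the local one of the inverse function theorem, from
    -- which it inherits smoothness.
    have hev : c =ᶠ[𝓝 (a x)] e.symm := by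
      have h1 : ∀ᶠ u in 𝓝 (a x), u ∈ e.target := e.open_target.mem_nhds hxt
      have h2 : ∀ᶠ u in 𝓝 (a x), e.symm u ∈ J₁ := by
        have := e.continuousAt_symm hxt
        rw [ContinuousAt, hsx] at this
        exact this.eventually (hJ.mem_nhds hx)
      filter_upwards [h1, h2] with u hu1 hu2
      have h3 : a (e.symm u) = u := by rw [← hea, e.right_inv hu1]
      have h4 := hinv.1 hu2
      rw [h3] at h4
      exact h4
    have hder' : HasDerivAt (e : ℝ → ℝ) (deriv a x) (e.symm (a x)) := by rw [hsx]; exact hder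
    refine ⟨?_, ?_⟩
    · refine ContDiffAt.congr_of_eventuallyEq ?_ hev
      exact e.contDiffAt_symm_deriv (hd x hx) hxt hder' (by rw [hsx]; exact hax)
    · exact (e.hasDerivAt_symm hxt (hd x hx) hder').congr_of_eventuallyEq hev
  refine ⟨c, hinv.symm.bijOn (hbij.surjOn.mapsTo_invFunOn) hbij.mapsTo, hinv, ?_, fun x hx =>
    (key x hx).2.deriv⟩
  intro u hu
  obtain ⟨x, hx, rfl⟩ := hbij.surjOn hu
  exact (key x hx).1.contDiffWithinAt

theorem IsChg.exists_inverse (h : IsChg J₁ J₂ a b k) (hJ : IsOpen J₁) :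
    ∃ a' b', IsChg J₂ J₁ a' b' k⁻¹ ∧ ∀ z ∈ strip J₂, chg a b k (chg a' b' k⁻¹ z) = z := by
  have hd : ∀ x ∈ J₁, deriv a x ≠ 0 := fun x hx h0 => by simpa [h0] using h.pos x hx
  obtain ⟨c, hbij, hinv, hs, hder⟩ := exists_smooth_inverse hJ h.bij h.smooth_a hd
  refine ⟨c, fun u => -(b (c u) / k), ⟨inv_ne_zero h.ne, hbij, hs,
    ((h.smooth_b.comp hs hbij.mapsTo).div_const k).neg, fun u hu => ?_⟩, ?_⟩
  · obtain ⟨x, hx, rfl⟩ := h.bij.surjOn hu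
    rw [hder x hx, ← mul_inv]
    exact inv_pos.2 (h.pos x hx)
  · rintro ⟨u, w⟩ hz
    refine Prod.ext (hinv.2 (mk_mem_strip.1 hz)) ?_
    have := h.ne
    simp only [chg]
    field_simp
    ring

theorem IsChg.trans (h : IsChg J₁ J₂ a b k) (h' : IsChg J₂ J₃ a' b' k') (hJ₁ : IsOpen J₁)
    (hJ₂ : IsOpen J₂) : IsChg J₁ J₃ (a' ∘ a) (fun x => b' (a x) + k' * b x) (k' * k) := by
  refine ⟨mul_ne_zero h'.ne h.ne, h'.bij.comp h.bij, h'.smooth_a.comp h.smooth_a h.bij.mapsTo,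
    (h'.smooth_b.comp h.smooth_a h.bij.mapsTo).add (contDiffOn_const.mul h.smooth_b),
    fun x hx => ?_⟩
  have h1 := h.pos x hx
  have h2 := h'.pos (a x) (h.bij.mapsTo hx)
  have h3 := (hasDerivAt_of_contDiffOn hJ₂ h'.smooth_a (h.bij.mapsTo hx)).comp x
    (hasDerivAt_of_contDiffOn hJ₁ h.smooth_a hx)
  rw [h3.deriv]
  nlinarith [mul_pos h1 h2]

theorem isChg_lin (hk : k ≠ 0) (c d : ℝ) :
    IsChg ((fun x => k * x + c) ⁻¹' J) J (fun x => k * x + c) (fun _ => d) k := by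
  refine ⟨hk, ⟨fun x hx => hx, fun x _ y _ hxy => ?_, fun u hu => ⟨(u - c) / k, ?_, ?_⟩⟩,
    by fun_prop, by fun_prop, fun x _ => ?_⟩
  · have : k * x = k * y := by simpa using hxy
    exact mul_left_cancel₀ hk this
  · rw [mem_preimage, mul_div_cancel₀ _ hk, sub_add_cancel]; exact hu
  · simp only; rw [mul_div_cancel₀ _ hk, sub_add_cancel]
  · rw [deriv_lin]
    have : 0 < k ^ 2 := by positivity
    simpa [sq] using this

theorem IsChg.isOpenInterval (h : IsChg J₁ J₂ a b k) (hJ : IsOpenInterval J₁) :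
    IsOpenInterval J₂ := by
  refine ⟨?_, ?_, ?_⟩
  · rw [← h.bij.image_eq]
    rw [isOpen_iff_mem_nhds]
    rintro _ ⟨x, hx, rfl⟩
    have hd : deriv a x ≠ 0 := fun h0 => by simpa [h0] using h.pos x hx
    have hst : HasStrictDerivAt a (deriv a x) x :=
      (h.smooth_a.contDiffAt (hJ.1.mem_nhds hx)).hasStrictDerivAt (by simp)
    rw [← hst.map_nhds_eq hd]
    exact image_mem_map (hJ.1.mem_nhds hx)
  · rw [← isPreconnected_iff_ordConnected, ← h.bij.image_eq]
    exact hJ.isPreconnected.image a h.smooth_a.continuousOn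
  · rw [← h.bij.image_eq]
    exact hJ.2.2.image a

/-! ### Congruence -/

theorem congruent_iff {S T : StripMap} (hS : IsOpen S.J) : Congruent S T ↔
    ∃ (A : Mink ≃ᵃ[ℝ] Mink) (a b : ℝ → ℝ) (k : ℝ), IsIsometry A ∧ IsChg S.J T.J a b k ∧
      ∀ z ∈ strip S.J, A (S.f z) = T.f (chg a b k z) := by
  constructor
  · rintro ⟨A, φ, hA, hφ, h⟩
    obtain ⟨a, b, k, hc, he⟩ := hφ.exists_chg hS
    exact ⟨A, a, b, k, hA, hc, fun z hz => by rw [← he hz]; exact h z hz⟩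
  · rintro ⟨A, a, b, k, hA, hc, h⟩
    exact ⟨A, chg a b k, hA, hc.isCoordChange hS, h⟩

theorem Congruent.refl (S : StripMap) (hS : IsOpen S.J) : Congruent S S := by
  refine (congruent_iff hS).2 ⟨AffineEquiv.refl ℝ Mink, fun x => 1 * x + 0, fun _ => 0, 1,
    IsIsometry.refl, ?_, fun z _ => ?_⟩
  · simpa using isChg_lin (J := S.J) one_ne_zero 0 0
  · simp [chg]

theorem Congruent.isOpenInterval {S T : StripMap} (h : Congruent S T) (hS : IsOpenInterval S.J) :
    IsOpenInterval T.J := by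
  obtain ⟨A, a, b, k, -, hc, -⟩ := (congruent_iff hS.1).1 h
  exact hc.isOpenInterval hS

theorem Congruent.symm {S T : StripMap} (h : Congruent S T) (hS : IsOpenInterval S.J) :
    Congruent T S := by
  have hT := h.isOpenInterval hS
  obtain ⟨A, a, b, k, hA, hc, h⟩ := (congruent_iff hS.1).1 h
  obtain ⟨a', b', hc', hinv⟩ := hc.exists_inverse hS.1
  refine (congruent_iff hT.1).2 ⟨A.symm, a', b', k⁻¹, hA.symm, hc', fun z hz => ?_⟩
  rw [AffineEquiv.symm_apply_eq, h _ (chg_mem_strip hc'.bij.mapsTo hz), hinv z hz]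

theorem Congruent.trans {S T U : StripMap} (h : Congruent S T) (h' : Congruent T U)
    (hS : IsOpenInterval S.J) : Congruent S U := by
  have hT := h.isOpenInterval hS
  obtain ⟨A, a, b, k, hA, hc, h⟩ := (congruent_iff hS.1).1 h
  obtain ⟨A', a', b', k', hA', hc', h'⟩ := (congruent_iff hT.1).1 h'
  refine (congruent_iff hS.1).2 ⟨A.trans A', _, _, _, hA.trans hA', hc.trans hc' hS.1 hT.1,
    fun z hz => ?_⟩
  rw [AffineEquiv.trans_apply, h z hz, h' _ (chg_mem_strip hc.bij.mapsTo hz)]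
  congr 1
  refine Prod.ext rfl ?_
  simp only [chg]
  ring

theorem equivalence_congE (H : ℝ) : Equivalence (congE H) where
  refl S := Congruent.refl S.1 S.2.1.1.1.1.1
  symm {S T} h := Congruent.symm (S := S.1) (T := T.1) h S.2.1.1.1.1
  trans {S T U} h h' := Congruent.trans (S := S.1) (T := T.1) (U := U.1) h h' S.2.1.1.1.1

theorem equivalence_congR (H : ℝ) : Equivalence (congR H) where
  refl S := Congruent.refl S.1 S.2.1.1.1.1.1.1
  symm {S T} h := Congruent.symm (S := S.1) (T := T.1) h S.2.1.1.1.1.1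
  trans {S T U} h h' := Congruent.trans (S := S.1) (T := T.1) (U := U.1) h h' S.2.1.1.1.1.1

/-! ### Congruence in terms of the data -/

/-- Pulling T back by z ↦ kz + c gives a surface with the fundamental forms of S, so the rigidity
theorem applies. The sign of k plays no role, since metric and Hopf differential are multiplied by
k². -/
theorem IsConf.congruent {S T : StripMap} {p p' : ℝ} {P P' : ℂ} {g g' : ℝ → ℝ} (hH : H ≠ 0)
    (hS : IsConf H p P g S) (hT : IsConf H p' P' g' T) {c ρ : ℝ} (hk : k ≠ 0)
    (hJ : S.J = (fun x => k * x + c) ⁻¹' T.J) (hP : P = (k : ℂ) ^ 2 * P') (hρ : ρ ^ 2 = k ^ 2)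
    (hg : ∀ x ∈ S.J, g x = ρ * g' (k * x + c)) : Congruent S T := by
  obtain ⟨⟨N, hN, hPN⟩, -, -⟩ := hS
  obtain ⟨⟨M, hM, hPM⟩, -, -⟩ := hT
  have hM' := hM.comp hk c 0
  rw [← hJ] at hM'
  have hm : ∀ x ∈ S.J, (g x / H) ^ 2 = k ^ 2 * (g' (k * x + c) / H) ^ 2 := fun x hx => by
    rw [hg x hx, ← hρ]; ring
  have hh : ∀ z ∈ strip S.J, _ := fun z hz => h_comp (N := M) (d := 0) hk hM.interval hM.smooth
    (c := c) (z := z) (by rw [← hJ]; exact hz)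
  have hmem : ∀ z ∈ strip S.J, hchg k c 0 z ∈ strip T.J := fun z hz =>
    mk_mem_strip.2 (by have := hz.1; rw [hJ] at this; exact this)
  have hk2 : (k : ℂ) ^ 2 = ((k ^ 2 : ℝ) : ℂ) := by push_cast; rfl
  have hre : P.re = k ^ 2 * P'.re := by rw [hP, hk2, Complex.re_ofReal_mul]
  have him : P.im = k ^ 2 * P'.im := by rw [hP, hk2, Complex.im_ofReal_mul]
  obtain ⟨A, hA, hAe⟩ := hN.exists_isometry (hM'.congr_metric hm) hH
    (fun z hz => by
      rw [(hh z hz).1, (hPN z hz).1, (hPM _ (hmem z hz)).1]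
      simp only [chg]
      rw [hm z.1 hz.1, hre]
      ring)
    (fun z hz => by
      rw [(hh z hz).2.1, (hPN z hz).2.1, (hPM _ (hmem z hz)).2.1, him]
      ring)
    (fun z hz => by
      rw [(hh z hz).2.2, (hPN z hz).2.2, (hPM _ (hmem z hz)).2.2]
      simp only [chg]
      rw [hm z.1 hz.1, hre]
      ring)
  refine (congruent_iff hN.isOpen).2 ⟨A, fun x => k * x + c, fun _ => 0, k, hA, ?_, hAe⟩
  have := isChg_lin (J := T.J) hk c 0
  rwa [← hJ] at this

/-- A coordinate change between two conformal parametrizations is conformal. Of the form (a(x), b(x)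
+ ky) and orientation preserving, it must be z ↦ kz + const; comparing metrics and second
fundamental forms gives the scaling laws. -/
theorem Congruent.data {S T : StripMap} {p p' : ℝ} {P P' : ℂ} {g g' : ℝ → ℝ} (h : Congruent S T)
    (hH : H ≠ 0) (hS : IsConf H p P g S) (hT : IsConf H p' P' g' T) :
    ∃ k c : ℝ, k ≠ 0 ∧ S.J = (fun x => k * x + c) ⁻¹' T.J ∧ P = (k : ℂ) ^ 2 * P' ∧
      ∀ x ∈ S.J, g x = |k| * g' (k * x + c) := by
  obtain ⟨⟨N, hN, hPN⟩, hgpos, -⟩ := hS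
  obtain ⟨⟨M, hM, hPM⟩, hgpos', -⟩ := hT
  obtain ⟨A, a, b, k, hA, hc, he⟩ := (congruent_iff hN.isOpen).1 h
  have hmaps := hc.bij.mapsTo
  have hNA := hN.affine hA
  -- The Cauchy-Riemann equations: orthogonality of the images of ∂x and ∂y gives b' = 0, equality
  -- of their lengths gives a' = ±k, and orientation excludes the minus sign.
  have hd : ∀ x ∈ S.J, deriv a x = k ∧ deriv b x = 0 := by
    intro x hx
    have hz := mk_mem_strip (y := 0) |>.2 hx
    have hF := hNA.frame _ hz
    have hF' := hM.frame _ (chg_mem_strip (b := b) (k := k) hmaps hz)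
    have e1 := pdx_congr hN.isOpen he hz
    have e2 := pdy_congr hN.isOpen he hz
    rw [pdx_comp_chg hN.isOpen hM.isOpen hc.smooth_a hc.smooth_b hmaps hM.smooth hx] at e1
    rw [pdy_comp_chg hN.isOpen hM.isOpen hc.smooth_a hc.smooth_b hmaps hM.smooth hx] at e2
    have hxx := hF.xx
    have hyy := hF.yy
    have hxy := hF.xy
    rw [e1, e2] at hxy
    rw [e1] at hxx
    rw [e2] at hyy
    simp only [mink_add_left, mink_add_right, mink_smul_left, mink_smul_right, hF'.xx, hF'.yy,
      hF'.xy, mink_comm (pdy T.f _) (pdx T.f _)] at hxx hyy hxy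
    have hpos := hF'.pos
    set m' := (g' (chg a b k (x, 0)).1 / H) ^ 2
    have hb0 : deriv b x = 0 := by
      have : k * deriv b x * m' = 0 := by linear_combination hxy
      rcases mul_eq_zero.1 this with h | h
      · exact (mul_eq_zero.1 h).resolve_left hc.ne
      · exact absurd h hpos.ne'
    refine ⟨?_, hb0⟩
    rw [hb0] at hxx
    have h2 : (deriv a x) ^ 2 = k ^ 2 := by
      have : ((deriv a x) ^ 2 - k ^ 2) * m' = 0 := by linear_combination hxx - hyy
      rcases mul_eq_zero.1 this with h | h
      · linarith
      · exact absurd h hpos.ne'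
    rcases sq_eq_sq_iff_eq_or_eq_neg.1 h2 with h | h
    · exact h
    · have := hc.pos x hx
      rw [h] at this
      nlinarith [sq_nonneg k]
  obtain ⟨x₀, hx₀⟩ := hN.interval.2.2
  set c := a x₀ - k * x₀ with hcdef
  set d := b x₀ with hddef
  have ha : ∀ x ∈ S.J, a x = k * x + c := fun x hx => by
    have : a x - k * x = a x₀ - k * x₀ := hN.interval.eq_of_hasDerivAt_zero
      (f := fun x => a x - k * x) (fun x hx => by
        refine ((hasDerivAt_of_contDiffOn hN.isOpen hc.smooth_a hx).sub
          ((hasDerivAt_id x).const_mul k)).congr_deriv ?_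
        rw [(hd x hx).1]; ring) hx hx₀
    linarith
  have hb : ∀ x ∈ S.J, b x = d := fun x hx => hN.interval.eq_of_hasDerivAt_zero
      (fun x hx => (hasDerivAt_of_contDiffOn hN.isOpen hc.smooth_b hx).congr_deriv (hd x hx).2) hx hx₀
  have hJ : S.J = (fun x => k * x + c) ⁻¹' T.J := by
    ext x
    constructor
    · intro hx
      rw [mem_preimage, ← ha x hx]
      exact hmaps hx
    · intro hx
      obtain ⟨x', hx', hxx'⟩ := hc.bij.surjOn hx
      rw [ha x' hx'] at hxx'
      have : k * x' = k * x := by simpa using hxx'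
      rwa [← mul_left_cancel₀ hc.ne this]
  have hchge : EqOn (chg a b k) (hchg k c d) (strip S.J) := fun z hz => by
    refine Prod.ext (ha z.1 hz.1) ?_
    simp only [chg, hb z.1 hz.1]
  have hM' := hM.comp hc.ne c d
  have hh := fun z hz => h_comp (N := M) (d := d) hc.ne hM.interval hM.smooth
    (c := c) (z := z) hz
  rw [← hJ] at hM' hh
  have he' : EqOn (fun z => T.f (hchg k c d z)) (fun z => A (S.f z)) (strip S.J) := fun z hz => by
    simp only
    rw [he z hz, hchge hz]
  obtain ⟨hm, hNM⟩ := (hNA.congr he').unique hM' hH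
  have hz₀ := mk_mem_strip (y := 0) |>.2 hx₀
  have h1 := h_congr hN.isOpen he' hNM.symm hz₀
  have h2 := h_affine (N := N) hN.isOpen hN.smooth hA hz₀
  have hmem : hchg k c d (x₀, 0) ∈ strip T.J := mk_mem_strip.2 (by rw [hJ] at hx₀; exact hx₀)
  have h3 := hh _ hz₀
  have h4 := hPM _ hmem
  have h5 := hPN _ hz₀
  have hk2 : (k : ℂ) ^ 2 = ((k ^ 2 : ℝ) : ℂ) := by push_cast; rfl
  refine ⟨k, c, hc.ne, hJ, ?_, fun x hx => ?_⟩
  · rw [hk2]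
    apply Complex.ext
    · rw [Complex.re_ofReal_mul]
      have e1 := h1.1
      rw [h3.1, h2.1, h4.1, h5.1] at e1
      have e2 := h1.2.2
      rw [h3.2.2, h2.2.2, h4.2.2, h5.2.2] at e2
      field_simp at e1 e2
      linarith
    · rw [Complex.im_ofReal_mul]
      have e1 := h1.2.1
      rw [h3.2.1, h2.2.1, h4.2.1, h5.2.1] at e1
      field_simp at e1
      linarith
  · have e := hm hx
    simp only at e
    have h6 : g x ^ 2 = (|k| * g' (k * x + c)) ^ 2 := by
      rw [mul_pow, sq_abs]
      rw [div_pow, div_pow] at e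
      field_simp at e
      linarith
    have hx' : k * x + c ∈ T.J := by rw [hJ] at hx; exact hx
    exact (pow_left_inj₀ (hgpos x hx).le (mul_nonneg (abs_nonneg k) (hgpos' _ hx').le)
      two_ne_zero).1 h6

end CMC
end

noncomputable section

namespace CMC

open Filter Topology Metric
open scoped NNReal

/-! ### Conformal coordinates on equivariant surfaces. -/

variable {J : Set ℝ} {H : ℝ} {f N : ℝ × ℝ → Mink} {m : ℝ → ℝ}

theorem exists_antideriv {F : Type*} [NormedAddCommGroup F] [NormedSpace ℝ F] [CompleteSpace F]
    (hJ : IsOpenInterval J) {s : ℝ → F} (hs : ContDiffOn ℝ ∞ s J) :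
    ∃ ξ : ℝ → F, ContDiffOn ℝ ∞ ξ J ∧ ∀ x ∈ J, HasDerivAt ξ (s x) x := by
  obtain ⟨x₀, hx₀⟩ := hJ.2.2
  have hd : ∀ x ∈ J, HasDerivAt (fun x => ∫ t in x₀..x, s t) (s x) x := fun x hx => by
    refine intervalIntegral.integral_hasDerivAt_right ?_ ?_
      (hs.continuousOn.continuousAt (hJ.1.mem_nhds hx))
    · exact (hs.continuousOn.mono (hJ.2.1.uIcc_subset hx₀ hx)).intervalIntegrable
    · exact hs.continuousOn.stronglyMeasurableAtFilter hJ.1 x hx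
  refine ⟨_, ?_, hd⟩
  rw [contDiffOn_infty_iff_deriv_of_isOpen hJ.1]
  exact ⟨fun x hx => (hd x hx).differentiableAt.differentiableWithinAt,
    hs.congr fun x hx => (hd x hx).deriv⟩

theorem ConfSurf.isSpacelikeImmersion (h : ConfSurf H J f N m) : IsSpacelikeImmersion ⟨J, f⟩ := by
  refine ⟨h.interval, h.smooth, fun z hz w hw => ?_⟩
  have hF := h.frame z hz
  simp only [fderiv_eq_pd, mink_add_left, mink_add_right, mink_smul_left, mink_smul_right, hF.xx,
    hF.yy, hF.xy, mink_comm (pdy f z) (pdx f z)]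
  have hpos := hF.pos
  have : 0 < w.1 ^ 2 + w.2 ^ 2 := by
    by_contra h0
    have h1 : w.1 = 0 := by nlinarith [sq_nonneg w.1, sq_nonneg w.2]
    have h2 : w.2 = 0 := by nlinarith [sq_nonneg w.1, sq_nonneg w.2]
    exact hw (Prod.ext h1 h2)
  nlinarith [mul_pos hpos this]

theorem ConfSurf.isUnitNormal (h : ConfSurf H J f N m) (hH : H ≠ 0) : IsUnitNormal ⟨J, f⟩ N :=
  ⟨(h.contDiffOn_normal hH).continuousOn, fun z hz =>
    ⟨(h.frame z hz).nn, (h.frame z hz).nx, (h.frame z hz).ny⟩⟩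

theorem ConfSurf.isCMC (h : ConfSurf H J f N m) (hH : H ≠ 0) : IsCMC H ⟨J, f⟩ :=
  ⟨h.isSpacelikeImmersion, N, h.isUnitNormal hH, fun z hz =>
    (meanCurvature_eq_iff (h.frame z hz)).2 (h.mean z hz)⟩

theorem fundamental_form_equivariant {R : Multiplicative ℝ →* (Mink ≃ᵃ[ℝ] Mink)} (hJ : IsOpen J)
    (hf : ContDiffOn ℝ ∞ f (strip J)) (hI : ∀ t, IsIsometry (R (Multiplicative.ofAdd t)))
    (hR : ∀ x ∈ J, ∀ y t : ℝ, f (x, y + t) = R (Multiplicative.ofAdd t) (f (x, y))) {x : ℝ}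
    (hx : x ∈ J) (y : ℝ) :
    mink (pdx f (x, y)) (pdx f (x, y)) = mink (pdx f (x, 0)) (pdx f (x, 0)) ∧
    mink (pdx f (x, y)) (pdy f (x, y)) = mink (pdx f (x, 0)) (pdy f (x, 0)) ∧
    mink (pdy f (x, y)) (pdy f (x, y)) = mink (pdy f (x, 0)) (pdy f (x, 0)) := by
  have h1 := pdx_equivariant hJ hf hR hx 0 y
  have h2 := pdy_equivariant hJ hf hR hx 0 y
  rw [zero_add] at h1 h2
  simp only [h1, h2, (hI y).linear_mink, and_self]

/-- Equivariant surfaces admit conformal coordinates in which they are equivariant under the same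
isometries. -/
theorem exists_isConf {T : StripMap} {R : Multiplicative ℝ →* (Mink ≃ᵃ[ℝ] Mink)} (hH : H ≠ 0)
    (hT : IsCMC H T) (hR : IsEquivariantUnder T R) :
    ∃ S, Congruent S T ∧ IsCMC H S ∧ IsEquivariantUnder S R ∧ ∃ p P g, IsConf H p P g S := by
  obtain ⟨⟨hJ, hs, hpos⟩, N, hN, hmean⟩ := hT
  obtain ⟨hflow, hRf⟩ := hR
  obtain ⟨J, f⟩ := T
  change IsOpenInterval J at hJ
  change ContDiffOn ℝ ∞ f (strip J) at hs
  change ∀ x ∈ J, ∀ y t : ℝ, f (x, y + t) = R (Multiplicative.ofAdd t) (f (x, y)) at hRf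
  have hI := fun {x : ℝ} (hx : x ∈ J) => fundamental_form_equivariant hJ.1 hs hflow.1 hRf hx
  set E : ℝ → ℝ := fun x => mink (pdx f (x, 0)) (pdx f (x, 0)) with hE
  set F : ℝ → ℝ := fun x => mink (pdx f (x, 0)) (pdy f (x, 0)) with hF
  set G : ℝ → ℝ := fun x => mink (pdy f (x, 0)) (pdy f (x, 0)) with hG
  have hmaps : MapsTo (fun x : ℝ => (x, (0 : ℝ))) J (strip J) := fun x hx => mk_mem_strip.2 hx
  have sx : ContDiffOn ℝ ∞ (fun x => pdx f (x, 0)) J :=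
    (contDiffOn_pdx hJ.1 hs).comp (by fun_prop) hmaps
  have sy : ContDiffOn ℝ ∞ (fun x => pdy f (x, 0)) J :=
    (contDiffOn_pdy hJ.1 hs).comp (by fun_prop) hmaps
  have sE : ContDiffOn ℝ ∞ E J := ContDiffOn.mink sx sx
  have sF : ContDiffOn ℝ ∞ F J := ContDiffOn.mink sx sy
  have sG : ContDiffOn ℝ ∞ G J := ContDiffOn.mink sy sy
  have hquad : ∀ x ∈ J, ∀ w : ℝ × ℝ, w ≠ 0 →
      0 < w.1 ^ 2 * E x + 2 * w.1 * w.2 * F x + w.2 ^ 2 * G x := fun x hx w hw => by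
    have := hpos (x, 0) (mk_mem_strip.2 hx) w hw
    simp only [fderiv_eq_pd, mink_add_left, mink_add_right, mink_smul_left, mink_smul_right,
      mink_comm (pdy f (x, 0)) (pdx f (x, 0))] at this
    calc 0 < _ := this
      _ = _ := by simp only [hE, hF, hG]; ring
  have hGpos : ∀ x ∈ J, 0 < G x := fun x hx => by simpa using hquad x hx (0, 1) (by simp)
  have hDpos : ∀ x ∈ J, 0 < E x * G x - F x ^ 2 := fun x hx => by
    -- This vector is orthogonal to ∂y; its squared length is G(EG - F²).
    have h1 := hquad x hx (G x, -F x) (by simp [(hGpos x hx).ne'])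
    have h2 : 0 < G x * (E x * G x - F x ^ 2) := by
      calc 0 < _ := h1
        _ = _ := by ring
    exact (pos_iff_pos_of_mul_pos h2).1 (hGpos x hx)
  set r : ℝ → ℝ := fun x => Real.sqrt (E x * G x - F x ^ 2) with hr
  have hrpos : ∀ x ∈ J, 0 < r x := fun x hx => Real.sqrt_pos.2 (hDpos x hx)
  have hrsq : ∀ x ∈ J, r x ^ 2 = E x * G x - F x ^ 2 := fun x hx => Real.sq_sqrt (hDpos x hx).le
  have sr : ContDiffOn ℝ ∞ r J := ((sE.mul sG).sub (sF.pow 2)).sqrt fun x hx => (hDpos x hx).ne'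
  -- Completing the square, E dx² + 2F dx dy + G dy² = G(dξ² + (dy + dη)²) with ξ' = √(EG - F²)/G
  -- and η' = F/G. Thus ξ and y + η are isothermal coordinates, and they respect translations in y.
  obtain ⟨ξ, sξ, dξ⟩ := exists_antideriv hJ (sr.div sG fun x hx => (hGpos x hx).ne')
  obtain ⟨η, sη, dη⟩ := exists_antideriv hJ (sF.div sG fun x hx => (hGpos x hx).ne')
  have hinj : InjOn ξ J := by
    refine (strictMonoOn_of_deriv_pos hJ.2.1.convex sξ.continuousOn fun x hx => ?_).injOn
    have hx' := interior_subset hx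
    rw [(dξ x hx').deriv]
    exact div_pos (hrpos x hx') (hGpos x hx')
  obtain ⟨a, hbij, hinv, sa, da⟩ := exists_smooth_inverse hJ.1 hinj.bijOn_image sξ
    fun x hx => by
      rw [(dξ x hx).deriv]
      exact (div_pos (hrpos x hx) (hGpos x hx)).ne'
  set U := ξ '' J with hU
  have hda : ∀ u ∈ U, deriv a u = G (a u) / r (a u) := fun u hu => by
    have h1 := da (a u) (hbij.mapsTo hu)
    rw [hinv.2 hu, (dξ _ (hbij.mapsTo hu)).deriv] at h1
    rw [h1]
    exact inv_div _ _
  have hapos : ∀ u ∈ U, 0 < deriv a u := fun u hu => by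
    rw [hda u hu]
    exact div_pos (hGpos _ (hbij.mapsTo hu)) (hrpos _ (hbij.mapsTo hu))
  -- The change from the isothermal coordinates back to (x, y) is (u, w) ↦ (ξ⁻¹(u), w - η(ξ⁻¹(u))).
  set b : ℝ → ℝ := fun u => -η (a u) with hb
  have sb : ContDiffOn ℝ ∞ b U := (sη.comp sa hbij.mapsTo).neg
  have hchg' : IsChg U J a b 1 := ⟨one_ne_zero, hbij, sa, sb, fun u hu => by simpa using hapos u hu⟩
  have hUo : IsOpenInterval U := by
    refine IsChg.isOpenInterval (J₁ := J) (a := ξ) (b := fun _ => 0) (k := 1)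
      ⟨one_ne_zero, hinj.bijOn_image, sξ, contDiffOn_const, fun x hx => ?_⟩ hJ
    rw [(dξ x hx).deriv, mul_one]
    exact div_pos (hrpos x hx) (hGpos x hx)
  have hdb : ∀ u ∈ U, deriv b u = -(F (a u) / r (a u)) := fun u hu => by
    have h1 : HasDerivAt b _ u := ((dη (a u) (hbij.mapsTo hu)).comp u
      (hasDerivAt_of_contDiffOn hUo.1 sa hu)).neg
    rw [h1.deriv, hda u hu]
    have h2 := hGpos _ (hbij.mapsTo hu)
    have h3 := hrpos _ (hbij.mapsTo hu)
    simp only [Pi.div_apply]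
    field_simp
  have hmem : ∀ z ∈ strip U, chg a b 1 z ∈ strip J := fun z hz => chg_mem_strip hbij.mapsTo hz
  have hframe : ∀ z ∈ strip U, IsFrame (G (a z.1)) (pdx (fun z => f (chg a b 1 z)) z)
      (pdy (fun z => f (chg a b 1 z)) z) (N (chg a b 1 z)) := by
    rintro ⟨u, w⟩ hz
    have hu : u ∈ U := mk_mem_strip.1 hz
    have hx := hbij.mapsTo hu
    obtain ⟨i1, i2, i3⟩ := hI hx (chg a b 1 (u, w)).2
    obtain ⟨n1, n2, n3⟩ := hN.2 _ (hmem _ hz)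
    have hrp := hrpos _ hx
    have hrs := hrsq _ hx
    change mink (pdx f (chg a b 1 (u, w))) (pdx f (chg a b 1 (u, w))) = E (a u) at i1
    change mink (pdx f (chg a b 1 (u, w))) (pdy f (chg a b 1 (u, w))) = F (a u) at i2
    change mink (pdy f (chg a b 1 (u, w))) (pdy f (chg a b 1 (u, w))) = G (a u) at i3
    simp only at n2 n3
    rw [pdx_comp_chg hUo.1 hJ.1 sa sb hbij.mapsTo hs hu, pdy_comp_chg hUo.1 hJ.1 sa sb hbij.mapsTo hs hu,
      hda u hu, hdb u hu]
    refine ⟨hGpos _ hx, ?_, ?_, ?_, n1, ?_, ?_⟩ <;>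
    simp only [mink_add_left, mink_add_right, mink_smul_left, mink_smul_right, i1, i2, i3, n2, n3,
      mink_comm (pdy f (chg a b 1 (u, w))) (pdx f (chg a b 1 (u, w)))] <;>
    field_simp <;> (try rw [hrs]) <;> ring
  have hconf : ConfSurf H U (fun z => f (chg a b 1 z)) (fun z => N (chg a b 1 z))
      (fun u => G (a u)) := by
    refine ⟨hUo, contDiffOn_comp_chg sa sb hbij.mapsTo hs, hframe, ?_⟩
    rintro ⟨u, w⟩ hz
    have hu : u ∈ U := mk_mem_strip.1 hz
    obtain ⟨n1, n2, n3⟩ := hN.2 _ (hmem _ hz)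
    refine (meanCurvature_eq_iff (f := fun z => f (chg a b 1 z)) (N := fun z => N (chg a b 1 z))
      (m := fun u => G (a u)) (z := (u, w)) (hframe _ hz)).1 ?_
    rw [meanCurvature_comp_chg hUo.1 hJ.1 sa sb hbij.mapsTo hs hu w
      (by rw [mul_one]; exact (hapos u hu).ne') n2 n3]
    exact hmean _ (hmem _ hz)
  have hRS : ∀ x ∈ U, ∀ y t : ℝ, f (chg a b 1 (x, y + t)) =
      R (Multiplicative.ofAdd t) (f (chg a b 1 (x, y))) := fun u hu w t => by
    simp only [chg]
    rw [← hRf _ (hbij.mapsTo hu)]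
    congr 2
    ring
  refine ⟨⟨U, fun z => f (chg a b 1 z)⟩, (congruent_iff hUo.1).2 ⟨AffineEquiv.refl ℝ Mink, a, b, 1,
    IsIsometry.refl, hchg', fun z hz => rfl⟩, hconf.isCMC hH, ⟨hflow, hRS⟩, ?_⟩
  exact ConfSurf.exists_isConf (S := ⟨U, fun z => f (chg a b 1 z)⟩) hconf hH
    (fun x hx y t => (hconf.equivariant hH hflow.1 hRS hx y t).2.1)
    (fun x hx y t => (hconf.equivariant hH hflow.1 hRS hx y t).2.2.1)

end CMC
end

noncomputable section

namespace CMC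

open Filter Topology Metric
open scoped NNReal

/-! ### One-parameter groups of isometries -/

/-- The generator of the affine flow with velocity `A X + b`, acting on `Mink × ℝ`. -/
def flowGen (A : Mink →L[ℝ] Mink) (b : Mink) : (Mink × ℝ) →L[ℝ] (Mink × ℝ) :=
  (A.comp (ContinuousLinearMap.fst ℝ Mink ℝ) +
    (ContinuousLinearMap.snd ℝ Mink ℝ).smulRight b).prod 0

theorem flowGen_apply (A : Mink →L[ℝ] Mink) (b : Mink) (e : Mink × ℝ) :
    flowGen A b e = (A e.1 + e.2 • b, 0) := rfl

/-- The one-parameter group generated by `flowGen A b`. -/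
def flowExp (A : Mink →L[ℝ] Mink) (b : Mink) (t : ℝ) : (Mink × ℝ) →L[ℝ] (Mink × ℝ) :=
  NormedSpace.exp (t • flowGen A b)

variable (A : Mink →L[ℝ] Mink) (b : Mink)

theorem flowExp_zero : flowExp A b 0 = 1 := by
  rw [flowExp, zero_smul, NormedSpace.exp_zero]

theorem flowExp_add (s t : ℝ) : flowExp A b (s + t) = flowExp A b s * flowExp A b t := by
  let : NormedAlgebra ℚ ((Mink × ℝ) →L[ℝ] (Mink × ℝ)) := NormedAlgebra.restrictScalars ℚ ℝ _
  rw [flowExp, add_smul, NormedSpace.exp_add_of_commute]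
  · rfl
  · exact ((Commute.refl (flowGen A b)).smul_left s).smul_right t

theorem hasDerivAt_flowExp (e : Mink × ℝ) (t : ℝ) :
    HasDerivAt (fun t => flowExp A b t e) (flowExp A b t (flowGen A b e)) t :=
  (hasDerivAt_exp_smul_const (𝕂 := ℝ) (flowGen A b) t).clm_apply (hasDerivAt_const t e)
    |>.congr_deriv (by simp [flowExp])

theorem hasDerivAt_flowExp' (e : Mink × ℝ) (t : ℝ) :
    HasDerivAt (fun t => flowExp A b t e) (flowGen A b (flowExp A b t e)) t :=
  (hasDerivAt_exp_smul_const' (𝕂 := ℝ) (flowGen A b) t).clm_apply (hasDerivAt_const t e)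
    |>.congr_deriv (by simp [flowExp])

theorem contDiff_flowExp : ContDiff ℝ ∞ (flowExp A b) := by
  have h : ContDiff ℝ ∞ (NormedSpace.exp : ((Mink × ℝ) →L[ℝ] (Mink × ℝ)) → _) :=
    contDiff_iff_contDiffAt.2 fun x => (NormedSpace.exp_analytic (𝕂 := ℝ) x).contDiffAt
  exact h.comp (contDiff_id.smul contDiff_const)

theorem isOpenInterval_univ : IsOpenInterval (univ : Set ℝ) :=
  ⟨isOpen_univ, ordConnected_univ, univ_nonempty⟩

theorem flowExp_snd (t : ℝ) (e : Mink × ℝ) : (flowExp A b t e).2 = e.2 := by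
  have h : ∀ x ∈ univ, HasDerivAt (fun t => (flowExp A b t e).2) 0 x := fun x _ =>
    (hasFDerivAt_snd (𝕜 := ℝ)).comp_hasDerivAt x (hasDerivAt_flowExp' A b e x)
      |>.congr_deriv rfl
  rw [isOpenInterval_univ.eq_of_hasDerivAt_zero h (mem_univ t) (mem_univ 0)]
  simp [flowExp_zero]

theorem flowExp_eq (t : ℝ) (e : Mink × ℝ) :
    flowExp A b t e = ((flowExp A b t e).1, e.2) := Prod.ext rfl (flowExp_snd A b t e)

theorem flowExp_neg (t : ℝ) (e : Mink × ℝ) : flowExp A b (-t) (flowExp A b t e) = e := by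
  have := flowExp_add A b (-t) t
  rw [neg_add_cancel, flowExp_zero] at this
  exact (DFunLike.congr_fun this e).symm

theorem flowExp_neg' (t : ℝ) (e : Mink × ℝ) : flowExp A b t (flowExp A b (-t) e) = e := by
  have := flowExp_neg A b (-t) e
  rwa [neg_neg] at this

/-- The linear part of the affine flow. -/
def flowLin (t : ℝ) : Mink ≃ₗ[ℝ] Mink where
  toFun X := (flowExp A b t (X, 0)).1
  map_add' X Y := by
    rw [← Prod.fst_add, ← map_add, Prod.mk_add_mk, add_zero]
  map_smul' r X := by
    rw [RingHom.id_apply, ← Prod.smul_fst, ← map_smul, Prod.smul_mk, smul_zero]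
  invFun X := (flowExp A b (-t) (X, 0)).1
  left_inv X := by
    have := flowExp_eq A b t (X, 0)
    simp only at this ⊢
    rw [← this, flowExp_neg]
  right_inv X := by
    have := flowExp_eq A b (-t) (X, 0)
    simp only at this ⊢
    rw [← this, flowExp_neg']

/-- The affine flow with velocity `A X + b`. -/
def flow : Multiplicative ℝ →* (Mink ≃ᵃ[ℝ] Mink) where
  toFun t := (flowLin A b t.toAdd).toAffineEquiv.trans
    (AffineEquiv.constVAdd ℝ Mink (flowExp A b t.toAdd (0, 1)).1)
  map_one' := by
    ext1 X
    simp [flowLin, flowExp_zero]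
  map_mul' s t := by
    have key : ∀ (r : ℝ) (X : Mink), (flowExp A b r (0, 1)).1 + (flowExp A b r (X, 0)).1 =
        (flowExp A b r (X, 1)).1 := fun r X => by
      rw [← Prod.fst_add, ← map_add, Prod.mk_add_mk, add_zero, zero_add]
    ext1 X
    simp only [AffineEquiv.trans_apply, AffineEquiv.mul_def, AffineEquiv.constVAdd_apply,
      LinearEquiv.coe_toAffineEquiv, flowLin, LinearEquiv.coe_mk, vadd_eq_add, toAdd_mul,
      LinearMap.coe_mk, AddHom.coe_mk]
    rw [key, key, key, flowExp_add, mul_apply_eq_comp,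
      flowExp_eq A b t.toAdd (X, 1)]

theorem flow_apply (t : ℝ) (X : Mink) :
    flow A b (Multiplicative.ofAdd t) X = (flowExp A b t (X, 1)).1 := by
  change (flowExp A b t (0, 1)).1 + (flowExp A b t (X, 0)).1 = _
  rw [← Prod.fst_add, ← map_add, Prod.mk_add_mk, add_zero, zero_add]

theorem flow_linear (t : ℝ) (X : Mink) :
    (flow A b (Multiplicative.ofAdd t)).linear X = (flowExp A b t (X, 0)).1 := by
  have := affine_sub (flow A b (Multiplicative.ofAdd t)) X 0
  rw [sub_zero, flow_apply, flow_apply, ← Prod.fst_sub, ← map_sub, Prod.mk_sub_mk, sub_zero,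
    sub_self] at this
  exact this.symm

theorem hasDerivAt_flow (X : Mink) (t : ℝ) :
    HasDerivAt (fun t => flow A b (Multiplicative.ofAdd t) X)
      ((flow A b (Multiplicative.ofAdd t)).linear (A X + b)) t := by
  simp only [flow_apply, flow_linear]
  refine ((hasFDerivAt_fst (𝕜 := ℝ)).comp_hasDerivAt t (hasDerivAt_flowExp A b (X, 1) t)).congr_deriv
    ?_
  rw [flowGen_apply, one_smul]
  rfl

theorem hasDerivAt_flow_linear (X : Mink) (t : ℝ) :
    HasDerivAt (fun t => (flow A b (Multiplicative.ofAdd t)).linear X)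
      ((flow A b (Multiplicative.ofAdd t)).linear (A X)) t := by
  simp only [flow_linear]
  refine ((hasFDerivAt_fst (𝕜 := ℝ)).comp_hasDerivAt t (hasDerivAt_flowExp A b (X, 0) t)).congr_deriv
    ?_
  rw [flowGen_apply, zero_smul, add_zero]
  rfl

theorem contDiff_flow : ContDiff ℝ ∞ fun z : ℝ × Mink => flow A b (Multiplicative.ofAdd z.1) z.2 := by
  simp only [flow_apply]
  exact contDiff_fst.comp (((contDiff_flowExp A b).comp contDiff_fst).clm_apply
    (contDiff_snd.prodMk contDiff_const))

/-- The generator commutes with its exponential, so the derivative of L_t X may be written A L_t X;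
skewness of A then makes the square of L_t X constant. -/
theorem mink_flow_linear (h : ∀ V W, mink (A V) W = -mink V (A W)) (t : ℝ) (X : Mink) :
    mink ((flow A b (Multiplicative.ofAdd t)).linear X)
      ((flow A b (Multiplicative.ofAdd t)).linear X) = mink X X := by
  have hd : ∀ x ∈ univ, HasDerivAt (fun t => mink ((flow A b (Multiplicative.ofAdd t)).linear X)
      ((flow A b (Multiplicative.ofAdd t)).linear X)) 0 x := fun x _ => by
    have h1 : HasDerivAt (fun t => (flow A b (Multiplicative.ofAdd t)).linear X)
        (A ((flow A b (Multiplicative.ofAdd x)).linear X)) x := by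
      simp only [flow_linear]
      refine ((hasFDerivAt_fst (𝕜 := ℝ)).comp_hasDerivAt x
        (hasDerivAt_flowExp' A b (X, 0) x)).congr_deriv ?_
      change (flowGen A b (flowExp A b x (X, 0))).1 = _
      rw [flowGen_apply, flowExp_snd]
      simp
    refine (HasDerivAt.mink h1 h1).congr_deriv ?_
    rw [h, neg_add_cancel]
  rw [isOpenInterval_univ.eq_of_hasDerivAt_zero hd (mem_univ t) (mem_univ 0)]
  simp only [flow_linear, flowExp_zero]
  rfl

theorem isIsometryFlow_flow (h : ∀ V W, mink (A V) W = -mink V (A W)) :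
    IsIsometryFlow (flow A b) :=
  ⟨fun t => IsIsometry.of_linear (mink_flow_linear A b h t), fun X =>
    continuous_iff_continuousAt.2 fun t => (hasDerivAt_flow A b X t).continuousAt⟩

/-! ### Smoothness of solutions -/

/-- Bootstrapping: if the derivative is as regular as the function, each step gains one order. -/
theorem contDiffOn_of_hasDerivAt {F : Type*} [NormedAddCommGroup F] [NormedSpace ℝ F] {J : Set ℝ}
    (hJ : IsOpen J) {y y' : ℝ → F} (hd : ∀ x ∈ J, HasDerivAt y (y' x) x)
    (h : ∀ n : ℕ, ContDiffOn ℝ n y J → ContDiffOn ℝ n y' J) : ContDiffOn ℝ ∞ y J := by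
  rw [contDiffOn_infty]
  intro n
  induction n with
  | zero => exact contDiffOn_zero.2 fun x hx => (hd x hx).continuousAt.continuousWithinAt
  | succ n ih =>
    push_cast
    rw [contDiffOn_succ_iff_deriv_of_isOpen hJ]
    refine ⟨fun x hx => (hd x hx).differentiableAt.differentiableWithinAt, by simp, ?_⟩
    exact (h n ih).congr fun x hx => (hd x hx).deriv

theorem Sol.contDiffOn {p Q : ℝ} {J : Set ℝ} {v w : ℝ → ℝ} (h : Sol p Q J v w) (hJ : IsOpen J) :
    ContDiffOn ℝ ∞ v J := by
  have := contDiffOn_of_hasDerivAt (y := fun x => (v x, w x)) hJ (fun x hx => h.hasDerivAt_prod hx)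
    fun n hn => by
      have h1 : ContDiffOn ℝ n v J := contDiff_fst.comp_contDiffOn hn
      have h2 : ContDiffOn ℝ n w J := contDiff_snd.comp_contDiffOn hn
      exact h2.prodMk ((contDiffOn_const.mul h1).mul ((h1.pow 2).sub contDiffOn_const))
  exact contDiff_fst.comp_contDiffOn this

theorem IsFrameSol.contDiffOn {α β : ℝ → ℝ} {J : Set ℝ} {y : ℝ → ℝ × ℝ × ℝ}
    (h : IsFrameSol α β J y) (hJ : IsOpen J) (hα : ContDiffOn ℝ ∞ α J) (hβ : ContDiffOn ℝ ∞ β J) :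
    ContDiffOn ℝ ∞ y J := by
  refine contDiffOn_of_hasDerivAt hJ h fun n hn => ?_
  have ha := hα.of_le (m := n) (by exact_mod_cast le_top)
  have hb := hβ.of_le (m := n) (by exact_mod_cast le_top)
  have h1 := contDiff_fst.comp_contDiffOn hn
  have h2 := contDiff_fst.comp_contDiffOn (contDiff_snd.comp_contDiffOn hn)
  have h3 := contDiff_snd.comp_contDiffOn (contDiff_snd.comp_contDiffOn hn)
  exact (ha.mul h3).prodMk ((hb.mul h3).prodMk ((ha.mul h1).add (hb.mul h2)))

end CMC
end

noncomputable section

namespace CMC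

open Filter Topology Metric
open scoped NNReal

/-! ### Construction of equivariant surfaces from solutions. -/

variable {J : Set ℝ} {H : ℝ}

/-- If Y D Yᵀ = D with D = diag(1, 1, -1), then D Yᵀ D is the inverse of Y, whence Yᵀ D Y = D. The
frame equations control the products of the rows of Y, while the frame consists of its columns. -/
theorem isFrame_of_transpose {y : Fin 3 → ℝ × ℝ × ℝ}
    (h : ∀ i j, (y i).1 * (y j).1 + (y i).2.1 * (y j).2.1 - (y i).2.2 * (y j).2.2 =
      if i = j then (![1, 1, -1] : Fin 3 → ℝ) i else 0) :
    IsFrame 1 (fun i => (y i).1) (fun i => (y i).2.1) (fun i => (y i).2.2) := by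
  let Y : Matrix (Fin 3) (Fin 3) ℝ := Matrix.of fun i => ![(y i).1, (y i).2.1, (y i).2.2]
  let D : Matrix (Fin 3) (Fin 3) ℝ := Matrix.diagonal ![1, 1, -1]
  have h1 : Y * (D * Y.transpose * D) = 1 := by
    ext i j
    have := h i j
    fin_cases i <;> fin_cases j <;>
      simp [Matrix.mul_apply, Fin.sum_univ_three, Y, D, Matrix.diagonal] at this ⊢ <;>
      linarith
  have h2 := mul_eq_one_comm.1 h1
  have key : ∀ i j, (D * Y.transpose * D * Y) i j = (1 : Matrix (Fin 3) (Fin 3) ℝ) i j := fun i j => by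
    rw [h2]
  have k00 := key 0 0
  have k11 := key 1 1
  have k22 := key 2 2
  have k01 := key 0 1
  have k20 := key 2 0
  have k21 := key 2 1
  simp only [Matrix.mul_apply, Fin.sum_univ_three, Y, D, Matrix.diagonal] at k00 k11 k22 k01 k20 k21
  simp at k00 k11 k22 k01 k20 k21
  refine ⟨one_pos, ?_, ?_, ?_, ?_, ?_, ?_⟩ <;> simp only [mink] <;> linarith

/-- The moving frame along a profile curve. -/
theorem exists_moving_frame (hJ : IsOpenInterval J) {α β : ℝ → ℝ} (hα : ContDiffOn ℝ ∞ α J)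
    (hβ : ContDiffOn ℝ ∞ β J) : ∃ e₁ e₂ n : ℝ → Mink, ContDiffOn ℝ ∞ e₁ J ∧ ContDiffOn ℝ ∞ e₂ J ∧
      ContDiffOn ℝ ∞ n J ∧ ∀ x ∈ J, HasDerivAt e₁ (α x • n x) x ∧ HasDerivAt e₂ (β x • n x) x ∧
        HasDerivAt n (α x • e₁ x + β x • e₂ x) x ∧ IsFrame 1 (e₁ x) (e₂ x) (n x) := by
  obtain ⟨x₀, hx₀⟩ := hJ.2.2
  -- The frame equations act on each of the three coordinates separately; y i collects the i-th
  -- coordinates of e₁, e₂, n.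
  choose y hy₀ hy using fun i : Fin 3 => exists_frameSol hJ hα.continuousOn hβ.continuousOn hx₀
    ((![(1, 0, 0), (0, 1, 0), (0, 0, 1)] : Fin 3 → ℝ × ℝ × ℝ) i)
  have hs := fun i => (hy i).contDiffOn hJ.1 hα hβ
  have d1 : ∀ x ∈ J, ∀ i, HasDerivAt (fun x => (y i x).1) (α x * (y i x).2.2) x := fun x hx i =>
    ((hasFDerivAt_fst (𝕜 := ℝ) (p := y i x)).comp_hasDerivAt x (hy i x hx)).congr_deriv rfl
  have d23 : ∀ x ∈ J, ∀ i, HasDerivAt (fun x => (y i x).2)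
      (β x * (y i x).2.2, α x * (y i x).1 + β x * (y i x).2.1) x := fun x hx i =>
    ((hasFDerivAt_snd (𝕜 := ℝ) (p := y i x)).comp_hasDerivAt x (hy i x hx)).congr_deriv rfl
  have d2 : ∀ x ∈ J, ∀ i, HasDerivAt (fun x => (y i x).2.1) (β x * (y i x).2.2) x := fun x hx i =>
    ((hasFDerivAt_fst (𝕜 := ℝ) (p := (y i x).2)).comp_hasDerivAt x (d23 x hx i)).congr_deriv rfl
  have d3 : ∀ x ∈ J, ∀ i, HasDerivAt (fun x => (y i x).2.2)
      (α x * (y i x).1 + β x * (y i x).2.1) x := fun x hx i =>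
    ((hasFDerivAt_snd (𝕜 := ℝ) (p := (y i x).2)).comp_hasDerivAt x (d23 x hx i)).congr_deriv rfl
  refine ⟨fun x i => (y i x).1, fun x i => (y i x).2.1, fun x i => (y i x).2.2,
    contDiffOn_pi.2 fun i => contDiff_fst.comp_contDiffOn (hs i),
    contDiffOn_pi.2 fun i => contDiff_fst.comp_contDiffOn (contDiff_snd.comp_contDiffOn (hs i)),
    contDiffOn_pi.2 fun i => contDiff_snd.comp_contDiffOn (contDiff_snd.comp_contDiffOn (hs i)),
    fun x hx => ⟨hasDerivAt_pi.2 (d1 x hx), hasDerivAt_pi.2 (d2 x hx), hasDerivAt_pi.2 (d3 x hx),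
      isFrame_of_transpose (y := fun i => y i x) fun i j => ?_⟩⟩
  -- The coefficient matrix lies in the Lie algebra of the Lorentz group, so the products of rows
  -- are preserved.
  have hc := hJ.eq_of_hasDerivAt_zero (f := fun x => (y i x).1 * (y j x).1 +
    (y i x).2.1 * (y j x).2.1 - (y i x).2.2 * (y j x).2.2) (fun x hx => by
      refine ((((d1 x hx i).mul (d1 x hx j)).add ((d2 x hx i).mul (d2 x hx j))).sub
        ((d3 x hx i).mul (d3 x hx j))).congr_deriv ?_
      ring) hx hx₀
  simp only [hy₀] at hc
  rw [hc]
  fin_cases i <;> fin_cases j <;> simp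

/-- The infinitesimal rotation of the moving frame along the second coordinate does not depend on
the first one. -/
theorem exists_generator (hJ : IsOpenInterval J) {u α β γ : ℝ → ℝ} {e₁ e₂ n : ℝ → Mink}
    (dβ : ∀ x ∈ J, HasDerivAt β (-(u x * β x)) x) (dγ : ∀ x ∈ J, HasDerivAt γ (u x * α x) x)
    (du : ∀ x ∈ J, HasDerivAt u (α x * γ x - β x ^ 2) x)
    (hd : ∀ x ∈ J, HasDerivAt e₁ (α x • n x) x ∧ HasDerivAt e₂ (β x • n x) x ∧
        HasDerivAt n (α x • e₁ x + β x • e₂ x) x ∧ IsFrame 1 (e₁ x) (e₂ x) (n x)) :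
    ∃ A : Mink →L[ℝ] Mink, (∀ V W, mink (A V) W = -mink V (A W)) ∧
      ∀ x ∈ J, A (e₁ x) = u x • e₂ x + β x • n x ∧ A (e₂ x) = -u x • e₁ x + γ x • n x := by
  -- The motion of the frame in the y-direction: e₁ ↦ u e₂ + β n, e₂ ↦ -u e₁ + γ n, n ↦ β e₁ + γ e₂.
  -- That its x-derivative vanishes is exactly the content of `dβ`, `dγ`, `du`.
  let op : ℝ → Mink →ₗ[ℝ] Mink := fun x => frameMap 1 (e₁ x) (e₂ x) (n x)
    (u x • e₂ x + β x • n x) (-u x • e₁ x + γ x • n x) (β x • e₁ x + γ x • e₂ x)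
  have hop : ∀ x V, op x V = mink V (e₁ x) • (u x • e₂ x + β x • n x) +
      mink V (e₂ x) • (-u x • e₁ x + γ x • n x) - mink V (n x) • (β x • e₁ x + γ x • e₂ x) :=
    fun x V => by simp only [op, frameMap_apply, div_one]
  have hopd : ∀ x ∈ J, ∀ V, HasDerivAt (fun x => op x V) 0 x := fun x hx V => by
    obtain ⟨h1, h2, h3, -⟩ := hd x hx
    have hV := hasDerivAt_const x V
    have d1 := HasDerivAt.mink hV h1
    have d2 := HasDerivAt.mink hV h2
    have d3 := HasDerivAt.mink hV h3
    have t1 := d1.smul (((du x hx).smul h2).add ((dβ x hx).smul h3))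
    have t2 := d2.smul (((du x hx).neg.smul h1).add ((dγ x hx).smul h3))
    have t3 := d3.smul (((dβ x hx).smul h1).add ((dγ x hx).smul h2))
    simp only [hop]
    refine ((t1.add t2).sub t3).congr_deriv ?_
    simp only [mink_zero_left, mink_smul_right, mink_add_right, Pi.add_apply, Pi.smul_apply',
      Pi.neg_apply]
    module
  obtain ⟨x₀, hx₀⟩ := hJ.2.2
  have hA : ∀ x ∈ J, ∀ V, op x₀ V = op x V := fun x hx V =>
    hJ.eq_of_hasDerivAt_zero (fun x hx => hopd x hx V) hx₀ hx
  refine ⟨LinearMap.toContinuousLinearMap (op x₀), fun V W => ?_, fun x hx => ?_⟩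
  · simp only [LinearMap.coe_toContinuousLinearMap', hop, mink_add_left, mink_add_right,
      mink_smul_left, mink_smul_right, mink_sub_left, mink_sub_right, mink_comm (e₁ x₀) W,
      mink_comm (e₂ x₀) W, mink_comm (n x₀) W]
    ring
  · have hF := (hd x hx).2.2.2
    simp only [LinearMap.coe_toContinuousLinearMap', hA x hx, hop, hF.xx, hF.yy, hF.xy,
      mink_comm (e₂ x) (e₁ x), mink_comm _ (n x), hF.nx, hF.ny]
    exact ⟨by module, by module⟩

theorem exists_flow (A : Mink →L[ℝ] Mink) (b : Mink) (h : ∀ V W, mink (A V) W = -mink V (A W)) :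
    ∃ R : Multiplicative ℝ →* (Mink ≃ᵃ[ℝ] Mink), IsIsometryFlow R ∧
      (ContDiff ℝ ∞ fun z : ℝ × Mink => R (Multiplicative.ofAdd z.1) z.2) ∧
      (∀ X t, HasDerivAt (fun t => R (Multiplicative.ofAdd t) X)
        ((R (Multiplicative.ofAdd t)).linear (A X + b)) t) ∧
      ∀ X t, HasDerivAt (fun t => (R (Multiplicative.ofAdd t)).linear X)
        ((R (Multiplicative.ofAdd t)).linear (A X)) t :=
  ⟨flow A b, isIsometryFlow_flow A b h, contDiff_flow A b, hasDerivAt_flow A b,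
    hasDerivAt_flow_linear A b⟩

/-- The surface swept out by a profile curve under a one-parameter group of isometries. -/
theorem confSurf_of_flow (hJ : IsOpenInterval J) {l u α β γ : ℝ → ℝ} {e₁ e₂ n F : ℝ → Mink}
    {A : Mink →L[ℝ] Mink} {b : Mink} {R : Multiplicative ℝ →* (Mink ≃ᵃ[ℝ] Mink)}
    (hl : ∀ x ∈ J, 0 < l x) (dl : ∀ x ∈ J, HasDerivAt l (u x * l x) x)
    (hm : ∀ x ∈ J, -(l x * α x) + -(l x * γ x) = 2 * H * l x ^ 2)
    (hd : ∀ x ∈ J, HasDerivAt e₁ (α x • n x) x ∧ HasDerivAt e₂ (β x • n x) x ∧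
        HasDerivAt n (α x • e₁ x + β x • e₂ x) x ∧ IsFrame 1 (e₁ x) (e₂ x) (n x))
    (hA2 : ∀ x ∈ J, A (e₂ x) = -u x • e₁ x + γ x • n x) (sF : ContDiffOn ℝ ∞ F J)
    (dF : ∀ x ∈ J, HasDerivAt F (l x • e₁ x) x) (hb : ∀ x ∈ J, A (F x) + b = l x • e₂ x)
    (hI : ∀ t, IsIsometry (R (Multiplicative.ofAdd t)))
    (sR : ContDiff ℝ ∞ fun z : ℝ × Mink => R (Multiplicative.ofAdd z.1) z.2)
    (dR : ∀ X t, HasDerivAt (fun t => R (Multiplicative.ofAdd t) X)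
        ((R (Multiplicative.ofAdd t)).linear (A X + b)) t)
    (dL : ∀ X t, HasDerivAt (fun t => (R (Multiplicative.ofAdd t)).linear X)
        ((R (Multiplicative.ofAdd t)).linear (A X)) t) :
    ∃ N : ℝ × ℝ → Mink,
      ConfSurf H J (fun z => R (Multiplicative.ofAdd z.2) (F z.1)) N (fun x => l x ^ 2) ∧
      ∀ z ∈ strip J, hxx (fun z => R (Multiplicative.ofAdd z.2) (F z.1)) N z = -(l z.1 * α z.1) ∧
        hxy (fun z => R (Multiplicative.ofAdd z.2) (F z.1)) N z = -(l z.1 * β z.1) ∧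
        hyy (fun z => R (Multiplicative.ofAdd z.2) (F z.1)) N z = -(l z.1 * γ z.1) := by
  have hL : ∀ y V W, mink ((R (Multiplicative.ofAdd y)).linear V)
    ((R (Multiplicative.ofAdd y)).linear W) = mink V W := fun y V W => (hI y).linear_mink V W
  set f : ℝ × ℝ → Mink := fun z => R (Multiplicative.ofAdd z.2) (F z.1) with hf
  have sf : ContDiffOn ℝ ∞ f (strip J) := sR.comp_contDiffOn
    (contDiff_snd.contDiffOn.prodMk (sF.comp contDiff_fst.contDiffOn fun z hz => hz.1))
  have fx : ∀ x ∈ J, ∀ y, pdx f (x, y) = (R (Multiplicative.ofAdd y)).linear (l x • e₁ x) :=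
    fun x hx y => pdx_eq hJ.1 sf hx (HasDerivAt.affine_comp (dF x hx) (R (Multiplicative.ofAdd y)))
  have fy : ∀ x ∈ J, ∀ y, pdy f (x, y) = (R (Multiplicative.ofAdd y)).linear (l x • e₂ x) :=
    fun x hx y => by
      refine pdy_eq hJ.1 sf hx ?_
      rw [← hb x hx]
      exact dR (F x) y
  have sfx := contDiffOn_pdx hJ.1 sf
  have sfy := contDiffOn_pdy hJ.1 sf
  have fxx : ∀ x ∈ J, ∀ y, pdx (pdx f) (x, y) =
      (R (Multiplicative.ofAdd y)).linear (l x • α x • n x + (u x * l x) • e₁ x) :=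
    fun x hx y => by
      refine pdx_eq hJ.1 sfx hx ?_
      have h := HasDerivAt.linearMap_comp ((dl x hx).smul (hd x hx).1)
        (R (Multiplicative.ofAdd y)).linear
      exact h.congr_of_eventuallyEq (by
        filter_upwards [hJ.1.mem_nhds hx] with s hs using fx s hs y)
  have fxy : ∀ x ∈ J, ∀ y, pdx (pdy f) (x, y) =
      (R (Multiplicative.ofAdd y)).linear (l x • β x • n x + (u x * l x) • e₂ x) :=
    fun x hx y => by
      refine pdx_eq hJ.1 sfy hx ?_
      have h := HasDerivAt.linearMap_comp ((dl x hx).smul (hd x hx).2.1)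
        (R (Multiplicative.ofAdd y)).linear
      exact h.congr_of_eventuallyEq (by
        filter_upwards [hJ.1.mem_nhds hx] with s hs using fy s hs y)
  have fyy : ∀ x ∈ J, ∀ y, pdy (pdy f) (x, y) =
      (R (Multiplicative.ofAdd y)).linear (l x • (-u x • e₁ x + γ x • n x)) :=
    fun x hx y => by
      refine pdy_eq hJ.1 sfy hx ?_
      have h := dL (l x • e₂ x) y
      rw [map_smul A, hA2 x hx] at h
      exact h.congr_of_eventuallyEq (Eventually.of_forall fun s => fy x hx s)
  have hh : ∀ z ∈ strip J, hxx f (fun z => (R (Multiplicative.ofAdd z.2)).linear (n z.1)) z =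
        -(l z.1 * α z.1) ∧
      hxy f (fun z => (R (Multiplicative.ofAdd z.2)).linear (n z.1)) z = -(l z.1 * β z.1) ∧
      hyy f (fun z => (R (Multiplicative.ofAdd z.2)).linear (n z.1)) z = -(l z.1 * γ z.1) := by
    rintro ⟨x, y⟩ hz
    have hx := mk_mem_strip.1 hz
    have hF := (hd x hx).2.2.2
    simp only [hxx, hxy, hyy, fxx x hx, fxy x hx, fyy x hx, hL, mink_add_right, mink_smul_right,
      hF.nn, hF.nx, hF.ny]
    refine ⟨?_, ?_, ?_⟩ <;> ring
  refine ⟨fun z => (R (Multiplicative.ofAdd z.2)).linear (n z.1), ⟨hJ, sf, ?_, fun z hz => ?_⟩, hh⟩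
  · rintro ⟨x, y⟩ hz
    have hx := mk_mem_strip.1 hz
    have hF := (hd x hx).2.2.2
    have hlx := hl x hx
    rw [fx x hx, fy x hx]
    refine ⟨by positivity, ?_, ?_, ?_, ?_, ?_, ?_⟩ <;>
      simp only [hL, mink_smul_left, mink_smul_right, hF.xx, hF.yy, hF.xy, hF.nn, hF.nx, hF.ny] <;>
      ring
  · obtain ⟨h1, -, h3⟩ := hh z hz
    rw [h1, h3]
    exact hm z.1 hz.1

/-- Surfaces with prescribed fundamental forms depending on one variable only. -/
theorem exists_surface (hJ : IsOpenInterval J) {l u α β γ : ℝ → ℝ} (sl : ContDiffOn ℝ ∞ l J)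
    (sα : ContDiffOn ℝ ∞ α J) (sβ : ContDiffOn ℝ ∞ β J) (hl : ∀ x ∈ J, 0 < l x)
    (dl : ∀ x ∈ J, HasDerivAt l (u x * l x) x) (dβ : ∀ x ∈ J, HasDerivAt β (-(u x * β x)) x)
    (dγ : ∀ x ∈ J, HasDerivAt γ (u x * α x) x)
    (du : ∀ x ∈ J, HasDerivAt u (α x * γ x - β x ^ 2) x)
    (hm : ∀ x ∈ J, -(l x * α x) + -(l x * γ x) = 2 * H * l x ^ 2) :
    ∃ (f N : ℝ × ℝ → Mink) (R : Multiplicative ℝ →* (Mink ≃ᵃ[ℝ] Mink)),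
      ConfSurf H J f N (fun x => l x ^ 2) ∧ IsEquivariantUnder ⟨J, f⟩ R ∧ ∀ z ∈ strip J,
        hxx f N z = -(l z.1 * α z.1) ∧ hxy f N z = -(l z.1 * β z.1) ∧
        hyy f N z = -(l z.1 * γ z.1) := by
  obtain ⟨e₁, e₂, n, s₁, s₂, s₃, hd⟩ := exists_moving_frame hJ sα sβ
  obtain ⟨A, hskew, hA⟩ := exists_generator hJ dβ dγ du hd
  obtain ⟨F, sF, dF⟩ := exists_antideriv hJ (s := fun x => l x • e₁ x) (sl.smul s₁)
  obtain ⟨x₀, hx₀⟩ := hJ.2.2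
  -- The translation part b is chosen so that the velocity A F + b of the flow is f_y = l e₂ at one
  -- point of the profile. It then is so everywhere, both sides having the same derivative.
  have hb : ∀ x ∈ J, A (F x) + (l x₀ • e₂ x₀ - A (F x₀)) = l x • e₂ x := fun x hx => by
    have : l x • e₂ x - A (F x) = l x₀ • e₂ x₀ - A (F x₀) := hJ.eq_of_hasDerivAt_zero
      (f := fun x => l x • e₂ x - A (F x)) (fun x hx => by
        obtain ⟨h1, h2, h3, -⟩ := hd x hx
        refine (((dl x hx).smul h2).sub (A.hasFDerivAt.comp_hasDerivAt x (dF x hx))).congr_deriv ?_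
        rw [map_smul A, (hA x hx).1]
        module) hx hx₀
    rw [← this]
    abel
  obtain ⟨R, hflow, sR, dR, dL⟩ := exists_flow A (l x₀ • e₂ x₀ - A (F x₀)) hskew
  obtain ⟨N, hN, hh⟩ := confSurf_of_flow hJ hl dl hm hd (fun x hx => (hA x hx).2) sF dF hb
    hflow.1 sR dR dL
  refine ⟨_, N, R, hN, ⟨hflow, fun x hx y t => ?_⟩, hh⟩
  change R (Multiplicative.ofAdd (y + t)) (F x) = R _ (R _ (F x))
  rw [add_comm, ofAdd_add, map_mul]
  rfl

/-- Every positive solution is realized by an equivariant surface. -/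
theorem exists_surface_of_sol {p : ℝ} {P : ℂ} {g w : ℝ → ℝ} (hH : H ≠ 0) (hJ : IsOpenInterval J)
    (hg : Sol p (‖P‖ ^ 2) J g w) (hpos : ∀ x ∈ J, 0 < g x) :
    ∃ S : StripMap, S.J = J ∧ IsEquivariantCMC H S ∧ IsConf H p P g S := by
  have hH' : 0 < |H| := abs_pos.2 hH
  have hHH : |H| ^ 2 = H ^ 2 := sq_abs H
  have sg := hg.contDiffOn hJ.1
  have hnorm : ‖P‖ ^ 2 = P.re ^ 2 + P.im ^ 2 := by
    rw [← Complex.normSq_eq_norm_sq, Complex.normSq_apply]; ring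
  -- Here l is the positive square root of the metric coefficient and u = g'/g. Since ⟨n, n⟩ = -1,
  -- the functions α, β, γ are the prescribed second fundamental form divided by -l.
  obtain ⟨f, N, R, hconf, hR, hh⟩ := exists_surface (H := H) hJ (l := fun x => g x / |H|)
    (u := fun x => w x / g x)
    (α := fun x => -((H * (g x / |H|) ^ 2 + P.re / H) / (g x / |H|)))
    (β := fun x => (P.im / H) / (g x / |H|))
    (γ := fun x => -((H * (g x / |H|) ^ 2 - P.re / H) / (g x / |H|)))
    (sg.div_const _)
    ((((contDiffOn_const.mul ((sg.div_const _).pow 2)).add contDiffOn_const).div (sg.div_const _)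
      fun x hx => (div_pos (hpos x hx) hH').ne').neg)
    (contDiffOn_const.div (sg.div_const _) fun x hx => (div_pos (hpos x hx) hH').ne')
    (fun x hx => div_pos (hpos x hx) hH')
    (fun x hx => by
      refine ((hg x hx).1.div_const _).congr_deriv ?_
      have := (hpos x hx).ne'
      field_simp)
    (fun x hx => by
      have := (hpos x hx).ne'
      refine ((hasDerivAt_const x (P.im / H)).div ((hg x hx).1.div_const _) (by positivity)).congr_deriv ?_
      field_simp
      ring)
    (fun x hx => by
      have := (hpos x hx).ne'
      have d := (hg x hx).1.div_const |H|
      refine (((((d.pow 2).const_mul H).sub_const (P.re / H)).div d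
        (by positivity)).neg).congr_deriv ?_
      simp only [Pi.pow_apply, Nat.add_one_sub_one, pow_one]
      field_simp
      ring)
    (fun x hx => by
      have := (hpos x hx).ne'
      obtain ⟨d1, d2, d3⟩ := hg x hx
      refine (d2.div d1 this).congr_deriv ?_
      field_simp
      rw [show |H| ^ 4 = (|H| ^ 2) ^ 2 by ring, hHH, d3, hnorm]
      ring)
    (fun x hx => by
      have := (hpos x hx).ne'
      field_simp
      ring)
  refine ⟨⟨J, f⟩, rfl, ⟨hconf.isCMC hH, R, hR⟩, ⟨N, ?_, ?_⟩, hpos, w, hg⟩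
  · refine hconf.congr_metric fun x _ => ?_
    simp only [div_pow, hHH]
  · intro z hz
    obtain ⟨h1, h2, h3⟩ := hh z hz
    have := (hpos _ hz.1).ne'
    rw [h1, h2, h3]
    refine ⟨?_, ?_, ?_⟩
    · simp only [← hHH, div_pow]
      field_simp
    · field_simp
    · simp only [← hHH, div_pow]
      field_simp

end CMC
end

noncomputable section

namespace CMC

open Filter Topology Metric
open scoped NNReal

variable {J : Set ℝ} {H : ℝ} {f N : ℝ × ℝ → Mink} {m : ℝ → ℝ}
  {R : Multiplicative ℝ →* (Mink ≃ᵃ[ℝ] Mink)}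

/-! ### Rotational surfaces -/

theorem linear_eq_self_of_translation {A : Mink ≃ᵃ[ℝ] Mink} {b : Mink} (h : ∀ X, A X = X + b)
    (V : Mink) : A.linear V = V := by
  have := affine_sub A V 0
  rw [sub_zero, h, h] at this
  rw [← this]
  abel

theorem affine_add (A : Mink ≃ᵃ[ℝ] Mink) (X V : Mink) : A (X + V) = A X + A.linear V := by
  have := affine_sub A (X + V) X
  rw [add_sub_cancel_left] at this
  rw [← this]
  abel

theorem eq_of_pdy_eq_zero {u : ℝ × ℝ → Mink} (hJ : IsOpen J) (hu : ContDiffOn ℝ ∞ u (strip J)) {x : ℝ}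
    (hx : x ∈ J) (h : ∀ y, pdy u (x, y) = 0) (y y' : ℝ) : u (x, y) = u (x, y') :=
  isOpenInterval_univ.eq_of_hasDerivAt_zero (f := fun y => u (x, y))
    (fun y _ => (hasDerivAt_pdy hJ hu hx y).congr_deriv (h y)) (mem_univ y) (mem_univ y')

/-- The direction d of the axis is fixed by every linear part, so ⟨d, f⟩ and ⟨d, N⟩ do not depend on
y. Hence ⟨d, f_y⟩, ⟨d, f_xy⟩ and ⟨d, N_y⟩ vanish. If ⟨N, f_xy⟩ were nonzero, the structure equations
would make d orthogonal to the whole frame. -/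
theorem ConfSurf.hxy_eq_zero_of_axis (h : ConfSurf H J f N m) (hH : H ≠ 0)
    (hR : IsEquivariantUnder ⟨J, f⟩ R) (hax : HasAxis R) {x : ℝ} (hx : x ∈ J) (y : ℝ) :
    hxy f N (x, y) = 0 := by
  obtain ⟨c, d, hd, hcd⟩ := hax
  obtain ⟨hflow, hf⟩ := hR
  change ∀ x ∈ J, ∀ y t : ℝ, f (x, y + t) = R (Multiplicative.ofAdd t) (f (x, y)) at hf
  have hc : ∀ t, R (Multiplicative.ofAdd t) c = c := fun t => by simpa using hcd t 0
  have hL : ∀ t, (R (Multiplicative.ofAdd t)).linear d = d := fun t => by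
    have h1 := hcd t 1
    rw [one_smul, affine_add, hc] at h1
    exact add_left_cancel h1
  have hfd : ∀ x ∈ J, ∀ y, mink d (pdy f (x, y)) = 0 := fun x hx y => by
    have hder := HasDerivAt.mink (hasDerivAt_const y d) (hasDerivAt_pdy h.isOpen h.smooth hx y)
    rw [mink_zero_left, zero_add] at hder
    refine hasDerivAt_zero_of_shift (fun y t => ?_) hder
    have e : f (x, y + t) = c + (R (Multiplicative.ofAdd t)).linear (f (x, y) - c) := by
      rw [hf x hx, ← affine_sub, hc]
      abel
    have e2 : mink d ((R (Multiplicative.ofAdd t)).linear (f (x, y) - c)) = mink d (f (x, y) - c) := by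
      conv_lhs => rw [← hL t]
      exact (hflow.1 t).linear_mink _ _
    rw [e, mink_add_right, e2, mink_sub_right]
    ring
  have hfxy : mink d (pdx (pdy f) (x, y)) = 0 := by
    have hder := HasDerivAt.mink (hasDerivAt_const x d)
      (hasDerivAt_pdx h.isOpen (contDiffOn_pdy h.isOpen h.smooth) hx y)
    rw [mink_zero_left, zero_add] at hder
    refine hder.unique ((hasDerivAt_const x (0 : ℝ)).congr_of_eventuallyEq ?_)
    filter_upwards [h.isOpen.mem_nhds hx] with s hs using hfd s hs y
  have hny : mink d (pdy N (x, y)) = 0 := by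
    have hder := HasDerivAt.mink (hasDerivAt_const y d)
      (hasDerivAt_pdy h.isOpen (h.contDiffOn_normal hH) hx y)
    rw [mink_zero_left, zero_add] at hder
    refine hasDerivAt_zero_of_shift (fun y t => ?_) hder
    rw [(h.equivariant hH hflow.1 hf hx y t).1]
    conv_lhs => rw [← hL t]
    exact (hflow.1 t).linear_mink _ _
  have hF := h.frame (x, y) (mk_mem_strip.2 hx)
  by_contra h0
  have hdy := hfd x hx y
  rw [h.fxy_eq hx, mink_sub_right, mink_smul_right, mink_smul_right, hdy, mul_zero, zero_sub,
    neg_eq_zero] at hfxy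
  have hdn := (mul_eq_zero.1 hfxy).resolve_left h0
  rw [h.ny_eq hx _ hH, mink_sub_right, mink_smul_right, mink_smul_right, hdy, mul_zero, sub_zero] at hny
  have hdx := (mul_eq_zero.1 hny).resolve_left (neg_ne_zero.2 (div_ne_zero h0 hF.pos.ne'))
  exact hd (hF.ext (by rw [hdx, mink_zero_left]) (by rw [hdy, mink_zero_left])
    (by rw [hdn, mink_zero_left]))

/-- Translations do not move f_x, so f_xy = 0. -/
theorem ConfSurf.hxy_eq_zero_of_translational (h : ConfSurf H J f N m)
    (hR : IsEquivariantUnder ⟨J, f⟩ R) (htr : IsTranslational R) {x : ℝ} (hx : x ∈ J) (y : ℝ) :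
    hxy f N (x, y) = 0 := by
  have hL : ∀ t V, (R (Multiplicative.ofAdd t)).linear V = V := fun t V => by
    obtain ⟨b, hb⟩ := htr t
    exact linear_eq_self_of_translation hb V
  have h1 : ∀ t, pdx f (x, y + t) = pdx f (x, y) := fun t => by
    rw [pdx_equivariant h.isOpen h.smooth hR.2 hx y t, hL]
  have h2 : pdy (pdx f) (x, y) = 0 := by
    refine pdy_eq h.isOpen (contDiffOn_pdx h.isOpen h.smooth) hx ?_
    refine (hasDerivAt_const y (pdx f (x, y))).congr_of_eventuallyEq (Eventually.of_forall fun s => ?_)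
    simpa using h1 (s - y)
  rw [hxy, pdx_pdy h.isOpen h.smooth (mk_mem_strip.2 hx), h2, mink_zero_right]

/-- If ⟨N, f_xy⟩ = 0, the y-derivatives of f, f_x and N are all multiples of f_y. Suitable
combinations are therefore constant along an orbit, hence fixed by the group, and provide the axis.
-/
theorem ConfSurf.hasAxis_or_isTranslational (h : ConfSurf H J f N m) (hH : H ≠ 0)
    (hR : IsEquivariantUnder ⟨J, f⟩ R) (h0 : ∀ z ∈ strip J, hxy f N z = 0) :
    HasAxis R ∨ IsTranslational R := by
  obtain ⟨hflow, hf⟩ := hR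
  change ∀ x ∈ J, ∀ y t : ℝ, f (x, y + t) = R (Multiplicative.ofAdd t) (f (x, y)) at hf
  obtain ⟨x, hx⟩ := h.interval.2.2
  have hJ := h.isOpen
  have hzx : ∀ y, hxy f N (x, y) = 0 := fun y => h0 _ (mk_mem_strip.2 hx)
  have hk : ∀ y, hyy f N (x, y) = hyy f N (x, 0) := fun y => by
    have := (h.equivariant hH hflow.1 hf hx 0 y).2.2.2
    rwa [zero_add] at this
  set k := hyy f N (x, 0) with hkdef
  set a := deriv m x / 2 with hadef
  have hm : 0 < m x := (h.frame (x, 0) (mk_mem_strip.2 hx)).pos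
  have hfx : ∀ t, (R (Multiplicative.ofAdd t)).linear (pdx f (x, 0)) = pdx f (x, t) := fun t => by
    rw [← pdx_equivariant hJ h.smooth hf hx 0 t, zero_add]
  have hfy : ∀ t, (R (Multiplicative.ofAdd t)).linear (pdy f (x, 0)) = pdy f (x, t) := fun t => by
    rw [← pdy_equivariant hJ h.smooth hf hx 0 t, zero_add]
  have hn : ∀ t, (R (Multiplicative.ofAdd t)).linear (N (x, 0)) = N (x, t) := fun t => by
    rw [← (h.equivariant hH hflow.1 hf hx 0 t).1, zero_add]
  have hff : ∀ t, R (Multiplicative.ofAdd t) (f (x, 0)) = f (x, t) := fun t => by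
    rw [← hf x hx 0 t, zero_add]
  have dfx : ∀ y, HasDerivAt (fun y => pdx f (x, y)) ((a / m x) • pdy f (x, y)) y := fun y => by
    refine (hasDerivAt_pdy hJ (contDiffOn_pdx hJ h.smooth) hx y).congr_deriv ?_
    rw [← pdx_pdy hJ h.smooth (mk_mem_strip.2 hx), h.fxy_eq hx, hzx, zero_smul, sub_zero]
  have dn : ∀ y, HasDerivAt (fun y => N (x, y)) (-(k / m x) • pdy f (x, y)) y := fun y => by
    refine (hasDerivAt_pdy hJ (h.contDiffOn_normal hH) hx y).congr_deriv ?_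
    rw [h.ny_eq hx _ hH, hzx, hk]
    module
  have df : ∀ y, HasDerivAt (fun y => f (x, y)) (pdy f (x, y)) y := fun y =>
    hasDerivAt_pdy hJ h.smooth hx y
  -- The y-derivative of r f + s f_x + t N is (r + sa/m - tk/m) f_y.
  have hconst : ∀ (r s t : ℝ), r + s * a / m x - t * k / m x = 0 → ∀ y,
      r • f (x, y) + s • pdx f (x, y) + t • N (x, y) =
      r • f (x, 0) + s • pdx f (x, 0) + t • N (x, 0) := fun r s t hrst y =>
    isOpenInterval_univ.eq_of_hasDerivAt_zero
      (f := fun y => r • f (x, y) + s • pdx f (x, y) + t • N (x, y)) (fun y _ => by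
        refine ((((df y).const_smul r).add ((dfx y).const_smul s)).add
          ((dn y).const_smul t)).congr_deriv ?_
        rw [show r • pdy f (x, y) + s • (a / m x) • pdy f (x, y) + t • -(k / m x) • pdy f (x, y) =
          (r + s * a / m x - t * k / m x) • pdy f (x, y) by module, hrst, zero_smul])
      (mem_univ y) (mem_univ 0)
  -- If a = k = 0 the whole frame is constant along the orbit, and the linear parts are trivial.
  by_cases hak : a = 0 ∧ k = 0
  · right
    obtain ⟨ha, hk0⟩ := hak
    have c1 : ∀ t, pdx f (x, t) = pdx f (x, 0) := fun t => by
      simpa using hconst 0 1 0 (by rw [ha]; simp) t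
    have c2 : ∀ t, N (x, t) = N (x, 0) := fun t => by
      simpa using hconst 0 0 1 (by rw [hk0]; simp) t
    have c3 : ∀ t, pdy f (x, t) = pdy f (x, 0) := fun t =>
      eq_of_pdy_eq_zero hJ (contDiffOn_pdy hJ h.smooth) hx (fun y => by
        rw [h.fyy_eq hx, hk, hk0, ← hadef, ha]; simp) t 0
    have hF := h.frame (x, 0) (mk_mem_strip.2 hx)
    intro t
    refine ⟨R (Multiplicative.ofAdd t) 0, fun X => ?_⟩
    have hlin : (R (Multiplicative.ofAdd t)).linear X = X := by
      conv_lhs => rw [hF.decomp X]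
      rw [map_sub, map_add, map_smul, map_smul, map_smul, hfx, hfy, hn, c1 t, c2 t, c3 t]
      exact (hF.decomp X).symm
    have := affine_add (R (Multiplicative.ofAdd t)) 0 X
    rw [zero_add, hlin] at this
    rw [this, add_comm]
  · left
    have hs : 0 < a ^ 2 + k ^ 2 := by
      rcases not_and_or.1 hak with h1 | h1 <;> positivity
    have hF := h.frame (x, 0) (mk_mem_strip.2 hx)
    -- Solutions of r + sa/m - tk/m = 0: the point has (r, s, t) = (1, -ma/(a² + k²), mk/(a² + k²)),
    -- the direction (0, k, a).
    refine ⟨f (x, 0) + (-(m x * a / (a ^ 2 + k ^ 2))) • pdx f (x, 0) +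
      (m x * k / (a ^ 2 + k ^ 2)) • N (x, 0), k • pdx f (x, 0) + a • N (x, 0), ?_, fun t s => ?_⟩
    · intro hd
      apply hak
      have e1 : mink (k • pdx f (x, 0) + a • N (x, 0)) (pdx f (x, 0)) = 0 := by
        rw [hd, mink_zero_left]
      have e2 : mink (k • pdx f (x, 0) + a • N (x, 0)) (N (x, 0)) = 0 := by
        rw [hd, mink_zero_left]
      rw [mink_add_left, mink_smul_left, mink_smul_left, hF.nx, hF.xx] at e1
      rw [mink_add_left, mink_smul_left, mink_smul_left, hF.nn, mink_comm (pdx f (x, 0)), hF.nx] at e2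
      refine ⟨by linarith, ?_⟩
      have : k * m x = 0 := by simpa using e1
      exact (mul_eq_zero.1 this).resolve_right hm.ne'
    · have c1 := hconst 1 (-(m x * a / (a ^ 2 + k ^ 2))) (m x * k / (a ^ 2 + k ^ 2))
        (by field_simp; ring) t
      have c2 := hconst 0 k a (by ring) t
      rw [one_smul, one_smul] at c1
      rw [zero_smul, zero_smul, zero_add, zero_add] at c2
      rw [affine_add, affine_add, affine_add, map_smul, map_smul, map_smul, map_add, map_smul,
        map_smul, hfx, hn, hff, c1, c2]

theorem IsConf.im_eq_zero {S : StripMap} {p : ℝ} {P : ℂ} {g : ℝ → ℝ} (h : IsConf H p P g S)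
    (hH : H ≠ 0) (hR : IsEquivariantUnder S R) (hrot : HasAxis R ∨ IsTranslational R) :
    P.im = 0 := by
  obtain ⟨⟨N, hN, hP⟩, -, -⟩ := h
  obtain ⟨x, hx⟩ := hN.interval.2.2
  have h1 := (hP (x, 0) (mk_mem_strip.2 hx)).2.1
  have h2 : hxy S.f N (x, 0) = 0 := by
    rcases hrot with h | h
    · exact hN.hxy_eq_zero_of_axis hH hR h hx 0
    · exact hN.hxy_eq_zero_of_translational hR h hx 0
  rw [h2] at h1
  have : P.im / H = 0 := by linarith
  exact (div_eq_zero_iff.1 this).resolve_right hH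

theorem IsConf.isRotationalCMC {S : StripMap} {p : ℝ} {P : ℂ} {g : ℝ → ℝ} (h : IsConf H p P g S)
    (hH : H ≠ 0) (hS : IsEquivariantCMC H S) (hP0 : P.im = 0) : IsRotationalCMC H S := by
  obtain ⟨⟨N, hN, hP⟩, -, -⟩ := h
  obtain ⟨hcmc, R, hR⟩ := hS
  refine ⟨hcmc, R, hR, hN.hasAxis_or_isTranslational hH hR fun z hz => ?_⟩
  rw [(hP z hz).2.1, hP0, zero_div, neg_zero]

end CMC
end

noncomputable section

namespace CMC

open Filter Topology Metric
open scoped NNReal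

variable {J J' I K : Set ℝ} {H p p' k c ρ : ℝ} {P P' : ℂ} {v w g g' : ℝ → ℝ} {S T : StripMap}

/-! ### Positive solutions -/

/-- The positive solution which determines the metric of the surfaces belonging to `v`. -/
def posSol (P : ℂ) (v : ℝ → ℝ) (x : ℝ) : ℝ := if P = 0 then |v x| else ‖P‖ / |v x|

theorem posSol_pos {x : ℝ} (h : v x ≠ 0) : 0 < posSol P v x := by
  unfold posSol
  split_ifs with hP
  · exact abs_pos.2 h
  · exact div_pos (norm_pos_iff.2 hP) (abs_pos.2 h)

theorem posSol_posSol {x : ℝ} : posSol P (posSol P v) x = |v x| := by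
  by_cases hP : P = 0
  · simp [posSol, hP]
  · simp only [posSol, hP, if_false, abs_div, abs_norm, abs_abs]
    rw [div_div_cancel₀ (norm_ne_zero_iff.2 hP)]

theorem sq_confFactor {x : ℝ} : confFactor H P (v x) ^ 2 = (posSol P v x / H) ^ 2 := by
  unfold confFactor posSol
  split_ifs with hP
  · rw [div_pow, div_pow, sq_abs]
  · rw [div_pow, div_pow, div_pow, mul_pow, sq_abs, div_div, mul_comm (H ^ 2)]

theorem posSol_congr {v' : ℝ → ℝ} {x y : ℝ} (h : |v x| = |v' y|) : posSol P v x = posSol P v' y := by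
  simp only [posSol, h]

/-- For P ≠ 0 the factor |k|² of |P| over the factor |k| of v leaves |k|, as in the case P = 0. -/
theorem posSol_scale {v' : ℝ → ℝ} {x y : ℝ} (hk : k ≠ 0) (hP : P' = (k : ℂ) ^ 2 * P)
    (h : |v' x| = |k| * |v y|) : posSol P' v' x = |k| * posSol P v y := by
  have hn : ‖P'‖ = |k| ^ 2 * ‖P‖ := by rw [hP, norm_mul, norm_pow, Complex.norm_real, Real.norm_eq_abs]
  have hP0 : P' = 0 ↔ P = 0 := by
    rw [hP, mul_eq_zero]
    simp [hk]
  have hk' : |k| ≠ 0 := abs_ne_zero.2 hk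
  unfold posSol
  by_cases h0 : P = 0
  · rw [if_pos h0, if_pos (hP0.2 h0), h]
  · rw [if_neg h0, if_neg (mt hP0.1 h0), h, hn, sq, mul_assoc, mul_div_mul_left _ _ hk', mul_div_assoc]

theorem exists_sign (hJ : IsOpenInterval J) (hv : ContinuousOn v J) (h0 : ∀ x ∈ J, v x ≠ 0) :
    ∃ σ : ℝ, (σ = 1 ∨ σ = -1) ∧ ∀ x ∈ J, v x = σ * |v x| := by
  obtain ⟨x₀, hx₀⟩ := hJ.2.2
  have key : ∀ x ∈ J, 0 < v x * v x₀ := by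
    by_contra! h
    obtain ⟨x, hx, hx'⟩ := h
    have hc : ContinuousOn (fun x => v x * v x₀) J := hv.mul continuousOn_const
    have h1 : (0 : ℝ) ∈ Icc (v x * v x₀) (v x₀ * v x₀) := ⟨hx', mul_self_nonneg _⟩
    obtain ⟨y, hy, hy'⟩ := hJ.isPreconnected.intermediate_value hx hx₀ hc h1
    exact (mul_ne_zero (h0 y hy) (h0 x₀ hx₀)) hy'
  rcases lt_or_gt_of_ne (h0 x₀ hx₀) with h | h
  · refine ⟨-1, Or.inr rfl, fun x hx => ?_⟩
    have : v x < 0 := by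
      by_contra! h'
      nlinarith [key x hx]
    rw [abs_of_neg this]; ring
  · refine ⟨1, Or.inl rfl, fun x hx => ?_⟩
    have : 0 < v x := (pos_iff_pos_of_mul_pos (key x hx)).2 h
    rw [abs_of_pos this, one_mul]

theorem sq_sign {σ : ℝ} (h : σ = 1 ∨ σ = -1) : σ ^ 2 = 1 := by rcases h with rfl | rfl <;> norm_num

theorem Sol.signed {Q σ : ℝ} (h : Sol p Q I v w) (hσ : σ = 1 ∨ σ = -1) :
    Sol p Q I (fun x => σ * v x) (fun x => σ * w x) := by
  have := h.comp (k := 1) (ρ := σ) (by rw [sq_sign hσ]; norm_num) 0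
  simpa using this

theorem Sol.posSol (h : Sol p (‖P‖ ^ 2) J v w) (hJ : IsOpenInterval J) (h0 : ∀ x ∈ J, v x ≠ 0) :
    ∃ w', Sol p (‖P‖ ^ 2) J (posSol P v) w' := by
  obtain ⟨σ, hσ, hv⟩ := exists_sign hJ h.continuousOn h0
  have hσ2 := sq_sign hσ
  have habs : ∀ x ∈ J, |v x| = σ * v x := fun x hx => by
    rw [hv x hx, abs_mul, abs_abs, ← mul_assoc, ← sq, hσ2]
    rcases hσ with rfl | rfl <;> simp
  have h1 := h.signed hσ
  by_cases hP : P = 0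
  · exact ⟨_, h1.congr hJ.1 (fun x hx => by simp only [CMC.posSol, if_pos hP, habs x hx])
      fun _ _ => rfl⟩
  · have h2 := h1.inv (q := ‖P‖) fun x hx => by rw [← habs x hx]; exact abs_ne_zero.2 (h0 x hx)
    exact ⟨_, h2.congr hJ.1 (fun x hx => by simp only [CMC.posSol, if_neg hP, habs x hx])
      fun _ _ => rfl⟩

/-- The positive solution `g` on `J` has no extension to a positive solution on a larger
interval. -/
def Inextendable (p Q : ℝ) (J : Set ℝ) (g : ℝ → ℝ) : Prop :=
  ∀ (J' : Set ℝ) (g' w' : ℝ → ℝ), IsOpenInterval J' → Sol p Q J' g' w' → (∀ x ∈ J', 0 < g' x) →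
    J ⊆ J' → EqOn g' g J → J' = J

theorem preimage_lin_comp (k k' c c' : ℝ) (J : Set ℝ) : (fun x => k * x + c) ⁻¹'
    ((fun x => k' * x + c') ⁻¹' J) = (fun x => k' * k * x + (k' * c + c')) ⁻¹' J := by
  ext x
  simp only [mem_preimage]
  rw [show k' * (k * x + c) + c' = k' * k * x + (k' * c + c') by ring]

theorem preimage_lin_inv (hk : k ≠ 0) (c : ℝ) (J : Set ℝ) : (fun x => k⁻¹ * x + -(c / k)) ⁻¹'
    ((fun x => k * x + c) ⁻¹' J) = J := by
  ext x
  simp only [mem_preimage]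
  rw [show k * (k⁻¹ * x + -(c / k)) + c = x by field_simp; ring]

theorem preimage_lin_inv' (hk : k ≠ 0) (c : ℝ) (J : Set ℝ) : (fun x => k * x + c) ⁻¹'
    ((fun x => k⁻¹ * x + -(c / k)) ⁻¹' J) = J := by
  ext x
  simp only [mem_preimage]
  rw [show k⁻¹ * (k * x + c) + -(c / k) = x by field_simp; ring]

theorem Inextendable.comp {Q : ℝ} (h : Inextendable p Q J g) (hk : k ≠ 0) (c : ℝ) :
    Inextendable (k ^ 2 * p) (k ^ 4 * Q) ((fun x => k * x + c) ⁻¹' J)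
      (fun x => |k| * g (k * x + c)) := by
  intro J' g' w' hJ' hs hpos hsub heq
  have hk' : |k| ≠ 0 := abs_ne_zero.2 hk
  have h1 := hs.comp (k := k⁻¹) (ρ := |k|⁻¹) (by rw [inv_pow, inv_pow, sq_abs]) (-(c / k))
  rw [show k⁻¹ ^ 2 * (k ^ 2 * p) = p by field_simp, show k⁻¹ ^ 4 * (k ^ 4 * Q) = Q by field_simp] at h1
  have h2 := h _ _ _ (hJ'.preimage (inv_ne_zero hk) _) h1
    (fun x hx => mul_pos (inv_pos.2 (abs_pos.2 hk)) (hpos _ hx))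
    (by
      have := preimage_mono (f := fun x => k⁻¹ * x + -(c / k)) hsub
      rwa [preimage_lin_inv hk] at this)
    (fun x hx => by
      have hx' : k⁻¹ * x + -(c / k) ∈ (fun x => k * x + c) ⁻¹' J := by
        rw [← preimage_lin_inv hk c J] at hx; exact hx
      rw [heq hx']
      simp only
      rw [show k * (k⁻¹ * x + -(c / k)) + c = x by field_simp; ring, inv_mul_cancel_left₀ hk'])
  rw [← h2, preimage_lin_inv' hk]

theorem Sol.union {Q : ℝ} {w' : ℝ → ℝ} (h : Sol p Q J g w) (h' : Sol p Q J' g' w')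
    (hJ : IsOpenInterval J) (hJ' : IsOpenInterval J') (hK : IsOpen K) (hKne : K.Nonempty)
    (hKJ : K ⊆ J) (hKJ' : K ⊆ J') (heq : EqOn g g' K) :
    ∃ G W, Sol p Q (J ∪ J') G W ∧ EqOn G g J ∧ EqOn G g' J' := by
  classical
  obtain ⟨x₀, hx₀⟩ := hKne
  have hi := hJ.inter hJ' (hKJ hx₀) (hKJ' hx₀)
  obtain ⟨e1, e2⟩ := (h.mono inter_subset_left).eqOn hi (h'.mono inter_subset_right)
    ⟨hKJ hx₀, hKJ' hx₀⟩ (heq hx₀) ((h.mono hKJ).eqOn_deriv (h'.mono hKJ') hK heq hx₀)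
  set G : ℝ → ℝ := fun x => if x ∈ J then g x else g' x
  set W : ℝ → ℝ := fun x => if x ∈ J then w x else w' x
  have a1 : EqOn G g J := fun x hx => if_pos hx
  have a2 : EqOn W w J := fun x hx => if_pos hx
  have b1 : EqOn G g' J' := fun x hx => by
    by_cases hxJ : x ∈ J
    · rw [a1 hxJ]; exact e1 ⟨hxJ, hx⟩
    · exact if_neg hxJ
  have b2 : EqOn W w' J' := fun x hx => by
    by_cases hxJ : x ∈ J
    · rw [a2 hxJ]; exact e2 ⟨hxJ, hx⟩
    · exact if_neg hxJ
  refine ⟨G, W, ?_, a1, b1⟩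
  rintro x (hx | hx)
  · exact h.congr hJ.1 a1 a2 x hx
  · exact h'.congr hJ'.1 b1 b2 x hx

theorem IsOpenInterval.union (hJ : IsOpenInterval J) (hJ' : IsOpenInterval J') {x : ℝ} (hx : x ∈ J)
    (hx' : x ∈ J') : IsOpenInterval (J ∪ J') :=
  ⟨hJ.1.union hJ'.1, (hJ.isPreconnected.union x hx hx' hJ'.isPreconnected).ordConnected,
    ⟨x, Or.inl hx⟩⟩

/-- Inextendable positive solutions are determined by their germs. -/
theorem Inextendable.eq {Q : ℝ} {w' : ℝ → ℝ} (hi : Inextendable p Q J g) (hi' : Inextendable p Q J' g')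
    (h : Sol p Q J g w) (h' : Sol p Q J' g' w') (hpos : ∀ x ∈ J, 0 < g x)
    (hpos' : ∀ x ∈ J', 0 < g' x) (hJ : IsOpenInterval J) (hJ' : IsOpenInterval J') (hK : IsOpen K)
    (hKne : K.Nonempty) (hKJ : K ⊆ J) (hKJ' : K ⊆ J') (heq : EqOn g g' K) :
    J = J' ∧ EqOn g g' J := by
  obtain ⟨G, W, hG, e1, e2⟩ := h.union h' hJ hJ' hK hKne hKJ hKJ' heq
  obtain ⟨x₀, hx₀⟩ := hKne
  have hu := hJ.union hJ' (hKJ hx₀) (hKJ' hx₀)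
  have hp : ∀ x ∈ J ∪ J', 0 < G x := by
    rintro x (hx | hx)
    · rw [e1 hx]; exact hpos x hx
    · rw [e2 hx]; exact hpos' x hx
  have h1 := hi _ G W hu hG hp subset_union_left e1
  have h2 := hi' _ G W hu hG hp subset_union_right e2
  have h3 := h1.symm.trans h2
  refine ⟨h3, fun x hx => ?_⟩
  rw [← e1 hx, ← e2 (h3 ▸ hx)]

/-- The set on which a solution does not vanish. -/
def nonvanishing (I : Set ℝ) (v : ℝ → ℝ) : Set ℝ := {x ∈ I | v x ≠ 0}

theorem isOpen_nonvanishing (hI : IsOpen I) (hv : ContinuousOn v I) : IsOpen (nonvanishing I v) :=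
  hv.isOpen_inter_preimage hI isOpen_compl_singleton

theorem eq_posSol_signed (hJ : IsOpenInterval J) (hv : ContinuousOn v J) (h0 : ∀ x ∈ J, v x ≠ 0)
    (hg : ∀ x ∈ J, g x = posSol P v x) :
    ∃ σ : ℝ, (σ = 1 ∨ σ = -1) ∧ ∀ x ∈ J, v x = σ * posSol P g x := by
  obtain ⟨σ, hσ, h⟩ := exists_sign hJ hv h0
  refine ⟨σ, hσ, fun x hx => ?_⟩
  rw [posSol_congr (v' := posSol P v) (y := x) (by rw [hg x hx]), posSol_posSol]
  exact h x hx

/-- The positive solution of a component of the domain of a maximal solution is inextendable. -/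
theorem MaxSol.inextendable (h : MaxSol p (‖P‖ ^ 2) I v w) {u : ℝ} (hu : u ∈ nonvanishing I v) :
    Inextendable p (‖P‖ ^ 2) (connectedComponentIn (nonvanishing I v) u) (posSol P v) := by
  have hsub := connectedComponentIn_subset (nonvanishing I v) u
  have hUo := isOpenInterval_component (isOpen_nonvanishing h.1.1 h.2.1.continuousOn) hu
  have huU := mem_connectedComponentIn hu
  intro J' g' w' hJ' hs hpos hJJ' heq
  refine Subset.antisymm ?_ hJJ'
  -- Inverting the extension and restoring the sign of v gives a solution that continues v. By
  -- maximality it lies inside I, and as it has no zeros it stays in the component.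
  obtain ⟨w₁, hs₁⟩ := hs.posSol hJ' fun x hx => (hpos x hx).ne'
  obtain ⟨σ, hσ, hσv⟩ := eq_posSol_signed (P := P) hUo
    (h.2.1.continuousOn.mono fun x hx => (hsub hx).1) (fun x hx => (hsub hx).2) heq
  have hs₂ := hs₁.signed hσ
  have hw := (h.2.1.mono fun x hx => (hsub hx).1).eqOn_deriv (hs₂.mono hJJ') hUo.1 hσv
  obtain ⟨h1, h2, -⟩ := h.eqOn hJ' hs₂ hu.1 (hJJ' huU) (hσv u huU).symm (hw huU).symm
  refine hJ'.isPreconnected.subset_connectedComponentIn (hJJ' huU) fun x hx => ⟨h1 hx, ?_⟩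
  rw [← h2 hx]
  refine mul_ne_zero ?_ (posSol_pos (hpos x hx).ne').ne'
  rcases hσ with rfl | rfl <;> norm_num

theorem posSol_posSol_of_pos {x : ℝ} (h : 0 < g x) (hv : v x = posSol P g x) : posSol P v x = g x := by
  rw [posSol_congr (v' := posSol P g) (y := x) (by rw [hv]), posSol_posSol, abs_of_pos h]

/-- Every positive solution extends to an inextendable one. -/
theorem exists_inextendable (hJ : IsOpenInterval J) (hg : Sol p (‖P‖ ^ 2) J g w)
    (hpos : ∀ x ∈ J, 0 < g x) : ∃ J' g' w', IsOpenInterval J' ∧ Sol p (‖P‖ ^ 2) J' g' w' ∧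
      (∀ x ∈ J', 0 < g' x) ∧ J ⊆ J' ∧ EqOn g' g J ∧ Inextendable p (‖P‖ ^ 2) J' g' := by
  obtain ⟨w₁, h₁⟩ := hg.posSol hJ fun x hx => (hpos x hx).ne'
  obtain ⟨I, v, w, hmax, hJI, hv⟩ := exists_maxSol hJ h₁
  obtain ⟨u, hu⟩ := hJ.2.2
  have hnv : J ⊆ nonvanishing I v := fun x hx => ⟨hJI hx, by
    rw [hv hx]; exact (posSol_pos (hpos x hx).ne').ne'⟩
  have hsub := connectedComponentIn_subset (nonvanishing I v) u
  have hUo := isOpenInterval_component (isOpen_nonvanishing hmax.1.1 hmax.2.1.continuousOn) (hnv hu)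
  obtain ⟨w₂, h₂⟩ := (hmax.2.1.mono fun x hx => (hsub hx).1).posSol hUo fun x hx => (hsub hx).2
  exact ⟨_, _, w₂, hUo, h₂, fun x hx => posSol_pos (hsub hx).2,
    hJ.isPreconnected.subset_connectedComponentIn hu hnv,
    fun x hx => posSol_posSol_of_pos (hpos x hx) (hv hx), hmax.inextendable (hnv hu)⟩

/-! ### Surfaces belonging to a parameter -/

/-- Only the square of the conformal factor enters, so v may be replaced by the positive solution
attached to it. -/
theorem belongsTo_iff (hH : H ≠ 0) {s : ℝ × ℂ × ℝ} (hS : IsSpacelikeImmersion S) :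
    BelongsTo H s S ↔ ∃ I v w, IsOpenInterval I ∧ (0 : ℝ) ∈ I ∧ Sol s.1 (‖s.2.1‖ ^ 2) I v w ∧
      v 0 = s.2.2 ∧ S.J ⊆ I ∧ (∀ x ∈ S.J, v x ≠ 0) ∧ IsConf H s.1 s.2.1 (posSol s.2.1 v) S := by
  constructor
  · rintro ⟨I, v, N, ⟨hI, h0, ⟨w, hsol⟩, hv0⟩, hJI, hne, hN, hdata⟩
    have hsol' : Sol s.1 (‖s.2.1‖ ^ 2) I v w := hsol
    have hframe : ∀ z ∈ strip S.J, IsFrame ((posSol s.2.1 v z.1 / H) ^ 2) (pdx S.f z) (pdy S.f z)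
        (N z) := fun z hz => by
      obtain ⟨d1, d2, d3, -, -⟩ := hdata z hz
      obtain ⟨n1, n2, n3⟩ := hN.2 z hz
      rw [sq_confFactor] at d1 d2
      exact ⟨sq_pos_iff.2 (div_ne_zero (posSol_pos (hne _ hz.1)).ne' hH), d1, d2, d3, n1, n2, n3⟩
    have hconf : ConfSurf H S.J S.f N (fun x => (posSol s.2.1 v x / H) ^ 2) :=
      ⟨hS.1, hS.2.1, hframe, fun z hz => (meanCurvature_eq_iff
        (m := fun x => (posSol s.2.1 v x / H) ^ 2) (hframe z hz)).1 (hdata z hz).2.2.2.1⟩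
    exact ⟨I, v, w, hI, h0, hsol', hv0, hJI, hne, ⟨N, hconf, fun z hz =>
      (hopf_eq_iff (m := fun x => (posSol s.2.1 v x / H) ^ 2) hH (hconf.mean z hz)).1
        (hdata z hz).2.2.2.2⟩, fun x hx => posSol_pos (hne x hx), (hsol'.mono hJI).posSol hS.1 hne⟩
  · rintro ⟨I, v, w, hI, h0, hsol, hv0, hJI, hne, ⟨N, hconf, hP⟩, -, -⟩
    refine ⟨I, v, N, ⟨hI, h0, ⟨w, hsol⟩, hv0⟩, hJI, hne, hconf.isUnitNormal hH, fun z hz => ?_⟩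
    have hF := hconf.frame z hz
    rw [sq_confFactor]
    exact ⟨hF.xx, hF.yy, hF.xy, (meanCurvature_eq_iff
      (m := fun x => (posSol s.2.1 v x / H) ^ 2) hF).2 (hconf.mean z hz),
      (hopf_eq_iff (m := fun x => (posSol s.2.1 v x / H) ^ 2) hH (hconf.mean z hz)).2 (hP z hz)⟩

/-! ### Maximal surfaces -/

theorem IsConf.isOpenInterval (h : IsConf H p P g S) : IsOpenInterval S.J := by
  obtain ⟨⟨N, hN, -⟩, -⟩ := h
  exact hN.interval

theorem IsConf.restrict (h : IsConf H p P g S) (hJ : IsOpenInterval J) (hs : J ⊆ S.J) :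
    IsConf H p P g ⟨J, S.f⟩ := by
  obtain ⟨⟨N, hN, hP⟩, hpos, w, hw⟩ := h
  exact ⟨⟨N, hN.mono hJ hs, fun z hz => hP z ⟨hs hz.1, trivial⟩⟩, fun x hx => hpos x (hs hx), w,
    hw.mono hs⟩

theorem Congruent.restrict (h : Congruent S T) (hS : IsOpenInterval S.J) (hJ : J ⊆ T.J)
    (hJo : IsOpenInterval J) : ∃ K ⊆ S.J, IsOpenInterval K ∧ Congruent ⟨K, S.f⟩ ⟨J, T.f⟩ ∧
      (K = S.J → J = T.J) := by
  obtain ⟨A, a, b, k, hA, hc, he⟩ := (congruent_iff hS.1).1 h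
  have hT := hc.isOpenInterval hS
  set K := S.J ∩ a ⁻¹' J
  have hbij : BijOn a K J := ⟨fun x hx => hx.2, hc.bij.injOn.mono inter_subset_left, fun y hy => by
    obtain ⟨x, hx, rfl⟩ := hc.bij.surjOn (hJ hy)
    exact ⟨x, ⟨hx, hy⟩, rfl⟩⟩
  have hKo : IsOpen K := hc.smooth_a.continuousOn.isOpen_inter_preimage hS.1 hJo.1
  have hcK : IsChg K J a b k := ⟨hc.ne, hbij, hc.smooth_a.mono inter_subset_left,
    hc.smooth_b.mono inter_subset_left, fun x hx => hc.pos x hx.1⟩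
  have hcong : Congruent ⟨K, S.f⟩ ⟨J, T.f⟩ := (congruent_iff (S := ⟨K, S.f⟩) hKo).2
    ⟨A, a, b, k, hA, hcK, fun z hz => he z ⟨hz.1.1, trivial⟩⟩
  refine ⟨K, inter_subset_left, ?_, hcong, fun hK => ?_⟩
  · obtain ⟨a', b', hinv, -⟩ := hcK.exists_inverse hKo
    exact hinv.isOpenInterval hJo
  · rw [← hbij.image_eq, hK, hc.bij.image_eq]

theorem Congruent.data' (h : Congruent S T) (hH : H ≠ 0) (hS : IsConf H p P g S)
    (hT : IsConf H p' P' g' T) : ∃ k c : ℝ, k ≠ 0 ∧ S.J = (fun x => k * x + c) ⁻¹' T.J ∧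
      P = (k : ℂ) ^ 2 * P' ∧ p = k ^ 2 * p' ∧ ∀ x ∈ S.J, g x = |k| * g' (k * x + c) := by
  obtain ⟨k, c, hk, hJ, hP, hg⟩ := h.data hH hS hT
  have hSo := hS.isOpenInterval
  obtain ⟨-, hpos, w, hw⟩ := hS
  obtain ⟨-, -, w', hw'⟩ := hT
  have h1 := hw'.comp (k := k) (ρ := |k|) (sq_abs k) c
  rw [← hJ] at h1
  obtain ⟨x, hx⟩ := hSo.2.2
  exact ⟨k, c, hk, hJ, hP, (hw.param_unique h1 hSo.1 hg hx (hpos x hx).ne').1, hg⟩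

theorem IsMaximal.of_congruent (h : IsMaximal H S) (hST : Congruent S T)
    (hT : IsEquivariantCMC H T) : IsMaximal H T :=
  ⟨hT, fun U hU J' hJ' => h.2 U hU J' ⟨hJ'.1, hST.trans hJ'.2 h.1.1.1.1⟩⟩

/-- A given extension is first put into conformal coordinates. The comparison of data then makes its
solution, pulled back by an affine map, a positive extension of g, which must be trivial. -/
theorem IsConf.isMaximal (h : IsConf H p P g S) (hH : H ≠ 0) (hS : IsEquivariantCMC H S)
    (hi : Inextendable p (‖P‖ ^ 2) S.J g) : IsMaximal H S := by
  have hSo := h.isOpenInterval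
  refine ⟨hS, fun T hT J' ⟨hJ', hcong⟩ => ?_⟩
  obtain ⟨hTcmc, R, hR⟩ := hT
  obtain ⟨U, hUT, hU, -, p', P', g', hUconf⟩ := exists_isConf hH hTcmc hR
  have hUo := hUconf.isOpenInterval
  have hJo : IsOpenInterval J' := hcong.isOpenInterval hSo
  obtain ⟨K, hK, hKo, hKJ, hKeq⟩ := hUT.restrict hUo hJ' hJo
  have hSK : Congruent S ⟨K, U.f⟩ := hcong.trans (hKJ.symm hKo) hSo
  obtain ⟨k, c, hk, hSJ, hP, hp, hg⟩ := hSK.data' hH h (hUconf.restrict hKo hK)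
  obtain ⟨-, hpos', w', hw'⟩ := hUconf
  have h1 := hw'.comp (k := k) (ρ := |k|) (sq_abs k) c
  rw [← hp, ← norm_sq_scale hP] at h1
  have h2 := hi _ _ _ (hUo.preimage hk c) h1
    (fun x hx => mul_pos (abs_pos.2 hk) (hpos' _ hx))
    (by rw [hSJ]; exact preimage_mono hK) (fun x hx => (hg x hx).symm)
  refine hKeq ?_
  rw [← preimage_lin_inv hk c K, ← preimage_lin_inv hk c U.J, h2, hSJ]

/-- A larger positive solution is realized by a surface, and rigidity makes that surface an
extension of S. -/
theorem IsConf.inextendable (h : IsConf H p P g S) (hH : H ≠ 0) (hS : IsMaximal H S) :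
    Inextendable p (‖P‖ ^ 2) S.J g := by
  have hSo := h.isOpenInterval
  intro J' g' w' hJ' hs hpos hsub heq
  obtain ⟨T, hTJ, hT, hTconf⟩ := exists_surface_of_sol hH hJ' hs hpos
  have hr := hTconf.restrict hSo (by rw [hTJ]; exact hsub)
  have hc : Congruent S ⟨S.J, T.f⟩ := h.congruent hH hr (k := 1) (c := 0) (ρ := 1) one_ne_zero
    (by simp) (by simp) rfl fun x hx => by simp [heq hx]
  rw [← hTJ]
  exact (hS.2 T hT S.J ⟨by rw [hTJ]; exact hsub, hc⟩).symm

end CMC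
end

noncomputable section

namespace CMC

open Filter Topology Metric
open scoped NNReal

variable {J J' I K : Set ℝ} {H p p' k c ρ : ℝ} {P P' : ℂ} {v w g g' : ℝ → ℝ} {S S' T : StripMap}

/-! ### Components of the domain of a maximal solution -/

/-- Maximal solutions are symmetric with respect to the midpoint of two zeros. -/
theorem MaxSol.symmetric {Q : ℝ} (h : MaxSol p Q I v w) {a b : ℝ} (ha : a ∈ I) (hb : b ∈ I)
    (hva : v a = 0) (hvb : v b = 0) :
    ∀ x ∈ I, -1 * x + (a + b) ∈ I ∧ |v x| = |v (-1 * x + (a + b))| := by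
  have hw : w b ^ 2 = w a ^ 2 := by
    rw [(h.2.1 a ha).2.2, (h.2.1 b hb).2.2, hva, hvb]
  obtain ⟨σ, hσ, hσw⟩ : ∃ σ : ℝ, (σ = 1 ∨ σ = -1) ∧ σ * -1 * w a = w b := by
    rcases sq_eq_sq_iff_eq_or_eq_neg.1 hw with h | h
    · exact ⟨-1, Or.inr rfl, by rw [h]; ring⟩
    · exact ⟨1, Or.inl rfl, by rw [h]; ring⟩
  -- The function σ v(a + b - x) has the same value and derivative at b as v: both vanish there, and
  -- σ is chosen to match the slopes. The case a = b is the oddness of v about a zero.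
  have hV := h.comp (k := -1) (ρ := σ) (by norm_num) (by rw [sq_sign hσ]; norm_num) (a + b)
  rw [show (-1 : ℝ) ^ 2 * p = p by ring, show (-1 : ℝ) ^ 4 * Q = Q by ring] at hV
  have hba : -1 * b + (a + b) = a := by ring
  obtain ⟨h1, h2, -⟩ := h.eqOn hV.1 hV.2.1 hb (by rw [mem_preimage, hba]; exact ha)
    (by rw [hba, hva, hvb, mul_zero]) (by rw [hba, hσw])
  have hinv : ∀ x, -1 * (-1 * x + (a + b)) + (a + b) = x := fun x => by ring
  intro x hx
  have hx' : -1 * x + (a + b) ∈ (fun x => -1 * x + (a + b)) ⁻¹' I := by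
    rw [mem_preimage, hinv]; exact hx
  refine ⟨h1 hx', ?_⟩
  rw [← h2 hx']
  simp only
  rw [hinv, abs_mul]
  rcases hσ with rfl | rfl <;> simp

theorem MaxSol.exists_reflection {Q : ℝ} (h : MaxSol p Q I v w) {u u' : ℝ}
    (hu : u ∈ nonvanishing I v) (hu' : u' ∈ nonvanishing I v) (hlt : u < u')
    (hne : connectedComponentIn (nonvanishing I v) u ≠ connectedComponentIn (nonvanishing I v) u') :
    ∃ e : ℝ, connectedComponentIn (nonvanishing I v) u =
      (fun x => -1 * x + e) ⁻¹' connectedComponentIn (nonvanishing I v) u' ∧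
      ∀ x ∈ I, |v x| = |v (-1 * x + e)| := by
  have hc := h.2.1.continuousOn
  have hIcc : Icc u u' ⊆ I := h.1.2.1.out hu.1 hu'.1
  have hZ : IsCompact (Icc u u' ∩ v ⁻¹' {0}) :=
    isCompact_Icc.of_isClosed_subset ((hc.mono hIcc).preimage_isClosed_of_isClosed isClosed_Icc
      isClosed_singleton) inter_subset_left
  have hZne : (Icc u u' ∩ v ⁻¹' {0}).Nonempty := by
    by_contra hemp
    rw [not_nonempty_iff_eq_empty] at hemp
    have hsub : Icc u u' ⊆ nonvanishing I v := fun x hx => ⟨hIcc hx, fun h0 => by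
      have : x ∈ Icc u u' ∩ v ⁻¹' {0} := ⟨hx, h0⟩
      rw [hemp] at this
      exact this⟩
    exact hne (connectedComponentIn_eq (isPreconnected_Icc.subset_connectedComponentIn
      (left_mem_Icc.2 hlt.le) hsub (right_mem_Icc.2 hlt.le)))
  -- With b the first zero after u and a the last zero before u', the reflection in (a + b)/2 maps
  -- the right end b of one component to the left end a of the other.
  obtain ⟨b, ⟨hb, hvb⟩, hbmin⟩ := hZ.exists_isLeast hZne
  obtain ⟨a, ⟨ha, hva⟩, hamax⟩ := hZ.exists_isGreatest hZne
  change v b = 0 at hvb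
  change v a = 0 at hva
  have hub : u < b := lt_of_le_of_ne hb.1 fun h => hu.2 (h ▸ hvb)
  have hau' : a < u' := lt_of_le_of_ne ha.2 fun h => hu'.2 (h ▸ hva)
  have hsym := h.symmetric (hIcc ha) (hIcc hb) hva hvb
  have hsymW : ∀ x ∈ nonvanishing I v, -1 * x + (a + b) ∈ nonvanishing I v := fun x hx =>
    ⟨(hsym x hx.1).1, by
      have := (hsym x hx.1).2
      exact abs_ne_zero.1 (this ▸ abs_ne_zero.2 hx.2)⟩
  have hinv : ∀ x, -1 * (-1 * x + (a + b)) + (a + b) = x := fun x => by ring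
  have h1 : Ico u b ⊆ connectedComponentIn (nonvanishing I v) u :=
    isPreconnected_Ico.subset_connectedComponentIn ⟨le_rfl, hub⟩ fun x hx =>
      ⟨hIcc ⟨hx.1, hx.2.le.trans hb.2⟩, fun h0 => absurd (hbmin ⟨⟨hx.1, hx.2.le.trans hb.2⟩, h0⟩)
        (not_le.2 hx.2)⟩
  have h2 : Ioc a u' ⊆ connectedComponentIn (nonvanishing I v) u' :=
    isPreconnected_Ioc.subset_connectedComponentIn ⟨hau', le_rfl⟩ fun x hx =>
      ⟨hIcc ⟨ha.1.trans hx.1.le, hx.2⟩, fun h0 => absurd (hamax ⟨⟨ha.1.trans hx.1.le, hx.2⟩, h0⟩)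
        (not_le.2 hx.1)⟩
  -- Small enough that b - t lies in the first component and its mirror image a + t in the second.
  set t := min (b - u) (u' - a)
  have ht : 0 < t := lt_min (by linarith) (by linarith)
  have ht1 : t ≤ b - u := min_le_left _ _
  have ht2 : t ≤ u' - a := min_le_right _ _
  have hx : b - t ∈ connectedComponentIn (nonvanishing I v) u := h1 ⟨by linarith, by linarith⟩
  have hx' : -1 * (b - t) + (a + b) ∈ connectedComponentIn (nonvanishing I v) u' :=
    h2 ⟨by linarith, by linarith⟩
  have hWo := isOpen_nonvanishing h.1.1 hc
  have key : ∀ y y', y ∈ nonvanishing I v → y' ∈ nonvanishing I v → ∀ x,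
      x ∈ connectedComponentIn (nonvanishing I v) y →
      -1 * x + (a + b) ∈ connectedComponentIn (nonvanishing I v) y' →
      (fun x => -1 * x + (a + b)) ⁻¹' connectedComponentIn (nonvanishing I v) y' ⊆
        connectedComponentIn (nonvanishing I v) y := fun y y' hy hy' x hx hx' => by
    rw [connectedComponentIn_eq hx]
    refine ((isOpenInterval_component hWo hy').preimage (by norm_num)
      _).isPreconnected.subset_connectedComponentIn hx' fun s hs => ?_
    rw [← hinv s]
    exact hsymW _ (connectedComponentIn_subset _ _ hs)
  refine ⟨a + b, Subset.antisymm (fun s hs => ?_) (key u u' hu hu' _ hx hx'),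
    fun x hx => (hsym x hx).2⟩
  refine key u' u hu' hu _ hx' (by rw [hinv]; exact hx) ?_
  rw [mem_preimage, hinv]
  exact hs

/-- Any two components are related by a symmetry of the solution. -/
theorem MaxSol.exists_symmetry {Q : ℝ} (h : MaxSol p Q I v w) {u u' : ℝ}
    (hu : u ∈ nonvanishing I v) (hu' : u' ∈ nonvanishing I v) :
    ∃ δ e : ℝ, (δ = 1 ∨ δ = -1) ∧ connectedComponentIn (nonvanishing I v) u =
      (fun x => δ * x + e) ⁻¹' connectedComponentIn (nonvanishing I v) u' ∧
      ∀ x ∈ I, |v x| = |v (δ * x + e)| := by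
  by_cases heq : connectedComponentIn (nonvanishing I v) u = connectedComponentIn (nonvanishing I v) u'
  · exact ⟨1, 0, Or.inl rfl, by simp [heq], by simp⟩
  · rcases lt_trichotomy u u' with hlt | rfl | hlt
    · obtain ⟨e, h1, h2⟩ := h.exists_reflection hu hu' hlt heq
      exact ⟨-1, e, Or.inr rfl, h1, h2⟩
    · exact absurd rfl heq
    · obtain ⟨e, h1, h2⟩ := h.exists_reflection hu' hu hlt (Ne.symm heq)
      refine ⟨-1, e, Or.inr rfl, ?_, h2⟩
      rw [h1, preimage_lin_comp]
      ext x
      simp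

theorem Inextendable.congr {Q : ℝ} (h : Inextendable p Q J g) (hg : EqOn g' g J) :
    Inextendable p Q J g' := fun J' g₁ w₁ hJ' hs hpos hsub heq =>
  h J' g₁ w₁ hJ' hs hpos hsub (heq.trans hg)

/-- The component carries a positive solution extending the given one, so inextendability forces
equality. -/
theorem MaxSol.eq_component (h : MaxSol p (‖P‖ ^ 2) I v w) (hJ : IsOpenInterval J)
    (hsub : J ⊆ nonvanishing I v) (hi : Inextendable p (‖P‖ ^ 2) J (posSol P v)) {u : ℝ}
    (hu : u ∈ J) : J = connectedComponentIn (nonvanishing I v) u := by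
  have hUsub := connectedComponentIn_subset (nonvanishing I v) u
  have hUo := isOpenInterval_component (isOpen_nonvanishing h.1.1 h.2.1.continuousOn) (hsub hu)
  obtain ⟨w', hw'⟩ := (h.2.1.mono fun x hx => (hUsub hx).1).posSol hUo fun x hx => (hUsub hx).2
  exact (hi _ _ _ hUo hw' (fun x hx => posSol_pos (hUsub hx).2)
    (hJ.isPreconnected.subset_connectedComponentIn hu hsub) fun _ _ => rfl).symm

/-! ### Surfaces and parameters -/

/-- Maximal surfaces correspond to components of the domain of the maximal solution. -/
theorem BelongsTo.exists_component {s : ℝ × ℂ × ℝ} (hH : H ≠ 0) (hS : IsMaximal H S)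
    (hb : BelongsTo H s S) (hv : MaxSol p (‖P‖ ^ 2) I v w) (hk : k ≠ 0) (hc : c ∈ I)
    (hρ : ρ ^ 2 = k ^ 2) (h1 : s.1 = k ^ 2 * p) (h2 : s.2.1 = (k : ℂ) ^ 2 * P)
    (h3 : s.2.2 = ρ * v c) :
    ∃ l e u g, l ^ 2 = k ^ 2 ∧ u ∈ nonvanishing I v ∧
      S.J = (fun x => l * x + e) ⁻¹' connectedComponentIn (nonvanishing I v) u ∧
      IsConf H s.1 s.2.1 g S ∧ ∀ x ∈ S.J, g x = |k| * posSol P v (l * x + e) := by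
  obtain ⟨I₁, v₁, w₁, hI₁, h0, hs₁, hv₁, hJI, hne, hconf⟩ := (belongsTo_iff hH hS.1.1.1).1 hb
  have hV := hv.comp hk hρ c
  rw [← h1, ← norm_sq_scale h2] at hV
  obtain ⟨ε, hε, hrefl⟩ := hV.exists_reflect (by rw [mem_preimage, mul_zero, zero_add]; exact hc) hI₁
    hs₁ h0 (by rw [hv₁, h3, mul_zero, zero_add])
  have hε2 := sq_sign hε
  -- The solution of S is ρ v(kx + c), possibly run backwards; the sign ε is absorbed into the
  -- scaling factor.
  obtain ⟨l, hldef⟩ : ∃ l, l = k * ε := ⟨_, rfl⟩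
  have hl : l ^ 2 = k ^ 2 := by rw [hldef, mul_pow, hε2, mul_one]
  have hl0 : l ≠ 0 := fun h0 => by rw [h0] at hl; exact hk (by simpa using hl.symm)
  have hlabs : |l| = |k| := (sq_eq_sq_iff_abs_eq_abs _ _).1 hl
  have hρabs : |ρ| = |k| := (sq_eq_sq_iff_abs_eq_abs _ _).1 hρ
  have hmem : ∀ x ∈ S.J, l * x + c ∈ nonvanishing I v ∧
      |v₁ x| = |k| * |v (l * x + c)| := fun x hx => by
    obtain ⟨m1, m2⟩ := hrefl x (hJI hx)
    rw [mem_preimage, ← mul_assoc, ← hldef] at m1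
    rw [← mul_assoc, ← hldef] at m2
    have h4 := hne x hx
    rw [m2] at h4
    exact ⟨⟨m1, (mul_ne_zero_iff.1 h4).2⟩, by rw [m2, abs_mul, hρabs]⟩
  have hg : ∀ x ∈ S.J, posSol s.2.1 v₁ x = |k| * posSol P v (l * x + c) := fun x hx =>
    posSol_scale hk h2 (hmem x hx).2
  have hSo := hconf.isOpenInterval
  have hi := (hconf.inextendable hH hS).comp (inv_ne_zero hl0) (-(c / l))
  have hinv : ∀ x, l * (l⁻¹ * x + -(c / l)) + c = x := fun x => by
    field_simp
    ring
  rw [h1, norm_sq_scale h2, ← hl, show (l⁻¹) ^ 2 * (l ^ 2 * p) = p by field_simp,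
    show k ^ 4 = l ^ 4 by rw [show k ^ 4 = (k ^ 2) ^ 2 by ring, ← hl]; ring,
    show (l⁻¹) ^ 4 * (l ^ 4 * ‖P‖ ^ 2) = ‖P‖ ^ 2 by field_simp] at hi
  set U := (fun x => l⁻¹ * x + -(c / l)) ⁻¹' S.J with hU
  have hi' : Inextendable p (‖P‖ ^ 2) U (posSol P v) := hi.congr fun x hx => by
    have := hg _ hx
    rw [hinv] at this
    simp only
    rw [this, abs_inv, hlabs, inv_mul_cancel_left₀ (abs_ne_zero.2 hk)]
  have hUo : IsOpenInterval U := hSo.preimage (inv_ne_zero hl0) _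
  have hUsub : U ⊆ nonvanishing I v := fun x hx => by
    have := (hmem _ hx).1
    rwa [hinv] at this
  obtain ⟨u, hu⟩ := hUo.2.2
  refine ⟨l, c, u, _, hl, hUsub hu, ?_, hconf, hg⟩
  rw [← hv.eq_component hUo hUsub hi' hu, hU, preimage_lin_inv' hl0]

/-- Both surfaces live over components of one maximal solution. A symmetry of |v| carries one
component to the other, and as k² is insensitive to signs the resulting affine map is a congruence.
-/
theorem congruent_of_orb {v₀ v₀' : ℝ} (hH : H ≠ 0) (hS : IsMaximal H S) (hS' : IsMaximal H S')
    (hb : BelongsTo H (p, P, v₀) S) (hb' : BelongsTo H (p', P', v₀') S') (hk : k ≠ 0)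
    (horb : Orb k p (‖P‖ ^ 2) v₀ p' v₀') (hP : P' = (k : ℂ) ^ 2 * P) : Congruent S S' := by
  obtain ⟨I₀, v₀', w₀, c, ρ, hI₀, h0, hc, hs, hv0, hρ, hp, hv0'⟩ := horb
  obtain ⟨I, v, w, hmax, hsub, heq⟩ := exists_maxSol hI₀ hs
  rw [← heq h0] at hv0
  rw [← heq hc] at hv0'
  obtain ⟨l₁, e₁, u₁, g₁, hl₁, hu₁, hJ₁, hc₁, hg₁⟩ := hb.exists_component hH hS hmax (k := 1)
    (c := 0) (ρ := 1) one_ne_zero (hsub h0) rfl (by simp) (by simp) (by simp [hv0])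
  obtain ⟨l₂, e₂, u₂, g₂, hl₂, hu₂, hJ₂, hc₂, hg₂⟩ := hb'.exists_component hH hS' hmax hk
    (hsub hc) hρ hp hP hv0'
  obtain ⟨δ, e, hδ, hcomp, hve⟩ := hmax.exists_symmetry hu₁ hu₂
  have hl₂0 : l₂ ≠ 0 := fun h0 => by rw [h0] at hl₂; exact hk (by simpa using hl₂.symm)
  have hδ2 := sq_sign hδ
  have hk' : |k| ≠ 0 := abs_ne_zero.2 hk
  have hK : (l₂⁻¹ * (δ * l₁)) ^ 2 = (k ^ 2)⁻¹ := by
    rw [mul_pow, mul_pow, hδ2, hl₁, inv_pow, hl₂]; ring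
  -- The affine map is obtained by solving l₂X + e₂ = δ(l₁x + e₁) + e for X.
  refine hc₁.congruent hH hc₂ (k := l₂⁻¹ * (δ * l₁)) (c := l₂⁻¹ * (δ * e₁ + e) + -(e₂ / l₂))
    (ρ := |k|⁻¹) ?_ ?_ ?_ ?_ fun x hx => ?_
  · intro h0
    rw [h0] at hK
    have : (k ^ 2)⁻¹ ≠ 0 := by positivity
    exact this (by rw [← hK]; ring)
  · rw [hJ₁, hcomp, hJ₂, preimage_lin_comp, preimage_lin_comp, mul_inv_cancel_left₀ hl₂0,
      show l₂ * (l₂⁻¹ * (δ * e₁ + e) + -(e₂ / l₂)) + e₂ = δ * e₁ + e by field_simp; ring]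
  · have : ((l₂⁻¹ * (δ * l₁) : ℝ) : ℂ) ^ 2 = ((k : ℂ) ^ 2)⁻¹ := by
      rw [← Complex.ofReal_pow, hK]
      push_cast
      rfl
    simp only
    rw [this, hP, inv_mul_cancel_left₀ (pow_ne_zero 2 (Complex.ofReal_ne_zero.2 hk))]
  · rw [hK, inv_pow, sq_abs]
  · have hxI : l₁ * x + e₁ ∈ connectedComponentIn (nonvanishing I v) u₁ := by
      rw [hJ₁] at hx; exact hx
    have hxI' := (connectedComponentIn_subset _ _ hxI).1
    have harg : l₂ * (l₂⁻¹ * (δ * l₁) * x + (l₂⁻¹ * (δ * e₁ + e) + -(e₂ / l₂))) + e₂ =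
        δ * (l₁ * x + e₁) + e := by
      field_simp
      ring
    have hx₂ : l₂⁻¹ * (δ * l₁) * x + (l₂⁻¹ * (δ * e₁ + e) + -(e₂ / l₂)) ∈ S'.J := by
      rw [hJ₂, mem_preimage, harg]
      rw [hcomp] at hxI
      exact hxI
    rw [hg₁ x hx, hg₂ _ hx₂, harg, abs_one, one_mul, inv_mul_cancel_left₀ hk']
    exact posSol_congr (hve _ hxI')

/-- The conformal factors, hence |v₁| and |v₂|, are related by the affine coordinate change. Signs
are constant on the strips, and uniqueness propagates the relation from the strip of S' to the point
0, which need not belong to it. -/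
theorem orb_of_congruent {v₀ v₀' : ℝ} (hH : H ≠ 0) (hS : IsSpacelikeImmersion S)
    (hS' : IsSpacelikeImmersion S') (hb : BelongsTo H (p, P, v₀) S)
    (hb' : BelongsTo H (p', P', v₀') S') (h : Congruent S S') :
    ∃ k > 0, Orb k p (‖P‖ ^ 2) v₀ p' v₀' ∧ P' = (k : ℂ) ^ 2 * P := by
  obtain ⟨I₁, v₁, w₁, hI₁, h0, hs₁, hv₁, hJI₁, hne₁, hconf₁⟩ := (belongsTo_iff hH hS).1 hb
  obtain ⟨I₂, v₂, w₂, hI₂, h0', hs₂, hv₂, hJI₂, hne₂, hconf₂⟩ := (belongsTo_iff hH hS').1 hb'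
  simp only at hs₁ hv₁ hconf₁ hs₂ hv₂ hconf₂
  obtain ⟨k, c, hk, hJ, hP, hp, hg⟩ := (h.symm hS.1).data' hH hconf₂ hconf₁
  obtain ⟨I, v, w, hmax, hsub, heq⟩ := exists_maxSol hI₁ hs₁
  have habs : ∀ x ∈ S'.J, |v₂ x| = |k| * |v₁ (k * x + c)| := fun x hx => by
    rw [← posSol_posSol (P := P') (v := v₂), ← posSol_posSol (P := P) (v := v₁)]
    refine posSol_scale hk hP ?_
    rw [hg x hx, abs_mul, abs_abs]
  obtain ⟨σ₁, hσ₁, hsg₁⟩ := exists_sign hS.1 (hs₁.continuousOn.mono hJI₁) hne₁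
  obtain ⟨σ₂, hσ₂, hsg₂⟩ := exists_sign hS'.1 (hs₂.continuousOn.mono hJI₂) hne₂
  have hkx : ∀ x ∈ S'.J, k * x + c ∈ S.J := fun x hx => by rw [hJ] at hx; exact hx
  have hρ : (σ₂ * σ₁ * |k|) ^ 2 = k ^ 2 := by
    rw [mul_pow, mul_pow, sq_sign hσ₁, sq_sign hσ₂, sq_abs]; ring
  have hV := hmax.comp hk hρ c
  rw [← hp, ← norm_sq_scale hP] at hV
  have heqV : EqOn v₂ (fun x => σ₂ * σ₁ * |k| * v (k * x + c)) S'.J := fun x hx => by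
    have h1 := hkx x hx
    simp only
    rw [heq (hJI₁ h1), hsg₂ x hx, habs x hx, hsg₁ _ h1, abs_mul, abs_abs]
    have : |σ₁| = 1 := by rcases hσ₁ with rfl | rfl <;> simp
    have h2 := sq_sign hσ₁
    rw [this]
    linear_combination -σ₂ * |k| * |v₁ (k * x + c)| * h2
  have hJV : S'.J ⊆ (fun x => k * x + c) ⁻¹' I := fun x hx => hsub (hJI₁ (hkx x hx))
  obtain ⟨x₀, hx₀⟩ := hS'.1.2.2
  have hw := (hs₂.mono hJI₂).eqOn_deriv (hV.2.1.mono hJV) hS'.1.1 heqV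
  obtain ⟨h1, h2, -⟩ := hV.eqOn hI₂ hs₂ (hJV hx₀) (hJI₂ hx₀) (heqV hx₀) (hw hx₀)
  refine ⟨|k|, abs_pos.2 hk, ⟨I, v, w, c, σ₂ * σ₁ * |k|, hmax.1, hsub h0, ?_, hmax.2.1,
    by rw [heq h0, hv₁], by rw [hρ, sq_abs], by rw [hp, sq_abs], ?_⟩, ?_⟩
  · have := h1 h0'
    rwa [mem_preimage, mul_zero, zero_add] at this
  · rw [← hv₂, h2 h0']
    simp only [mul_zero, zero_add]
  · rw [hP, ← Complex.ofReal_pow, ← Complex.ofReal_pow, sq_abs]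

theorem exists_belongsTo {v₀ : ℝ} (hH : H ≠ 0) (hE : (p, P, v₀) ∈ E) : ∃ S, IsMaximal H S ∧
    BelongsTo H (p, P, v₀) S ∧ (P.im = 0 → IsRotationalCMC H S) := by
  obtain ⟨I₀, v', w', hI₀, h0, hs, hv0⟩ := exists_sol_local (p := p) (Q := ‖P‖ ^ 2) hE.1
  obtain ⟨I, v, w, hmax, hsub, heq⟩ := exists_maxSol hI₀ hs
  rw [← heq h0] at hv0
  obtain ⟨u, hu, hvu⟩ := hmax.2.1.exists_ne_zero hmax.1 (hsub h0) (fun hh => hE.2 ⟨by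
    simpa using hh.1, by rw [← hv0]; exact hh.2⟩)
  have huW : u ∈ nonvanishing I v := ⟨hu, hvu⟩
  have hUsub := connectedComponentIn_subset (nonvanishing I v) u
  have hUo := isOpenInterval_component (isOpen_nonvanishing hmax.1.1 hmax.2.1.continuousOn) huW
  obtain ⟨w₂, h₂⟩ := (hmax.2.1.mono fun x hx => (hUsub hx).1).posSol hUo fun x hx => (hUsub hx).2
  obtain ⟨S, hSJ, hS, hconf⟩ := exists_surface_of_sol hH hUo h₂ fun x hx => posSol_pos (hUsub hx).2
  refine ⟨S, hconf.isMaximal hH hS (by rw [hSJ]; exact hmax.inextendable huW),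
    (belongsTo_iff hH hS.1.1).2 ⟨I, v, w, hmax.1, hsub h0, hmax.2.1, hv0, ?_, ?_, hconf⟩,
    hconf.isRotationalCMC hH hS⟩
  · rw [hSJ]; exact fun x hx => (hUsub hx).1
  · rw [hSJ]; exact fun x hx => (hUsub hx).2

theorem IsConf.congr (h : IsConf H p P g S) (hg : EqOn g' g S.J) : IsConf H p P g' S := by
  have hSo := h.isOpenInterval
  obtain ⟨⟨N, hN, hP⟩, hpos, w, hw⟩ := h
  refine ⟨⟨N, hN.congr_metric fun x hx => by simp only [hg hx], fun z hz => ?_⟩, fun x hx => ?_, w,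
    hw.congr hSo.1 hg fun _ _ => rfl⟩
  · have := hP z hz
    simp only [← hg hz.1] at this
    exact this
  · rw [hg hx]; exact hpos x hx

/-- A map might be equivariant under several groups; for a rotational surface a rotational one is
selected, so that the conformal coordinates inherit it. -/
theorem exists_equivariance (hS : IsEquivariantCMC H S) : ∃ R, IsEquivariantUnder S R ∧
    (IsRotationalCMC H S → HasAxis R ∨ IsTranslational R) := by
  by_cases h : IsRotationalCMC H S
  · obtain ⟨-, R, hR, hax⟩ := h
    exact ⟨R, hR, fun _ => hax⟩
  · obtain ⟨-, R, hR⟩ := hS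
    exact ⟨R, hR, fun h' => absurd h' h⟩

theorem exists_isConf_rotational (hH : H ≠ 0) (hS : IsEquivariantCMC H S) :
    ∃ U p P g, Congruent U S ∧ IsEquivariantCMC H U ∧ IsConf H p P g U ∧
      (IsRotationalCMC H S → P.im = 0) := by
  obtain ⟨R, hR, hax⟩ := exists_equivariance hS
  obtain ⟨U, hUS, hU, hUR, p, P, g, hconf⟩ := exists_isConf hH hS.1 hR
  exact ⟨U, p, P, g, hUS, ⟨hU, R, hUR⟩, hconf, fun h => hconf.im_eq_zero hH hUR (hax h)⟩

theorem exists_parameter (hH : H ≠ 0) (hS : IsMaximal H S) : ∃ (p : ℝ) (P : ℂ) (v₀ : ℝ) (S' : StripMap),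
    (p, P, v₀) ∈ E ∧ Congruent S S' ∧ IsMaximal H S' ∧ BelongsTo H (p, P, v₀) S' ∧
    (IsRotationalCMC H S → P.im = 0) := by
  obtain ⟨U, p, P, g, hUS, hU, hconf, hrot⟩ := exists_isConf_rotational hH hS.1
  have hUo := hconf.isOpenInterval
  obtain ⟨x₀, hx₀⟩ := hUo.2.2
  obtain ⟨-, hpos, w, hw⟩ := id hconf
  -- A shift in x brings 0 into the interval, so that v₀ can be read off at 0.
  have hs := hw.comp (k := 1) (ρ := 1) rfl x₀
  rw [one_pow, one_pow, one_mul, one_mul] at hs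
  have hJo := hUo.preimage one_ne_zero x₀
  have hpos' : ∀ x ∈ (fun x => 1 * x + x₀) ⁻¹' U.J, 0 < 1 * g (1 * x + x₀) := fun x hx => by
    rw [one_mul]; exact hpos _ hx
  obtain ⟨S', hSJ, hS', hconf'⟩ := exists_surface_of_sol hH hJo hs hpos'
  have hc : Congruent S' U := hconf'.congruent hH hconf one_ne_zero (c := x₀) (ρ := 1) hSJ (by simp)
    rfl fun x _ => rfl
  have hcS : Congruent S S' := (hc.trans hUS hS'.1.1.1).symm hS'.1.1.1
  obtain ⟨w₁, h₁⟩ := hs.posSol hJo fun x hx => (hpos' x hx).ne'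
  have h0 : (0 : ℝ) ∈ (fun x => 1 * x + x₀) ⁻¹' U.J := by simpa using hx₀
  have hp0 := posSol_pos (P := P) (v := fun x => 1 * g (1 * x + x₀)) (hpos' 0 h0).ne'
  refine ⟨p, P, posSol P (fun x => 1 * g (1 * x + x₀)) 0, S', ⟨?_, fun hh => hp0.ne' hh.2⟩, hcS,
    hS.of_congruent hcS hS', ?_, hrot⟩
  · have := (h₁ 0 h0).2.2
    simp only
    rw [← this]
    positivity
  · refine (belongsTo_iff hH hS'.1.1).2 ⟨_, _, w₁, hJo, h0, h₁, rfl, hSJ.le, fun x hx => ?_,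
      hconf'.congr fun x hx => ?_⟩
    · rw [hSJ] at hx
      exact (posSol_pos (hpos' x hx).ne').ne'
    · rw [hSJ] at hx
      exact posSol_posSol_of_pos (hpos' x hx) rfl

/-! ### Extension to maximal surfaces -/

theorem exists_extension (hH : H ≠ 0) (hT : IsEquivariantCMC H T) : ∃ S J, IsMaximal H S ∧
    ExtendsOver T S J ∧ (IsRotationalCMC H T → IsRotationalCMC H S) := by
  obtain ⟨U, p, P, g, hUT, hU, hconf, hrot⟩ := exists_isConf_rotational hH hT
  have hUo := hconf.isOpenInterval
  obtain ⟨-, hpos, w, hw⟩ := id hconf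
  obtain ⟨J', g', w', hJ', hs', hpos', hsub, heq, hi⟩ := exists_inextendable hUo hw hpos
  obtain ⟨S, hSJ, hS, hconf'⟩ := exists_surface_of_sol hH hJ' hs' hpos'
  have hUS : U.J ⊆ S.J := by rw [hSJ]; exact hsub
  have hc : Congruent U ⟨U.J, S.f⟩ := hconf.congruent hH (hconf'.restrict hUo hUS) (k := 1) (c := 0)
    (ρ := 1) one_ne_zero (by simp) (by simp) rfl fun x hx => by simp [heq hx]
  exact ⟨S, U.J, hconf'.isMaximal hH hS (by rw [hSJ]; exact hi),
    ⟨hUS, (hUT.symm hUo).trans hc hT.1.1.1⟩, fun h => hconf'.isRotationalCMC hH hS (hrot h)⟩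

/-- In conformal coordinates the two solutions agree, up to an affine change, on the part coming
from T. Inextendable positive solutions with a common germ coincide. -/
theorem congruent_of_extendsOver (hH : H ≠ 0) (hT : IsOpenInterval T.J) (hS : IsMaximal H S)
    (hS' : IsMaximal H S') (h : ExtendsOver T S J) (h' : ExtendsOver T S' J') : Congruent S S' := by
  obtain ⟨U, p, P, g, hUS, hU, hconf, -⟩ := exists_isConf_rotational hH hS.1
  obtain ⟨U', p', P', g', hUS', hU', hconf', -⟩ := exists_isConf_rotational hH hS'.1
  have hUo := hconf.isOpenInterval
  have hUo' := hconf'.isOpenInterval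
  have hi := hconf.inextendable hH (hS.of_congruent (hUS.symm hUo) hU)
  have hi' := hconf'.inextendable hH (hS'.of_congruent (hUS'.symm hUo') hU')
  obtain ⟨K, hK, hKo, hKJ, -⟩ := hUS.restrict hUo h.1 (h.2.isOpenInterval hT)
  obtain ⟨K', hK', hKo', hKJ', -⟩ := hUS'.restrict hUo' h'.1 (h'.2.isOpenInterval hT)
  have hKK : Congruent ⟨K, U.f⟩ ⟨K', U'.f⟩ :=
    (hKJ.trans ((h.2.symm hT).trans h'.2 (h.2.isOpenInterval hT)) hKo).trans (hKJ'.symm hKo') hKo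
  obtain ⟨k, c, hk, hJ, hP, hp, hg⟩ := hKK.data' hH (hconf.restrict hKo hK)
    (hconf'.restrict hKo' hK')
  obtain ⟨-, hpos, w, hw⟩ := id hconf
  obtain ⟨-, hpos', w', hw'⟩ := id hconf'
  have hi₂ := hi'.comp hk c
  have hs₂ := hw'.comp (k := k) (ρ := |k|) (sq_abs k) c
  rw [← hp, ← norm_sq_scale hP] at hi₂ hs₂
  simp only at hJ hg
  obtain ⟨h1, h2⟩ := hi.eq hi₂ hw hs₂ hpos (fun x hx => mul_pos (abs_pos.2 hk) (hpos' _ hx)) hUo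
    (hUo'.preimage hk c) hKo.1 hKo.2.2 hK (by rw [hJ]; exact preimage_mono hK') fun x hx => hg x hx
  have hUU : Congruent U U' := hconf.congruent hH hconf' hk h1 hP (sq_abs k) h2
  exact ((hUS.symm hUo).trans hUU hS.1.1.1.1).trans hUS' hS.1.1.1.1

end CMC
end

noncomputable section

namespace CMC

open Filter Topology Metric
open scoped NNReal

variable {H : ℝ}

/-! ### Moduli spaces -/

/-- A total correspondence that matches and reflects the relations, and meets every class of the
target, induces a bijection of quotients. -/
theorem exists_quot_equiv {α β : Type*} {r : α → α → Prop} {t : β → β → Prop} (hr : Equivalence r)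
    (ht : Equivalence t) (B : α → β → Prop) (h₁ : ∀ a, ∃ b, B a b)
    (h₂ : ∀ a a' b b', B a b → B a' b' → (r a a' ↔ t b b')) (h₃ : ∀ b, ∃ a b', t b b' ∧ B a b') :
    ∃ Φ : Quot r ≃ Quot t, ∀ a b, B a b → Φ (Quot.mk _ a) = Quot.mk _ b := by
  choose F hF using h₁
  let φ : Quot r → Quot t := Quot.lift (fun a => Quot.mk _ (F a)) fun a a' h =>
    Quot.sound ((h₂ a a' _ _ (hF a) (hF a')).1 h)
  have hφ : ∀ a b, B a b → φ (Quot.mk _ a) = Quot.mk _ b := fun a b hab =>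
    Quot.sound ((h₂ a a _ _ (hF a) hab).1 (hr.refl a))
  refine ⟨Equiv.ofBijective φ ⟨?_, ?_⟩, hφ⟩
  · rintro ⟨a⟩ ⟨a'⟩ h
    exact Quot.sound ((h₂ a a' _ _ (hF a) (hF a')).2 ((ht.quot_mk_eq_iff _ _).1 h))
  · rintro ⟨b⟩
    obtain ⟨a, b', hbb', hab⟩ := h₃ b
    exact ⟨Quot.mk _ a, (hφ a b' hab).trans (Quot.sound (ht.symm hbb'))⟩

theorem norm_ofReal_sq (q : ℝ) : ‖(q : ℂ)‖ ^ 2 = q ^ 2 := by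
  rw [Complex.norm_real, Real.norm_eq_abs, sq_abs]

theorem mem_E_of_mem_R {s : ℝ × ℝ × ℝ} (h : s ∈ R) : (s.1, (s.2.1 : ℂ), s.2.2) ∈ E := by
  refine ⟨?_, fun hh => h.2 ⟨Complex.ofReal_eq_zero.1 hh.1, hh.2⟩⟩
  simp only [norm_ofReal_sq]
  exact h.1

theorem mem_R_of_mem_E {p q v₀ : ℝ} (h : (p, (q : ℂ), v₀) ∈ E) : (p, q, v₀) ∈ R := by
  refine ⟨?_, fun hh => h.2 ⟨by simpa using hh.1, hh.2⟩⟩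
  have := h.1
  simp only [norm_ofReal_sq] at this
  exact this

theorem exists_equivariantImmersion (hH : H ≠ 0) (s : E) :
    ∃ S : EquivariantImmersion H, BelongsTo H s.1 S.1 := by
  obtain ⟨S, hS, hb, -⟩ := exists_belongsTo hH s.2
  exact ⟨⟨S, hS⟩, hb⟩

theorem exists_rotationalImmersion (hH : H ≠ 0) (s : R) :
    ∃ S : RotationalImmersion H, BelongsTo H (s.1.1, (s.1.2.1 : ℂ), s.1.2.2) S.1 := by
  obtain ⟨S, hS, hb, hrot⟩ := exists_belongsTo hH (mem_E_of_mem_R s.2)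
  exact ⟨⟨S, hS, hrot (Complex.ofReal_im _)⟩, hb⟩

theorem exists_equiv_equivariantModuli (hH : H ≠ 0) : ∃ Φ : Quot simE ≃ EquivariantModuli H,
    ∀ (s : E) (S : EquivariantImmersion H), BelongsTo H s.1 S.1 → Φ (Quot.mk _ s) = Quot.mk _ S := by
  refine exists_quot_equiv equivalence_simE (equivalence_congE H) (fun s S => BelongsTo H s.1 S.1)
    (exists_equivariantImmersion hH) (fun s s' S S' hb hb' => ?_) fun S => ?_
  · rw [simE_iff]
    constructor
    · rintro ⟨k, hk, horb, hP⟩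
      exact congruent_of_orb hH S.2 S'.2 hb hb' hk.ne' horb hP
    · exact orb_of_congruent hH S.2.1.1.1 S'.2.1.1.1 hb hb'
  · obtain ⟨p, P, v₀, S', hE, hc, hS', hb, -⟩ := exists_parameter hH S.2
    exact ⟨⟨_, hE⟩, ⟨S', hS'⟩, hc, hb⟩

theorem IsRotationalCMC.isEquivariantCMC {S : StripMap} (h : IsRotationalCMC H S) :
    IsEquivariantCMC H S := by
  obtain ⟨hS, R, hR, -⟩ := h
  exact ⟨hS, R, hR⟩

theorem exists_equiv_rotationalModuli (hH : H ≠ 0) : ∃ Ψ : Quot simR ≃ RotationalModuli H,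
    ∀ (s : R) (S : RotationalImmersion H),
      BelongsTo H (s.1.1, (s.1.2.1 : ℂ), s.1.2.2) S.1 → Ψ (Quot.mk _ s) = Quot.mk _ S := by
  refine exists_quot_equiv equivalence_simR (equivalence_congR H)
    (fun s S => BelongsTo H (s.1.1, (s.1.2.1 : ℂ), s.1.2.2) S.1)
    (exists_rotationalImmersion hH) (fun s s' S S' hb hb' => ?_) fun S => ?_
  · rw [simR_iff]
    constructor
    · rintro ⟨k, hk, horb, hP⟩
      exact congruent_of_orb hH S.2.1 S'.2.1 hb hb' hk.ne' (by rwa [norm_ofReal_sq])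
        (by rw [hP]; push_cast; rfl)
    · intro h
      obtain ⟨k, hk, horb, hP⟩ := orb_of_congruent hH S.2.1.1.1.1 S'.2.1.1.1.1 hb hb' h
      rw [norm_ofReal_sq] at horb
      exact ⟨k, hk, horb, by exact_mod_cast hP⟩
  · obtain ⟨p, P, v₀, S', hE, hc, hS', hb, him⟩ := exists_parameter hH S.2.1
    have hP : ((P.re : ℝ) : ℂ) = P := Complex.ext rfl (by simpa using (him S.2.2).symm)
    rw [← hP] at hE hb
    -- The surface S' is not yet known to be rotational. It is replaced by a rotational one with the
    -- same parameter, to which it is congruent.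
    obtain ⟨U, hU, hb', hrot⟩ := exists_belongsTo hH hE
    exact ⟨⟨(p, P.re, v₀), mem_R_of_mem_E hE⟩, ⟨U, hU, hrot (Complex.ofReal_im _)⟩, hc.trans
      (congruent_of_orb hH hS' hU hb hb' one_ne_zero (Orb.refl hE.1) (by simp)) S.2.1.1.1.1.1, hb'⟩

theorem existsUnique_equivariantModuli (hH : H ≠ 0) (T : StripMap) (hT : IsEquivariantCMC H T) :
    ∃! m : EquivariantModuli H, ∃ (S : EquivariantImmersion H) (J' : Set ℝ),
      m = Quot.mk _ S ∧ ExtendsOver T S.1 J' := by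
  obtain ⟨S, J, hS, hext, -⟩ := exists_extension hH hT
  refine ⟨Quot.mk _ ⟨S, hS⟩, ⟨⟨S, hS⟩, J, rfl, hext⟩, ?_⟩
  rintro _ ⟨S', J', rfl, hext'⟩
  exact Quot.sound (congruent_of_extendsOver hH hT.1.1.1 S'.2 hS hext' hext)

theorem existsUnique_rotationalModuli (hH : H ≠ 0) (T : StripMap) (hT : IsRotationalCMC H T) :
    ∃! m : RotationalModuli H, ∃ (S : RotationalImmersion H) (J' : Set ℝ),
      m = Quot.mk _ S ∧ ExtendsOver T S.1 J' := by
  obtain ⟨S, J, hS, hext, hrot⟩ := exists_extension hH hT.isEquivariantCMC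
  refine ⟨Quot.mk _ ⟨S, hS, hrot hT⟩, ⟨⟨S, hS, hrot hT⟩, J, rfl, hext⟩, ?_⟩
  rintro _ ⟨S', J', rfl, hext'⟩
  exact Quot.sound (congruent_of_extendsOver hH hT.1.1.1 S'.2.1 hS hext' hext)

end CMC
end

theorem theorem5p6 (H : ℝ) (hH : H ≠ 0) :
    -- the relations on the parameter spaces and congruence are equivalence relations
    Equivalence CMC.simE ∧ Equivalence CMC.simR ∧
    Equivalence (CMC.congE H) ∧ Equivalence (CMC.congR H) ∧
    -- the quotients of the parameter spaces are not Hausdorff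
    ¬ T2Space (Quot CMC.simE) ∧ ¬ T2Space (Quot CMC.simR) ∧
    -- `E / ∼` is the moduli space of equivariant immersions
    (∀ s : CMC.E, ∃ S : CMC.EquivariantImmersion H, CMC.BelongsTo H s.1 S.1) ∧
    (∃ Φ : Quot CMC.simE ≃ CMC.EquivariantModuli H,
      ∀ (s : CMC.E) (S : CMC.EquivariantImmersion H),
        CMC.BelongsTo H s.1 S.1 → Φ (Quot.mk _ s) = Quot.mk _ S) ∧
    (∀ T : CMC.StripMap, CMC.IsEquivariantCMC H T →
      ∃! m : CMC.EquivariantModuli H, ∃ (S : CMC.EquivariantImmersion H) (J' : Set ℝ),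
        m = Quot.mk _ S ∧ CMC.ExtendsOver T S.1 J') ∧
    -- `R / ∼` is the moduli space of rotational immersions
    (∀ s : CMC.R, ∃ S : CMC.RotationalImmersion H,
      CMC.BelongsTo H (s.1.1, (s.1.2.1 : ℂ), s.1.2.2) S.1) ∧
    (∃ Ψ : Quot CMC.simR ≃ CMC.RotationalModuli H,
      ∀ (s : CMC.R) (S : CMC.RotationalImmersion H),
        CMC.BelongsTo H (s.1.1, (s.1.2.1 : ℂ), s.1.2.2) S.1 → Ψ (Quot.mk _ s) = Quot.mk _ S) ∧
    (∀ T : CMC.StripMap, CMC.IsRotationalCMC H T →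
      ∃! m : CMC.RotationalModuli H, ∃ (S : CMC.RotationalImmersion H) (J' : Set ℝ),
        m = Quot.mk _ S ∧ CMC.ExtendsOver T S.1 J') := by
  exact ⟨CMC.equivalence_simE, CMC.equivalence_simR, CMC.equivalence_congE H,
    CMC.equivalence_congR H, CMC.not_t2Space_simE, CMC.not_t2Space_simR,
    CMC.exists_equivariantImmersion hH, CMC.exists_equiv_equivariantModuli hH,
    CMC.existsUnique_equivariantModuli hH, CMC.exists_rotationalImmersion hH,
    CMC.exists_equiv_rotationalModuli hH, CMC.existsUnique_rotationalModuli hH⟩
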